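/- **Supercyclidic 3D system.** Work in $\mathbb{RP}^3$. *SC-patches.* A supercyclidic patch (SC-patch) is a patch $f:[0,1]^2\to\mathbb{RP}^3$, given by smooth homogeneous coordinates and bounded by four (regularly and injectively parametrized) arcs of nondegenerate conics, which is a characteristic parametrization of a supercyclide: its parameter lines are arcs of nondegenerate conics, they form a conjugate net ($F_{uv}\in\mathrm{span}(F,F_u,F_v)$ for a homogeneous lift $F$, with $F,F_u,F_v$ linearly independent), and along each parameter line the tangent planes envelop a quadratic cone. Singular patches are admitted: the conditions on parameter lines and on points are required for all parameter values $u$ and $v$ outside finite sets of exceptional values (a point with both $u$ and $v$ exceptional may be undefined). The patch is adapted to the quadrilateral $(f(0,0),f(1,0),f(1,1),f(0,1))$. Patches are considered equal if they differ only by increasing reparametrizations of the two parameter intervals; boundary curves are compared as sets of points. *Cubes.* A Q-cube consists of eight points $x,x_i,x_{ij},x_{123}$ indexed by the vertices of a combinatorial cube such that each face has coplanar vertices. An SC-cube is a Q-cube with an SC-patch adapted to each of the six faces such that for every edge the boundary curves of the two incident patches associated with this edge coincide. *Genericity.* Seven points $x,x_i,x_{ij}$ are called generic if in each of the quadrilaterals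 $(x,x_i,x_{ij},x_j)$ no three vertices are collinear, $x,x_1,x_2,x_3$ are not coplanar, and $x_k,x_{ik},x_{jk},x_{ij}$ are not coplanar for $\{i,j,k\}=\{1,2,3\}$. Admissible data are three SC-patches adapted to quadrilaterals $(x,x_i,x_{ij},x_j)$ with a common vertex $x$, any two of them having a common boundary curve, the one joining $x$ to the shared neighbour $x_i$, such that the seven vertices are generic and for each of the nine boundary curves its supporting plane is different from the planes $x\vee x_i\vee x_j$ and $x_k\vee x_{ik}\vee x_{jk}$ of the two faces of the cube that contain the corresponding edge. **Theorem.** (1) Admissible data determine the three opposite faces: there is an SC-cube of which the three given patches are the faces at $x$, and for any two such SC-cubes the eighth vertices $x_{123}$ coincide and each of the three opposite patches is the same up to reparametrization. (2) Let a Q-cube be given, of which the vertices other than $x_{123}$ are generic. Then there are admissible data adapted to its three faces at $x$, and each choice of such data extends to an SC-cube on this Q-cube, uniquely up to reparametrization of the three opposite patches. -/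

import Mathlib

open Set
open scoped ContDiff LinearAlgebra.Projectivization

noncomputable section

namespace Supercyclidic

/-- Homogeneous coordinate vectors of points of real projective 3-space. -/
abbrev V4 : Type := Fin 4 → ℝ

/-- Real projective 3-space. -/
abbrev RP3 : Type := ℙ ℝ V4

/-! ### Conic arcs, quadratic cones, supercyclidic patches

Curves and surfaces in projective 3-space are given by smooth homogeneous coordinate functions
with values in `V4`; a nonzero vector stands for the point that it spans.  All curves are considered
on the parameter interval `[0,1]` and all patches on the parameter square `[0,1] × [0,1]`. -/

/-- The set of points of projective 3-space traced out by `γ` on `[0,1]`. -/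
def arc (γ : ℝ → V4) : Set RP3 :=
  {p | ∃ t ∈ Icc (0 : ℝ) 1, p.submodule = Submodule.span ℝ {γ t}}

/-- The subspace spanned by the curve `γ` on `[0,1]`; for a conic arc this is its supporting
plane. -/
def supportingPlane (γ : ℝ → V4) : Submodule ℝ V4 :=
  Submodule.span ℝ (γ '' Icc (0 : ℝ) 1)

/-- `γ` is on `[0,1]` a regular and injective parametrization of an arc of a nondegenerate
conic: the conic `B(p,p) = 0` in the plane `P`. -/
structure IsConicArc (γ : ℝ → V4) : Prop where
  regular : ∀ t ∈ Icc (0 : ℝ) 1, LinearIndependent ℝ ![γ t, deriv γ t]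
  injective : ∀ s ∈ Icc (0 : ℝ) 1, ∀ t ∈ Icc (0 : ℝ) 1, s ≠ t →
    LinearIndependent ℝ ![γ s, γ t]
  conic : ∃ (P : Submodule ℝ V4) (B : LinearMap.BilinForm ℝ V4),
    Module.finrank ℝ P = 3 ∧ B.IsSymm ∧ (B.restrict P).Nondegenerate ∧
    ∀ t ∈ Icc (0 : ℝ) 1, γ t ∈ P ∧ B (γ t) (γ t) = 0

/-- Partial derivative with respect to the first parameter. -/
def dU (F : ℝ → ℝ → V4) (u v : ℝ) : V4 := deriv (fun s => F s v) u

/-- Partial derivative with respect to the second parameter. -/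
def dV (F : ℝ → ℝ → V4) (u v : ℝ) : V4 := deriv (fun t => F u t) v

/-- The span of the point and the partial derivatives: the projective tangent plane at a regular
point. -/
def tangentPlane (F : ℝ → ℝ → V4) (u v : ℝ) : Submodule ℝ V4 :=
  Submodule.span ℝ {F u v, dU F u v, dV F u v}

/-- A plane `T` touches the quadratic cone `B(p,p) = 0` along the generator through the
point `p` of the cone, which is not the vertex. -/
def TouchesConeAt (B : LinearMap.BilinForm ℝ V4) (p : V4) (T : Submodule ℝ V4) : Prop :=
  B p p = 0 ∧ p ∉ LinearMap.ker B ∧ T = LinearMap.ker (B p)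

/-- `B(p,p) = 0` is a quadratic cone in projective 3-space: a quadric with exactly one singular
point, the vertex. -/
def IsQuadraticCone (B : LinearMap.BilinForm ℝ V4) : Prop :=
  B.IsSymm ∧ Module.finrank ℝ (LinearMap.ker B) = 1

/-- The parametrized surface `F` is a regular characteristic parametrization of a supercyclide on
the product `I₁ × I₂` of two subsets of `[0,1]`: it is an immersion, its parameter lines form a
conjugate net, they are conics, and the tangent planes along each of them envelop a quadratic
cone. -/
structure IsCharacteristicOn (F : ℝ → ℝ → V4) (I₁ I₂ : Set ℝ) : Prop where
  immersion : ∀ u ∈ I₁, ∀ v ∈ I₂, LinearIndependent ℝ ![F u v, dU F u v, dV F u v]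
  conjugate : ∀ u ∈ I₁, ∀ v ∈ I₂, dU (dV F) u v ∈ tangentPlane F u v
  conicU : ∀ v ∈ I₂, IsConicArc (fun u => F u v)
  conicV : ∀ u ∈ I₁, IsConicArc (fun v => F u v)
  coneU : ∀ v ∈ I₂, ∃ B, IsQuadraticCone B ∧ ∀ u ∈ I₁, TouchesConeAt B (F u v) (tangentPlane F u v)
  coneV : ∀ u ∈ I₁, ∃ B, IsQuadraticCone B ∧ ∀ v ∈ I₂, TouchesConeAt B (F u v) (tangentPlane F u v)

/-- A supercyclidic patch: a smooth patch, bounded by four conic arcs, that is a characteristic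
parametrization of a supercyclide.

Patches may have singularities, as is unavoidable (an open set of patches has them): characteristic
conics of one family may shrink to a point where the conics of the other family cross their
characteristic line, or the tangent plane may be constant along a conic (as along the top circle of
a torus).  So finitely many exceptional parameter values `E₁`, `E₂` are admitted in each direction.
Note that `F u v` is still nonzero unless both `u` and `v` are exceptional, since all other
parameter lines are conic arcs on the whole interval `[0,1]`. A patch with `E₁ = E₂ = ∅` is a
regular patch. -/
structure IsSCPatch (F : ℝ → ℝ → V4) : Prop where
  smooth : ContDiff ℝ ∞ (fun p : ℝ × ℝ => F p.1 p.2)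
  boundaryU0 : IsConicArc (fun u => F u 0)
  boundaryU1 : IsConicArc (fun u => F u 1)
  boundaryV0 : IsConicArc (fun v => F 0 v)
  boundaryV1 : IsConicArc (fun v => F 1 v)
  characteristic : ∃ E₁ E₂ : Set ℝ, E₁.Finite ∧ E₂.Finite ∧
    IsCharacteristicOn F (Icc (0 : ℝ) 1 \ E₁) (Icc (0 : ℝ) 1 \ E₂)

/-- The patch `F` has the vertex quadrilateral `(p, p₁, p₁₂, p₂)`. -/
def HasVertices (F : ℝ → ℝ → V4) (p p₁ p₁₂ p₂ : RP3) : Prop :=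
  p.submodule = Submodule.span ℝ {F 0 0} ∧ p₁.submodule = Submodule.span ℝ {F 1 0} ∧
  p₁₂.submodule = Submodule.span ℝ {F 1 1} ∧ p₂.submodule = Submodule.span ℝ {F 0 1}

/-- `F` is a supercyclidic patch adapted to the quadrilateral `(p, p₁, p₁₂, p₂)`. -/
def IsAdaptedSCPatch (F : ℝ → ℝ → V4) (p p₁ p₁₂ p₂ : RP3) : Prop :=
  IsSCPatch F ∧ HasVertices F p p₁ p₁₂ p₂

/-- `F` and `G` are the same patch of projective 3-space, up to an orientation preserving
reparametrization of each of the two parameter intervals (zeros of the homogeneous coordinates do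
not represent points). -/
def SamePatch (F G : ℝ → ℝ → V4) : Prop :=
  ∃ φ ψ : unitInterval ≃o unitInterval, ∀ u v : unitInterval,
    F u v ≠ 0 → G (φ u) (ψ v) ≠ 0 →
      Submodule.span ℝ {F u v} = Submodule.span ℝ {G (φ u) (ψ v)}

/-! ### Q-cubes and SC-cubes

The vertices of a combinatorial cube are the functions `z : Fin 3 → Fin 2`.  Directions are
elements of `Fin 3` and are counted cyclically.  The face `(k, ε)` consists of the vertices with
`z k = ε`; its first direction is `k + 1` and its second direction is `k + 2`. -/

/-- The vertex of the face `(k, ε)` with coordinates `s`, `t` in the directions `k + 1`,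
`k + 2`. -/
def cubeVertex (k : Fin 3) (ε s t : Fin 2) : Fin 3 → Fin 2 :=
  fun i => if i = k then ε else if i = k + 1 then s else t

/-- A Q-cube: a cube in projective 3-space with planar faces. -/
def IsQCube (X : (Fin 3 → Fin 2) → RP3) : Prop :=
  ∀ (k : Fin 3) (ε : Fin 2), Projectivization.Dependent
    ![X (cubeVertex k ε 0 0), X (cubeVertex k ε 1 0), X (cubeVertex k ε 1 1), X (cubeVertex k ε 0 1)]

/-- An SC-cube: a Q-cube `X` with a supercyclidic patch `F k ε` adapted to each face `(k, ε)`, such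
that for each edge the boundary curves of the two incident patches associated with the edge coincide.
The edge of direction `i` with coordinates `a`, `b` in the directions `i + 1`, `i + 2` belongs
to the faces `(i + 2, b)` and `(i + 1, a)`. -/
structure IsSCCube (X : (Fin 3 → Fin 2) → RP3) (F : Fin 3 → Fin 2 → ℝ → ℝ → V4) : Prop where
  planar : IsQCube X
  adapted : ∀ k ε, IsAdaptedSCPatch (F k ε)
    (X (cubeVertex k ε 0 0)) (X (cubeVertex k ε 1 0)) (X (cubeVertex k ε 1 1))
    (X (cubeVertex k ε 0 1))
  commonBoundary : ∀ (i : Fin 3) (a b : Fin 2),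
    arc (fun t => F (i + 2) b t (a.val : ℝ)) = arc (fun t => F (i + 1) a (b.val : ℝ) t)

/-! ### Cauchy data at one vertex

`x` is a vertex, `x₁ k` its neighbour in direction `k`, and `x₂ k` the vertex that is opposite to
`x` in the face spanned by the directions `k + 1` and `k + 2`. -/

/-- The seven vertices are in general position: the vertices of the three faces at `x` are
pairwise distinct and no three of them are collinear, the vertices `x, x₁ 0, x₁ 1, x₁ 2` are not
coplanar, and the plane through `x₁ k` and its two neighbours other than `x` does not contain the
remaining one of the points `x₂`. -/
def VerticesGeneric (x : RP3) (x₁ x₂ : Fin 3 → RP3) : Prop :=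
  (∀ k : Fin 3, Projectivization.Independent ![x, x₁ (k + 1), x₁ (k + 2)] ∧
    Projectivization.Independent ![x, x₁ (k + 1), x₂ k] ∧
    Projectivization.Independent ![x, x₁ (k + 2), x₂ k] ∧
    Projectivization.Independent ![x₁ (k + 1), x₁ (k + 2), x₂ k]) ∧
  Projectivization.Independent ![x, x₁ 0, x₁ 1, x₁ 2] ∧
  ∀ k : Fin 3, Projectivization.Independent ![x₁ k, x₂ (k + 1), x₂ (k + 2), x₂ k]

/-- The plane of the face at `x` with normal direction `k`. -/
def nearPlane (x : RP3) (x₁ : Fin 3 → RP3) (k : Fin 3) : Submodule ℝ V4 :=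
  x.submodule ⊔ (x₁ (k + 1)).submodule ⊔ (x₁ (k + 2)).submodule

/-- The plane of the opposite face with normal direction `k`; it is spanned by `x₁ k` and its two
neighbours other than `x`. -/
def farPlane (x₁ x₂ : Fin 3 → RP3) (k : Fin 3) : Submodule ℝ V4 :=
  (x₁ k).submodule ⊔ (x₂ (k + 1)).submodule ⊔ (x₂ (k + 2)).submodule

/-- Three generic supercyclidic patches `f k` at one common vertex `x`, cyclically sharing a common
boundary curve each: `f k` is adapted to the face with normal direction `k`, and
for each direction `i` the patches `f (i + 2)` and `f (i + 1)` have a common boundary curve that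
joins `x` and `x₁ i`.

Genericity means that the vertices are in general position and that no boundary plane is the plane of
one of the two faces incident with its edge (that is, it contains no Laplace point of these faces
other than the one on its edge). -/
structure IsCauchyData (x : RP3) (x₁ x₂ : Fin 3 → RP3) (f : Fin 3 → ℝ → ℝ → V4) : Prop where
  adapted : ∀ k, IsAdaptedSCPatch (f k) x (x₁ (k + 1)) (x₂ k) (x₁ (k + 2))
  commonBoundary : ∀ i, arc (fun t => f (i + 2) t 0) = arc (fun t => f (i + 1) 0 t)
  vertices : VerticesGeneric x x₁ x₂
  planesNear : ∀ k,
    supportingPlane (fun t => f k t 0) ≠ nearPlane x x₁ k ∧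
    supportingPlane (fun t => f k t 1) ≠ nearPlane x x₁ k ∧
    supportingPlane (fun t => f k 0 t) ≠ nearPlane x x₁ k ∧
    supportingPlane (fun t => f k 1 t) ≠ nearPlane x x₁ k
  planesFar : ∀ k,
    supportingPlane (fun t => f k t 1) ≠ farPlane x₁ x₂ (k + 2) ∧
    supportingPlane (fun t => f k 1 t) ≠ farPlane x₁ x₂ (k + 1)

/-- The vertex `x` of a cube. -/
def vertex0 (X : (Fin 3 → Fin 2) → RP3) : RP3 := X 0

/-- The vertices `x₁ k` of a cube. -/
def vertex1 (X : (Fin 3 → Fin 2) → RP3) (k : Fin 3) : RP3 := X (Function.update 0 k 1)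

/-- The vertices `x₂ k` of a cube. -/
def vertex2 (X : (Fin 3 → Fin 2) → RP3) (k : Fin 3) : RP3 := X (Function.update 1 k 0)

end Supercyclidic

end

namespace Supercyclidic

open Module Filter Topology

/-! ### Linear algebra in the space of homogeneous coordinates -/

/-! The whole theorem reduces to perspectivities between boundary conics.

Let the tangent planes along a parameter line envelop a cone with vertex `w`. Projecting from `w`
onto the plane of the conic and differentiating, conjugacy forces every cross derivative to be a
combination of the surface point and `w` (`IsRegularPatch.exists_apex`). The vertices of the cones
along the lines of one family lie on tangents to the lines of the other family, and they span a line
`A`: the planes of the second family form a pencil about this characteristic line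
(`IsRegularPatch.exists_axis`). A chord joining corresponding points of two lines of the first
family lies in a plane of the pencil, so it meets `A`; the derivative of the intersection point is
parallel to it, hence the point is fixed (`IsRegularPatch.exists_perspective`). Opposite boundary
curves are therefore perspective from the Laplace point, where the two sides of the quadrilateral
that join them meet.

Two consequences concern a single patch. First, it is determined by its boundary: a general point is
the intersection of two lines, each through a boundary point and a centre, and the centres are fixed
by the boundary planes (`IsSCPatch.samePatch_of_boundary`). Second, two conic arcs through a vertex
and two perspectivities that close up at the opposite vertex always bound a patch, a projective
image of a translation surface (`exists_patch`).

In the cube, fix a direction. All four Laplace points belonging to it lie on the line `M` in which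
the near and the far face plane meet. The first edge reaches the last one along two paths of two
perspectivities, and each composite is the identity modulo `M`. Uniqueness: composites of this form
with the same image arc agree on the plane of the first conic (`eq_on_plane_of_arcMap`), so two
candidates for the last edge differ by vectors lying in both last centres, that is by zero
(`last_edge_unique`). Existence: expressing the first two centres in the last two gives forms for
which the paths agree (`exists_closing_forms`), and the corners are then automatically correct
(`exists_last_edge`). Doing this in all three directions and applying `exists_patch` gives the
opposite patches; the eighth vertex is the common point of the three far planes. For the existence
of data on a given Q-cube, conics in Bézier form are used whose control points avoid the relevant
face planes.

Exceptional parameters are handled by closedness of linear dependence, and by the fact that a linear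
form restricted to a conic has only zeros of finite order, so that ratios of functions continue
through zeros. -/

theorem indep_pair_iff {a b : V4} :
    LinearIndependent ℝ ![a, b] ↔ ∀ s t : ℝ, s • a + t • b = 0 → s = 0 ∧ t = 0 :=
  LinearIndependent.pair_iff

theorem indep_triple_iff {a b c : V4} : LinearIndependent ℝ ![a, b, c] ↔
    ∀ r s t : ℝ, r • a + s • b + t • c = 0 → r = 0 ∧ s = 0 ∧ t = 0 := by
  rw [Fintype.linearIndependent_iff]
  constructor
  · intro h r s t e
    have := h ![r, s, t] (by simpa [Fin.sum_univ_succ, add_assoc] using e)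
    exact ⟨this 0, this 1, this 2⟩
  · intro h g e
    obtain ⟨h0, h1, h2⟩ := h (g 0) (g 1) (g 2) (by simpa [Fin.sum_univ_succ, add_assoc] using e)
    intro i; fin_cases i <;> assumption

theorem indep_quad_iff {a b c d : V4} : LinearIndependent ℝ ![a, b, c, d] ↔
    ∀ r s t w : ℝ, r • a + s • b + t • c + w • d = 0 → r = 0 ∧ s = 0 ∧ t = 0 ∧ w = 0 := by
  rw [Fintype.linearIndependent_iff]
  constructor
  · intro h r s t w e
    have := h ![r, s, t, w] (by simpa [Fin.sum_univ_succ, add_assoc] using e)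
    exact ⟨this 0, this 1, this 2, this 3⟩
  · intro h g e
    obtain ⟨h0, h1, h2, h3⟩ := h (g 0) (g 1) (g 2) (g 3)
      (by simpa [Fin.sum_univ_succ, add_assoc] using e)
    intro i; fin_cases i <;> assumption

theorem indep_triple_of_notMem {a b c : V4} (h : LinearIndependent ℝ ![a, b])
    (hc : c ∉ Submodule.span ℝ {a, b}) : LinearIndependent ℝ ![a, b, c] := by
  rw [indep_triple_iff]
  intro r s t e
  have ht : t = 0 := by
    by_contra ht
    refine hc (Submodule.mem_span_pair.2 ⟨-(t⁻¹ * r), -(t⁻¹ * s), ?_⟩)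
    have : c = t⁻¹ • (t • c) := by rw [smul_smul, inv_mul_cancel₀ ht, one_smul]
    rw [this, show t • c = -(r • a + s • b) from eq_neg_of_add_eq_zero_right e]
    module
  subst ht
  obtain ⟨h1, h2⟩ := indep_pair_iff.1 h r s (by simpa using e)
  exact ⟨h1, h2, rfl⟩

theorem notMem_span_pair {a b c : V4} (h : LinearIndependent ℝ ![a, b, c]) :
    c ∉ Submodule.span ℝ {a, b} := by
  intro hc
  obtain ⟨r, s, e⟩ := Submodule.mem_span_pair.1 hc
  have := (indep_triple_iff.1 h r s (-1) (by rw [e]; module)).2.2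
  norm_num at this

theorem indep_quad_of_notMem {a b c d : V4} (h : LinearIndependent ℝ ![a, b, c])
    (hd : d ∉ Submodule.span ℝ {a, b, c}) : LinearIndependent ℝ ![a, b, c, d] := by
  rw [indep_quad_iff]
  intro r s t w e
  have hw : w = 0 := by
    by_contra hw
    refine hd (Submodule.mem_span_triple.2 ⟨-(w⁻¹ * r), -(w⁻¹ * s), -(w⁻¹ * t), ?_⟩)
    have : d = w⁻¹ • (w • d) := by rw [smul_smul, inv_mul_cancel₀ hw, one_smul]
    rw [this, show w • d = -(r • a + s • b + t • c) from eq_neg_of_add_eq_zero_right e]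
    module
  subst hw
  obtain ⟨h1, h2, h3⟩ := indep_triple_iff.1 h r s t (by simpa using e)
  exact ⟨h1, h2, h3, rfl⟩

theorem notMem_span_triple {a b c d : V4} (h : LinearIndependent ℝ ![a, b, c, d]) :
    d ∉ Submodule.span ℝ {a, b, c} := by
  intro hd
  obtain ⟨r, s, t, e⟩ := Submodule.mem_span_triple.1 hd
  have := (indep_quad_iff.1 h r s t (-1) (by rw [e]; module)).2.2.2
  norm_num at this

theorem indep_pair_of_ne {a b : V4} (ha : a ≠ 0) (h : b ∉ Submodule.span ℝ {a}) :
    LinearIndependent ℝ ![a, b] := by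
  rw [indep_pair_iff]
  intro s t e
  have ht : t = 0 := by
    by_contra ht
    refine h (Submodule.mem_span_singleton.2 ⟨-(t⁻¹ * s), ?_⟩)
    have : b = t⁻¹ • (t • b) := by rw [smul_smul, inv_mul_cancel₀ ht, one_smul]
    rw [this, show t • b = -(s • a) from eq_neg_of_add_eq_zero_right e]
    module
  subst ht
  refine ⟨?_, rfl⟩
  simpa [ha] using e

theorem left_ne_zero_of_indep {a b : V4} (h : LinearIndependent ℝ ![a, b]) : a ≠ 0 := h.ne_zero 0

theorem right_ne_zero_of_indep {a b : V4} (h : LinearIndependent ℝ ![a, b]) : b ≠ 0 := h.ne_zero 1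

theorem finrank_span_pair {a b : V4} (h : LinearIndependent ℝ ![a, b]) :
    finrank ℝ (Submodule.span ℝ {a, b}) = 2 := by
  have := finrank_span_eq_card h
  rwa [show range ![a, b] = {a, b} by
    ext x; simp [eq_comm]; tauto, Fintype.card_fin] at this

theorem finrank_span_triple {a b c : V4} (h : LinearIndependent ℝ ![a, b, c]) :
    finrank ℝ (Submodule.span ℝ {a, b, c}) = 3 := by
  have := finrank_span_eq_card h
  rwa [show range ![a, b, c] = {a, b, c} by
    ext x; simp [eq_comm]; tauto, Fintype.card_fin] at this

theorem span_pair_le {W : Submodule ℝ V4} {a b : V4} (ha : a ∈ W) (hb : b ∈ W) :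
    Submodule.span ℝ {a, b} ≤ W :=
  Submodule.span_le.2 (by rintro x (rfl | rfl) <;> assumption)

theorem span_triple_le {W : Submodule ℝ V4} {a b c : V4} (ha : a ∈ W) (hb : b ∈ W) (hc : c ∈ W) :
    Submodule.span ℝ {a, b, c} ≤ W :=
  Submodule.span_le.2 (by rintro x (rfl | rfl | rfl) <;> assumption)

theorem span_pair_eq {W : Submodule ℝ V4} (hW : finrank ℝ W = 2) {a b : V4} (ha : a ∈ W)
    (hb : b ∈ W) (h : LinearIndependent ℝ ![a, b]) : Submodule.span ℝ {a, b} = W :=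
  Submodule.eq_of_le_of_finrank_eq (span_pair_le ha hb) (by rw [finrank_span_pair h, hW])

theorem span_triple_eq {W : Submodule ℝ V4} (hW : finrank ℝ W = 3) {a b c : V4} (ha : a ∈ W)
    (hb : b ∈ W) (hc : c ∈ W) (h : LinearIndependent ℝ ![a, b, c]) :
    Submodule.span ℝ {a, b, c} = W :=
  Submodule.eq_of_le_of_finrank_eq (span_triple_le ha hb hc) (by rw [finrank_span_triple h, hW])

theorem exists_form_notMem {W : Submodule ℝ V4} {a : V4} (ha : a ∉ W) :
    ∃ n : V4 →ₗ[ℝ] ℝ, n a = 1 ∧ ∀ p ∈ W, n p = 0 := by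
  obtain ⟨f, hf, hW⟩ := Submodule.exists_le_ker_of_notMem ha
  exact ⟨(f a)⁻¹ • f, by simp [hf], fun p hp => by simp [LinearMap.mem_ker.1 (hW hp)]⟩

theorem finrank_ker_form {n : V4 →ₗ[ℝ] ℝ} (hn : n ≠ 0) : finrank ℝ (LinearMap.ker n) = 3 := by
  have := Module.Dual.finrank_ker_add_one_of_ne_zero (f := n) hn
  simpa using this

theorem exists_ker_eq {P : Submodule ℝ V4} (hP : finrank ℝ P = 3) :
    ∃ n : V4 →ₗ[ℝ] ℝ, LinearMap.ker n = P := by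
  have : P < ⊤ := lt_top_iff_ne_top.2 (by rintro rfl; simp at hP)
  obtain ⟨n, hn, hle⟩ := Submodule.exists_le_ker_of_lt_top P this
  exact ⟨n, (Submodule.eq_of_le_of_finrank_eq hle (by rw [hP, finrank_ker_form hn])).symm⟩

theorem exists_ker_eq_of_notMem {P : Submodule ℝ V4} (hP : finrank ℝ P = 3) {a : V4}
    (ha : a ∉ P) : ∃ n : V4 →ₗ[ℝ] ℝ, n a = 1 ∧ ∀ p, n p = 0 ↔ p ∈ P := by
  obtain ⟨n, hn⟩ := exists_ker_eq hP
  have hna : n a ≠ 0 := fun h => ha (hn ▸ LinearMap.mem_ker.2 h)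
  refine ⟨(n a)⁻¹ • n, by simp [hna], fun p => ?_⟩
  rw [← hn]
  simp [hna]

theorem span_singleton_eq_iff {p q : V4} :
    Submodule.span ℝ {p} = Submodule.span ℝ {q} ↔ ∃ c : ℝ, c ≠ 0 ∧ p = c • q := by
  rw [eq_comm, Submodule.span_singleton_eq_span_singleton]
  constructor
  · rintro ⟨z, rfl⟩
    exact ⟨z, z.ne_zero, rfl⟩
  · rintro ⟨c, hc, rfl⟩
    exact ⟨Units.mk0 c hc, rfl⟩

theorem span_smul_eq {c : ℝ} (hc : c ≠ 0) (p : V4) :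
    Submodule.span ℝ {c • p} = Submodule.span ℝ {p} :=
  span_singleton_eq_iff.2 ⟨c, hc, rfl⟩

theorem ne_zero_of_span_eq {p q : V4} (h : Submodule.span ℝ {p} = Submodule.span ℝ {q})
    (hp : p ≠ 0) : q ≠ 0 := by
  rintro rfl
  obtain ⟨c, -, e⟩ := span_singleton_eq_iff.1 h
  exact hp (by simpa using e)

theorem mem_iff_of_span_eq {p q : V4} (h : Submodule.span ℝ {p} = Submodule.span ℝ {q})
    (W : Submodule ℝ V4) : p ∈ W ↔ q ∈ W := by
  rw [← Submodule.span_singleton_le_iff_mem, h, Submodule.span_singleton_le_iff_mem]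

/-- Two dependent nonzero vectors span the same line. -/
theorem span_eq_of_dep {p q : V4} (hp : p ≠ 0) (hq : q ≠ 0)
    (h : ¬ LinearIndependent ℝ ![p, q]) : Submodule.span ℝ {p} = Submodule.span ℝ {q} := by
  have : q ∈ Submodule.span ℝ {p} := by
    by_contra hq'
    exact h (indep_pair_of_ne hp hq')
  obtain ⟨c, rfl⟩ := Submodule.mem_span_singleton.1 this
  exact (span_smul_eq (by rintro rfl; simp at hq) p).symm

/-- Two planes with the same three independent vectors coincide. -/
theorem plane_eq {P Q : Submodule ℝ V4} (hP : finrank ℝ P = 3) (hQ : finrank ℝ Q = 3) {a b c : V4}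
    (h : LinearIndependent ℝ ![a, b, c]) (haP : a ∈ P) (hbP : b ∈ P) (hcP : c ∈ P)
    (haQ : a ∈ Q) (hbQ : b ∈ Q) (hcQ : c ∈ Q) : P = Q := by
  rw [← span_triple_eq hP haP hbP hcP h, ← span_triple_eq hQ haQ hbQ hcQ h]

/-- The intersection of two different planes is a line. -/
theorem finrank_inf {P Q : Submodule ℝ V4} (hP : finrank ℝ P = 3) (hQ : finrank ℝ Q = 3)
    (h : P ≠ Q) : finrank ℝ (P ⊓ Q : Submodule ℝ V4) = 2 := by
  have h1 := Submodule.finrank_sup_add_finrank_inf_eq P Q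
  have h2 : finrank ℝ (P ⊔ Q : Submodule ℝ V4) ≤ 4 := by
    simpa using Submodule.finrank_le (P ⊔ Q)
  have h3 : P < P ⊔ Q := by
    refine lt_of_le_of_ne le_sup_left fun e => h ?_
    have : Q ≤ P := by rw [e]; exact le_sup_right
    exact (Submodule.eq_of_le_of_finrank_eq this (by rw [hP, hQ])).symm
  have h4 := Submodule.finrank_lt_finrank_of_lt h3
  omega

/-- The intersection of a plane with a line that it does not contain is a point. -/
theorem finrank_inf_line {P A : Submodule ℝ V4} (hP : finrank ℝ P = 3) (hA : finrank ℝ A = 2)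
    (h : ¬ A ≤ P) : finrank ℝ (A ⊓ P : Submodule ℝ V4) = 1 := by
  have h1 := Submodule.finrank_sup_add_finrank_inf_eq A P
  have h2 : finrank ℝ (A ⊔ P : Submodule ℝ V4) ≤ 4 := by
    simpa using Submodule.finrank_le (A ⊔ P)
  have h3 : P < A ⊔ P := by
    refine lt_of_le_of_ne le_sup_right fun e => h ?_
    rw [e]; exact le_sup_left
  have h4 := Submodule.finrank_lt_finrank_of_lt h3
  omega

theorem dep_of_finrank_one {W : Submodule ℝ V4} (hW : finrank ℝ W ≤ 1) {a b : V4} (ha : a ∈ W)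
    (hb : b ∈ W) : ¬ LinearIndependent ℝ ![a, b] := by
  intro h
  have := Submodule.finrank_mono (span_pair_le ha hb)
  rw [finrank_span_pair h] at this
  omega

theorem indep_pair_of_triple {a b c : V4} (h : LinearIndependent ℝ ![a, b, c]) :
    LinearIndependent ℝ ![a, b] := by
  rw [indep_pair_iff]; intro s t e
  obtain ⟨h1, h2, -⟩ := indep_triple_iff.1 h s t 0 (by simpa using e)
  exact ⟨h1, h2⟩

theorem indep_swap_of_triple {a b c : V4} (h : LinearIndependent ℝ ![a, b, c]) :
    LinearIndependent ℝ ![a, c, b] := by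
  rw [indep_triple_iff]; intro r s t e
  obtain ⟨h1, h2, h3⟩ := indep_triple_iff.1 h r t s (by rw [← e]; abel)
  exact ⟨h1, h3, h2⟩

theorem indep_rotate_of_triple {a b c : V4} (h : LinearIndependent ℝ ![a, b, c]) :
    LinearIndependent ℝ ![b, c, a] := by
  rw [indep_triple_iff]; intro r s t e
  obtain ⟨h1, h2, h3⟩ := indep_triple_iff.1 h t r s (by rw [← e]; abel)
  exact ⟨h2, h3, h1⟩

/-! ### Derivatives and limits -/

theorem hasDerivAt_map {W : Type*} [NormedAddCommGroup W] [NormedSpace ℝ W] (L : V4 →ₗ[ℝ] W)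
    {γ : ℝ → V4} {γ' : V4} {t : ℝ} (h : HasDerivAt γ γ' t) :
    HasDerivAt (fun s => L (γ s)) (L γ') t :=
  L.toContinuousLinearMap.hasFDerivAt.comp_hasDerivAt t h

theorem contDiff_map {W E : Type*} [NormedAddCommGroup W] [NormedSpace ℝ W] [NormedAddCommGroup E]
    [NormedSpace ℝ E] (L : V4 →ₗ[ℝ] W) {γ : E → V4} (h : ContDiff ℝ ∞ γ) :
    ContDiff ℝ ∞ (fun s => L (γ s)) :=
  L.toContinuousLinearMap.contDiff.comp h

theorem hasDerivAt_bilin (B : LinearMap.BilinForm ℝ V4) {γ δ : ℝ → V4} {γ' δ' : V4} {t : ℝ}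
    (h : HasDerivAt γ γ' t) (k : HasDerivAt δ δ' t) :
    HasDerivAt (fun s => B (γ s) (δ s)) (B γ' (δ t) + B (γ t) δ') t := by
  have hc := B.toContinuousBilinearMap.isBoundedBilinearMap.hasFDerivAt (γ t, δ t)
  have := hc.comp_hasDerivAt t (h.prodMk k)
  simpa [add_comm, Function.comp_def] using this

theorem deriv_mem_of_eventually {f : ℝ → V4} {t : ℝ} {W : Submodule ℝ V4}
    (hf : DifferentiableAt ℝ f t) (h : ∀ᶠ s in 𝓝 t, f s ∈ W) : deriv f t ∈ W := by
  by_contra hW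
  obtain ⟨n, hn, hnW⟩ := exists_form_notMem hW
  have h1 := hasDerivAt_map n hf.hasDerivAt
  have h2 : (fun s => n (f s)) =ᶠ[𝓝 t] fun _ => 0 := h.mono fun s hs => hnW _ hs
  have h3 := h1.unique ((hasDerivAt_const t (0 : ℝ)).congr_of_eventuallyEq h2)
  rw [hn] at h3
  norm_num at h3

theorem Icc_subset_closure_diff {E : Set ℝ} (hE : E.Finite) :
    Icc (0 : ℝ) 1 ⊆ closure (Ioo (0 : ℝ) 1 \ E) := by
  rw [← closure_Ioo (zero_ne_one' ℝ)]
  refine closure_minimal ?_ isClosed_closure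
  have hd : Dense (Eᶜ : Set ℝ) := hE.countable.dense_compl ℝ
  exact hd.open_subset_closure_inter isOpen_Ioo

/-- Linear independence is an open condition. Incidences proved off the exceptional parameters pass
to the limit in this way. -/
theorem not_linearIndependent_of_mem_closure {X ι : Type*} [TopologicalSpace X] [Finite ι]
    {f : X → ι → V4} (hf : Continuous f) {S : Set X} (h : ∀ s ∈ S, ¬ LinearIndependent ℝ (f s))
    {t : X} (ht : t ∈ closure S) : ¬ LinearIndependent ℝ (f t) := by
  have hc : IsClosed {s | ¬ LinearIndependent ℝ (f s)} :=
    (isOpen_setOfPred_linearIndependent.preimage hf).isClosed_compl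
  exact closure_minimal h hc ht

theorem continuous_pair {X : Type*} [TopologicalSpace X] {a b : X → V4} (ha : Continuous a)
    (hb : Continuous b) : Continuous fun x => ![a x, b x] := by
  refine continuous_pi fun i => ?_
  fin_cases i <;> assumption

theorem continuous_triple {X : Type*} [TopologicalSpace X] {a b c : X → V4} (ha : Continuous a)
    (hb : Continuous b) (hc : Continuous c) : Continuous fun x => ![a x, b x, c x] := by
  refine continuous_pi fun i => ?_
  fin_cases i <;> assumption

theorem continuous_quad {X : Type*} [TopologicalSpace X] {a b c d : X → V4} (ha : Continuous a)
    (hb : Continuous b) (hc : Continuous c) (hd : Continuous d) :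
    Continuous fun x => ![a x, b x, c x, d x] := by
  refine continuous_pi fun i => ?_
  fin_cases i <;> assumption

/-! ### Conic arcs -/

/-- A symmetric bilinear form that is nondegenerate on the plane `P`. -/
structure IsConicForm (P : Submodule ℝ V4) (C : LinearMap.BilinForm ℝ V4) : Prop where
  symm : ∀ p q, C p q = C q p
  nondeg : ∀ p ∈ P, (∀ q ∈ P, C p q = 0) → p = 0

theorem exists_mem_notMem {P W : Submodule ℝ V4} (h : finrank ℝ W < finrank ℝ P) :
    ∃ p ∈ P, p ∉ W := by
  by_contra! hc
  have := Submodule.finrank_mono (show P ≤ W from hc)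
  omega

/-- A nondegenerate form in dimension three has no totally isotropic line. For `r` off such a line,
`C(q,r) p - C(p,r) q` would lie in the radical, hence `C(p,r) = 0`, and then `p` itself would. -/
theorem IsConicForm.not_isotropic {P : Submodule ℝ V4} {C : LinearMap.BilinForm ℝ V4}
    (h : IsConicForm P C) (hP : finrank ℝ P = 3) {p q : V4} (hp : p ∈ P) (hq : q ∈ P)
    (hpq : LinearIndependent ℝ ![p, q]) (h1 : C p p = 0) (h2 : C p q = 0) : C q q ≠ 0 := by
  intro h3
  obtain ⟨r, hr, hr'⟩ := exists_mem_notMem (P := P) (W := Submodule.span ℝ {p, q})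
    (by rw [finrank_span_pair hpq, hP]; norm_num)
  have h3r := indep_triple_of_notMem hpq hr'
  have hspan := span_triple_eq hP hp hq hr h3r
  have key : (C q r) • p - (C p r) • q = 0 := by
    refine h.nondeg _ (P.sub_mem (P.smul_mem _ hp) (P.smul_mem _ hq)) fun x hx => ?_
    rw [← hspan] at hx
    obtain ⟨a, b, c, rfl⟩ := Submodule.mem_span_triple.1 hx
    simp only [map_add, map_sub, map_smul, LinearMap.sub_apply, LinearMap.smul_apply, smul_eq_mul,
      h1, h2, h3, h.symm q p]
    ring
  obtain ⟨e1, e2⟩ := indep_pair_iff.1 hpq (C q r) (-(C p r)) (by rw [← key]; module)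
  refine left_ne_zero_of_indep hpq (h.nondeg p hp fun x hx => ?_)
  rw [← hspan] at hx
  obtain ⟨a, b, c, rfl⟩ := Submodule.mem_span_triple.1 hx
  simp [h1, h2, neg_eq_zero.1 e2]

/-- Three points of a nondegenerate conic are not collinear. -/
theorem IsConicForm.indep {P : Submodule ℝ V4} {C : LinearMap.BilinForm ℝ V4}
    (h : IsConicForm P C) (hP : finrank ℝ P = 3) {p q r : V4} (hp : p ∈ P) (hq : q ∈ P)
    (hpq : LinearIndependent ℝ ![p, q]) (hpr : LinearIndependent ℝ ![p, r])
    (hqr : LinearIndependent ℝ ![q, r])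
    (h1 : C p p = 0) (h2 : C q q = 0) (h3 : C r r = 0) : LinearIndependent ℝ ![p, q, r] := by
  refine indep_triple_of_notMem hpq fun hr => ?_
  obtain ⟨a, b, rfl⟩ := Submodule.mem_span_pair.1 hr
  have e : 2 * (a * b) * C p q = 0 := by
    have := h3
    simp only [map_add, map_smul, LinearMap.add_apply, LinearMap.smul_apply, smul_eq_mul, h1, h2,
      h.symm q p] at this
    linarith
  have hc : C p q ≠ 0 := fun hc => h.not_isotropic hP hp hq hpq h1 hc h2
  rcases mul_eq_zero.1 ((mul_eq_zero.1 e).resolve_right hc) with e | e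
  · norm_num at e
  rcases mul_eq_zero.1 e with rfl | rfl
  · have := (indep_pair_iff.1 hqr b (-1) (by module)).2
    norm_num at this
  · have := (indep_pair_iff.1 hpr a (-1) (by module)).2
    norm_num at this

namespace IsConicArc

variable {γ : ℝ → V4}

theorem mem_supportingPlane {t : ℝ} (ht : t ∈ Icc (0 : ℝ) 1) : γ t ∈ supportingPlane γ :=
  Submodule.subset_span ⟨t, ht, rfl⟩

/-- Three points of the arc already span the plane `P` supplied by `conic`, so `P` is the supporting
plane. -/
theorem exists_form_aux (h : IsConicArc γ) : finrank ℝ (supportingPlane γ) = 3 ∧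
    ∃ C, IsConicForm (supportingPlane γ) C ∧ ∀ t ∈ Icc (0 : ℝ) 1, C (γ t) (γ t) = 0 := by
  obtain ⟨P, C, hP, hs, hn, hγ⟩ := h.conic
  have hC : IsConicForm P C := by
    refine ⟨fun p q => (hs.eq p q).symm ▸ rfl, fun p hp hpq => ?_⟩
    have := hn.1 ⟨p, hp⟩ fun q => by simpa using hpq q q.2
    simpa using this
  have e : supportingPlane γ = P := by
    have hle : supportingPlane γ ≤ P := by
      refine Submodule.span_le.2 ?_
      rintro _ ⟨t, ht, rfl⟩
      exact (hγ t ht).1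
    have m0 : (0 : ℝ) ∈ Icc (0 : ℝ) 1 := by simp
    have m1 : (1 : ℝ) ∈ Icc (0 : ℝ) 1 := by simp
    have m2 : (1 / 2 : ℝ) ∈ Icc (0 : ℝ) 1 := by constructor <;> norm_num
    have hi := hC.indep hP (hγ 0 m0).1 (hγ 1 m1).1 (h.injective 0 m0 1 m1 (by norm_num))
      (h.injective 0 m0 _ m2 (by norm_num)) (h.injective 1 m1 _ m2 (by norm_num)) (hγ 0 m0).2
      (hγ 1 m1).2 (hγ _ m2).2
    refine le_antisymm hle ?_
    rw [← span_triple_eq hP (hγ 0 m0).1 (hγ 1 m1).1 (hγ _ m2).1 hi]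
    exact span_triple_le (mem_supportingPlane m0) (mem_supportingPlane m1) (mem_supportingPlane m2)
  rw [e]
  exact ⟨hP, C, hC, fun t ht => (hγ t ht).2⟩

theorem finrank_supportingPlane (h : IsConicArc γ) : finrank ℝ (supportingPlane γ) = 3 :=
  h.exists_form_aux.1

theorem exists_form (h : IsConicArc γ) :
    ∃ C, IsConicForm (supportingPlane γ) C ∧ ∀ t ∈ Icc (0 : ℝ) 1, C (γ t) (γ t) = 0 :=
  h.exists_form_aux.2

theorem ne_zero (h : IsConicArc γ) {t : ℝ} (ht : t ∈ Icc (0 : ℝ) 1) : γ t ≠ 0 :=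
  left_ne_zero_of_indep (h.regular t ht)

theorem indep_three (h : IsConicArc γ) {r s t : ℝ} (hr : r ∈ Icc (0 : ℝ) 1)
    (hs : s ∈ Icc (0 : ℝ) 1) (ht : t ∈ Icc (0 : ℝ) 1) (hrs : r ≠ s) (hrt : r ≠ t) (hst : s ≠ t) :
    LinearIndependent ℝ ![γ r, γ s, γ t] := by
  obtain ⟨C, hC, hγ⟩ := h.exists_form
  exact hC.indep h.finrank_supportingPlane (mem_supportingPlane hr) (mem_supportingPlane hs)
    (h.injective r hr s hs hrs) (h.injective r hr t ht hrt) (h.injective s hs t ht hst) (hγ r hr)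
    (hγ s hs) (hγ t ht)

/-- If infinitely many points of a conic arc belong to a subspace, then so does its plane. -/
theorem supportingPlane_le_of_infinite (h : IsConicArc γ) {W : Submodule ℝ V4} {S : Set ℝ}
    (hS : S.Infinite) (hS' : S ⊆ Icc 0 1) (hW : ∀ t ∈ S, γ t ∈ W) : supportingPlane γ ≤ W := by
  obtain ⟨T, hT, hc⟩ := hS.exists_subset_card_eq 3
  obtain ⟨a, b, c, hab, hac, hbc, rfl⟩ := Finset.card_eq_three.1 hc
  have ha : a ∈ S := hT (by simp)
  have hb : b ∈ S := hT (by simp)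
  have hc : c ∈ S := hT (by simp)
  rw [← span_triple_eq h.finrank_supportingPlane (mem_supportingPlane (hS' ha))
    (mem_supportingPlane (hS' hb)) (mem_supportingPlane (hS' hc))
    (h.indep_three (hS' ha) (hS' hb) (hS' hc) hab hac hbc)]
  exact span_triple_le (hW a ha) (hW b hb) (hW c hc)

theorem finite_mem (h : IsConicArc γ) {W : Submodule ℝ V4} (hW : ¬ supportingPlane γ ≤ W) :
    {t ∈ Icc (0 : ℝ) 1 | γ t ∈ W}.Finite := by
  by_contra hf
  exact hW (h.supportingPlane_le_of_infinite hf (fun t ht => ht.1) fun t ht => ht.2)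

theorem finite_zeros (h : IsConicArc γ) {n : V4 →ₗ[ℝ] ℝ} {p : V4} (hp : p ∈ supportingPlane γ)
    (hn : n p ≠ 0) : {t ∈ Icc (0 : ℝ) 1 | n (γ t) = 0}.Finite :=
  h.finite_mem (W := LinearMap.ker n) fun hle => hn (hle hp)

theorem not_le_of_finrank_le_two (h : IsConicArc γ) {W : Submodule ℝ V4} (hW : finrank ℝ W ≤ 2) :
    ¬ supportingPlane γ ≤ W := by
  intro hle
  have := Submodule.finrank_mono hle
  rw [h.finrank_supportingPlane] at this
  omega

theorem deriv_mem (hγ : ContDiff ℝ ∞ γ) {t : ℝ} (ht : t ∈ Icc (0 : ℝ) 1) :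
    deriv γ t ∈ supportingPlane γ := by
  have hcl : IsClosed {s | deriv γ s ∈ supportingPlane γ} :=
    (Submodule.closed_of_finiteDimensional (supportingPlane γ)).preimage
      (hγ.continuous_deriv (by simp))
  have hsub : Ioo (0 : ℝ) 1 \ ∅ ⊆ {s | deriv γ s ∈ supportingPlane γ} := fun s hs =>
    show deriv γ s ∈ supportingPlane γ from deriv_mem_of_eventually (hγ.differentiable (by simp) s)
      (mem_of_superset (Ioo_mem_nhds hs.1.1 hs.1.2)
        fun r hr => mem_supportingPlane ⟨hr.1.le, hr.2.le⟩)
  exact closure_minimal hsub hcl (Icc_subset_closure_diff Set.finite_empty ht)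

theorem deriv_deriv_mem (hγ : ContDiff ℝ ∞ γ) {t : ℝ} (ht : t ∈ Ioo (0 : ℝ) 1) :
    deriv (deriv γ) t ∈ supportingPlane γ := by
  have h1 : ContDiff ℝ ∞ (deriv γ) := hγ.iterate_deriv 1
  exact deriv_mem_of_eventually (h1.differentiable (by simp) t)
    (mem_of_superset (Ioo_mem_nhds ht.1 ht.2) fun r hr => deriv_mem hγ ⟨hr.1.le, hr.2.le⟩)

theorem form_deriv {C : LinearMap.BilinForm ℝ V4} (hC : ∀ p q, C p q = C q p)
    (hγ : ContDiff ℝ ∞ γ) (h0 : ∀ t ∈ Icc (0 : ℝ) 1, C (γ t) (γ t) = 0) {t : ℝ}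
    (ht : t ∈ Ioo (0 : ℝ) 1) : C (γ t) (deriv γ t) = 0 := by
  have hd := (hγ.differentiable (by simp) t).hasDerivAt
  have h1 := hasDerivAt_bilin C hd hd
  have h2 : (fun s => C (γ s) (γ s)) =ᶠ[𝓝 t] fun _ => 0 :=
    mem_of_superset (Ioo_mem_nhds ht.1 ht.2) fun r hr => h0 r ⟨hr.1.le, hr.2.le⟩
  have h3 := h1.unique ((hasDerivAt_const t (0 : ℝ)).congr_of_eventuallyEq h2)
  rw [hC (deriv γ t)] at h3
  linarith

/-- Differentiating `C(γ,γ') = 0` gives `C(γ,γ'') = -C(γ',γ')`. This is nonzero because the tangent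
is not totally isotropic, while `C(γ,·)` vanishes on the tangent. -/
theorem indep_deriv (h : IsConicArc γ) (hγ : ContDiff ℝ ∞ γ) {t : ℝ} (ht : t ∈ Ioo (0 : ℝ) 1) :
    LinearIndependent ℝ ![γ t, deriv γ t, deriv (deriv γ) t] := by
  obtain ⟨C, hC, h0⟩ := h.exists_form
  have htI : t ∈ Icc (0 : ℝ) 1 := ⟨ht.1.le, ht.2.le⟩
  have hd := (hγ.differentiable (by simp) t).hasDerivAt
  have h1 : ContDiff ℝ ∞ (deriv γ) := hγ.iterate_deriv 1
  have hd1 := (h1.differentiable (by simp) t).hasDerivAt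
  have e1 := hasDerivAt_bilin C hd hd1
  have e2 : (fun s => C (γ s) (deriv γ s)) =ᶠ[𝓝 t] fun _ => 0 :=
    mem_of_superset (Ioo_mem_nhds ht.1 ht.2) fun r hr => form_deriv hC.symm hγ h0 hr
  have e3 := e1.unique ((hasDerivAt_const t (0 : ℝ)).congr_of_eventuallyEq e2)
  have e4 := form_deriv hC.symm hγ h0 ht
  have e5 := hC.not_isotropic h.finrank_supportingPlane (mem_supportingPlane htI) (deriv_mem hγ htI)
    (h.regular t htI) (h0 t htI) e4
  rw [indep_triple_iff]
  intro a b c e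
  have e6 : c * C (γ t) (deriv (deriv γ) t) = 0 := by
    have := congrArg (C (γ t)) e
    simpa [h0 t htI, e4] using this
  have hc : c = 0 := by
    refine (mul_eq_zero.1 e6).resolve_right fun e7 => e5 ?_
    rw [e7] at e3; linarith
  subst hc
  obtain ⟨ha, hb⟩ := indep_pair_iff.1 (h.regular t htI) a b (by simpa using e)
  exact ⟨ha, hb, rfl⟩

/-- A linear form that does not vanish on the plane of a conic arc has only zeros of finite order on
the arc. -/
theorem exists_iteratedDeriv_ne_zero (h : IsConicArc γ) (hγ : ContDiff ℝ ∞ γ) {n : V4 →ₗ[ℝ] ℝ}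
    {p : V4} (hp : p ∈ supportingPlane γ) (hn : n p ≠ 0) {t : ℝ} (ht : t ∈ Ioo (0 : ℝ) 1) :
    ∃ k, iteratedDeriv k (fun s => n (γ s)) t ≠ 0 := by
  by_contra! hk
  have d1 : deriv (fun s => n (γ s)) = fun s => n (deriv γ s) := by
    funext s
    exact (hasDerivAt_map n (hγ.differentiable (by simp) s).hasDerivAt).deriv
  have h1 : ContDiff ℝ ∞ (deriv γ) := hγ.iterate_deriv 1
  have d2 : deriv (fun s => n (deriv γ s)) = fun s => n (deriv (deriv γ) s) := by
    funext s
    exact (hasDerivAt_map n (h1.differentiable (by simp) s).hasDerivAt).deriv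
  have k0 : n (γ t) = 0 := by simpa using hk 0
  have k1 : n (deriv γ t) = 0 := by simpa [iteratedDeriv_one, d1] using hk 1
  have k2 : n (deriv (deriv γ) t) = 0 := by simpa [iteratedDeriv_succ, d1, d2] using hk 2
  have htI : t ∈ Icc (0 : ℝ) 1 := ⟨ht.1.le, ht.2.le⟩
  rw [← span_triple_eq h.finrank_supportingPlane (mem_supportingPlane htI) (deriv_mem hγ htI)
    (deriv_deriv_mem hγ ht) (h.indep_deriv hγ ht)] at hp
  obtain ⟨a, b, c, rfl⟩ := Submodule.mem_span_triple.1 hp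
  exact hn (by simp [k0, k1, k2])

theorem indep_map {P : Submodule ℝ V4} {L : V4 →ₗ[ℝ] V4} (hL : ∀ p ∈ P, L p = 0 → p = 0)
    {p q : V4} (hp : p ∈ P) (hq : q ∈ P) (h : LinearIndependent ℝ ![p, q]) :
    LinearIndependent ℝ ![L p, L q] := by
  rw [indep_pair_iff]
  intro s t e
  refine indep_pair_iff.1 h s t (hL _ (P.add_mem (P.smul_mem _ hp) (P.smul_mem _ hq)) ?_)
  simpa using e

/-- A linear map that is injective on a subspace has a left inverse there. -/
theorem exists_leftInverse_on {P : Submodule ℝ V4} {L : V4 →ₗ[ℝ] V4}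
    (hL : ∀ p ∈ P, L p = 0 → p = 0) : ∃ g : V4 →ₗ[ℝ] V4, ∀ p ∈ P, g (L p) = p := by
  obtain ⟨g, hg⟩ := LinearMap.exists_leftInverse_of_injective (L ∘ₗ P.subtype) (by
    rw [LinearMap.ker_eq_bot']
    rintro ⟨p, hp⟩ e
    simpa using hL p hp e)
  refine ⟨P.subtype ∘ₗ g, fun p hp => ?_⟩
  have := LinearMap.congr_fun hg ⟨p, hp⟩
  simp only [LinearMap.comp_apply, Submodule.subtype_apply, LinearMap.id_apply] at this ⊢
  rw [this]

theorem finrank_map_of_inj {P : Submodule ℝ V4} {L : V4 →ₗ[ℝ] V4}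
    (hL : ∀ p ∈ P, L p = 0 → p = 0) : finrank ℝ (P.map L) = finrank ℝ P := by
  have : Function.Injective (L ∘ₗ P.subtype) := by
    rw [← LinearMap.ker_eq_bot, LinearMap.ker_eq_bot']
    rintro ⟨p, hp⟩ e
    simpa using hL p hp e
  have h2 := LinearMap.finrank_range_of_inj this
  rwa [LinearMap.range_comp, Submodule.range_subtype] at h2

/-- The image of a conic arc under a linear map that is injective on its plane. -/
theorem map (h : IsConicArc γ) (hγ : ContDiff ℝ ∞ γ) {L : V4 →ₗ[ℝ] V4}
    (hL : ∀ p ∈ supportingPlane γ, L p = 0 → p = 0) : IsConicArc (fun t => L (γ t)) := by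
  obtain ⟨C, hC, h0⟩ := h.exists_form
  obtain ⟨g, hg⟩ := exists_leftInverse_on hL
  refine ⟨fun t ht => ?_, fun s hs t ht hst => ?_, (supportingPlane γ).map L,
    C.compl₁₂ g g, ?_, ?_, ?_, ?_⟩
  · rw [(hasDerivAt_map L (hγ.differentiable (by simp) t).hasDerivAt).deriv]
    exact indep_map hL (mem_supportingPlane ht) (deriv_mem hγ ht) (h.regular t ht)
  · exact indep_map hL (mem_supportingPlane hs) (mem_supportingPlane ht) (h.injective s hs t ht hst)
  · rw [finrank_map_of_inj hL, h.finrank_supportingPlane]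
  · exact ⟨fun p q => hC.symm _ _⟩
  · have key : ∀ p ∈ (supportingPlane γ).map L,
        (∀ q ∈ (supportingPlane γ).map L, C (g p) (g q) = 0) → p = 0 := by
      rintro _ ⟨p, hp, rfl⟩ hq
      rw [hC.nondeg p hp fun q hq' => by
        simpa [hg p hp, hg q hq'] using hq (L q) ⟨q, hq', rfl⟩, map_zero]
    refine ⟨fun p hp => ?_, fun p hp => ?_⟩
    · exact Subtype.ext (key p p.2 fun q hq => by simpa using hp ⟨q, hq⟩)
    · exact Subtype.ext (key p p.2 fun q hq => by rw [hC.symm]; simpa using hp ⟨q, hq⟩)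
  · intro t ht
    refine ⟨⟨γ t, mem_supportingPlane ht, rfl⟩, ?_⟩
    simp [hg _ (mem_supportingPlane ht), h0 t ht]

end IsConicArc

/-! ### Partial derivatives -/

/-- A smooth surface. -/
def Smooth2 (F : ℝ → ℝ → V4) : Prop := ContDiff ℝ ∞ (fun p : ℝ × ℝ => F p.1 p.2)

namespace Smooth2

variable {F : ℝ → ℝ → V4}

theorem curveU (hF : Smooth2 F) (v : ℝ) : ContDiff ℝ ∞ (fun u => F u v) :=
  ContDiff.comp (g := fun p : ℝ × ℝ => F p.1 p.2) hF (contDiff_id.prodMk contDiff_const)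

theorem curveV (hF : Smooth2 F) (u : ℝ) : ContDiff ℝ ∞ (fun v => F u v) :=
  ContDiff.comp (g := fun p : ℝ × ℝ => F p.1 p.2) hF (contDiff_const.prodMk contDiff_id)

theorem swap (hF : Smooth2 F) : Smooth2 fun u v => F v u :=
  ContDiff.comp (g := fun p : ℝ × ℝ => F p.1 p.2) hF (contDiff_snd.prodMk contDiff_fst)

theorem hasDerivAt_dU (hF : Smooth2 F) (u v : ℝ) : HasDerivAt (fun s => F s v) (dU F u v) u :=
  ((hF.curveU v).differentiable (by simp) u).hasDerivAt

theorem hasDerivAt_dV (hF : Smooth2 F) (u v : ℝ) : HasDerivAt (fun t => F u t) (dV F u v) v :=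
  ((hF.curveV u).differentiable (by simp) v).hasDerivAt

theorem dU_eq (hF : Smooth2 F) (u v : ℝ) :
    dU F u v = fderiv ℝ (fun p : ℝ × ℝ => F p.1 p.2) (u, v) (1, 0) := by
  have h1 : HasDerivAt (fun s : ℝ => (s, v)) (1, 0) u :=
    (hasDerivAt_id u).prodMk (hasDerivAt_const u v)
  have h2 := (ContDiff.differentiable hF (by simp) (u, v)).hasFDerivAt
  exact (h2.comp_hasDerivAt u h1).deriv

theorem dV_eq (hF : Smooth2 F) (u v : ℝ) :
    dV F u v = fderiv ℝ (fun p : ℝ × ℝ => F p.1 p.2) (u, v) (0, 1) := by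
  have h1 : HasDerivAt (fun s : ℝ => (u, s)) (0, 1) v :=
    (hasDerivAt_const v u).prodMk (hasDerivAt_id v)
  have h2 := (ContDiff.differentiable hF (by simp) (u, v)).hasFDerivAt
  exact (h2.comp_hasDerivAt v h1).deriv

theorem contDiff_fderiv (hF : Smooth2 F) :
    ContDiff ℝ ∞ (fderiv ℝ fun p : ℝ × ℝ => F p.1 p.2) :=
  ContDiff.fderiv_right hF (by simp)

theorem smooth_dU (hF : Smooth2 F) : Smooth2 (dU F) := by
  have h : (fun p : ℝ × ℝ => dU F p.1 p.2) =
      fun p => fderiv ℝ (fun p : ℝ × ℝ => F p.1 p.2) p (1, 0) := by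
    funext p; exact hF.dU_eq p.1 p.2
  rw [Smooth2, h]
  exact hF.contDiff_fderiv.clm_apply contDiff_const

theorem smooth_dV (hF : Smooth2 F) : Smooth2 (dV F) := by
  have h : (fun p : ℝ × ℝ => dV F p.1 p.2) =
      fun p => fderiv ℝ (fun p : ℝ × ℝ => F p.1 p.2) p (0, 1) := by
    funext p; exact hF.dV_eq p.1 p.2
  rw [Smooth2, h]
  exact hF.contDiff_fderiv.clm_apply contDiff_const

theorem dU_dV_comm (hF : Smooth2 F) (u v : ℝ) : dU (dV F) u v = dV (dU F) u v := by
  have hd := hF.contDiff_fderiv.differentiable (by simp) (u, v)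
  have h : (fun p : ℝ × ℝ => dV F p.1 p.2) =
      fun p => fderiv ℝ (fun p : ℝ × ℝ => F p.1 p.2) p (0, 1) := by
    funext p; exact hF.dV_eq p.1 p.2
  have h' : (fun p : ℝ × ℝ => dU F p.1 p.2) =
      fun p => fderiv ℝ (fun p : ℝ × ℝ => F p.1 p.2) p (1, 0) := by
    funext p; exact hF.dU_eq p.1 p.2
  rw [hF.smooth_dV.dU_eq, hF.smooth_dU.dV_eq, h, h', fderiv_clm_apply hd (by fun_prop),
    fderiv_clm_apply hd (by fun_prop)]
  have hs : IsSymmSndFDerivAt ℝ (fun p : ℝ × ℝ => F p.1 p.2) (u, v) :=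
    (ContDiff.contDiffAt hF).isSymmSndFDerivAt (by
      rw [minSmoothness_of_isRCLikeNormedField]; exact WithTop.coe_le_coe.2 (le_top : (2 : ℕ∞) ≤ ⊤))
  simpa using hs.eq (1, 0) (0, 1)

theorem continuous (hF : Smooth2 F) : Continuous fun p : ℝ × ℝ => F p.1 p.2 :=
  ContDiff.continuous hF

theorem continuousU (hF : Smooth2 F) (v : ℝ) : Continuous fun u => F u v :=
  (hF.curveU v).continuous

theorem continuousV (hF : Smooth2 F) (u : ℝ) : Continuous fun v => F u v :=
  (hF.curveV u).continuous

end Smooth2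

/-! ### Regular supercyclidic patches -/

/-- The parameters in the open unit interval outside `E`. -/
def regularSet (E : Set ℝ) : Set ℝ := Ioo 0 1 \ E

theorem regularSet_subset (E : Set ℝ) : regularSet E ⊆ Icc 0 1 :=
  fun _ h => ⟨h.1.1.le, h.1.2.le⟩

theorem infinite_regularSet {E : Set ℝ} (hE : E.Finite) : (regularSet E).Infinite :=
  (Ioo_infinite (zero_lt_one' ℝ)).sdiff hE

theorem regularSet_mem_nhds {E : Set ℝ} (hE : E.Finite) {t : ℝ} (ht : t ∈ regularSet E) :
    regularSet E ∈ 𝓝 t :=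
  (isOpen_Ioo.sdiff hE.isClosed).mem_nhds ht

theorem regularSet_union (E E' : Set ℝ) : regularSet (E ∪ E') ⊆ regularSet E :=
  fun _ h => ⟨h.1, fun h' => h.2 (Or.inl h')⟩

/-- A smooth surface that is a characteristic parametrization of a supercyclide outside finite sets
of parameters. -/
structure IsRegularPatch (F : ℝ → ℝ → V4) (E₁ E₂ : Set ℝ) : Prop where
  smooth : Smooth2 F
  finite₁ : E₁.Finite
  finite₂ : E₂.Finite
  char : IsCharacteristicOn F (regularSet E₁) (regularSet E₂)

theorem IsSCPatch.exists_regular {F : ℝ → ℝ → V4} (h : IsSCPatch F) :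
    ∃ E₁ E₂, IsRegularPatch F E₁ E₂ := by
  obtain ⟨E₁, E₂, h₁, h₂, hc⟩ := h.characteristic
  have m₁ : regularSet E₁ ⊆ Icc 0 1 \ E₁ := fun t ht => ⟨regularSet_subset _ ht, ht.2⟩
  have m₂ : regularSet E₂ ⊆ Icc 0 1 \ E₂ := fun t ht => ⟨regularSet_subset _ ht, ht.2⟩
  refine ⟨E₁, E₂, h.smooth, h₁, h₂, fun u hu v hv => hc.immersion u (m₁ hu) v (m₂ hv),
    fun u hu v hv => hc.conjugate u (m₁ hu) v (m₂ hv), fun v hv => hc.conicU v (m₂ hv),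
    fun u hu => hc.conicV u (m₁ hu), fun v hv => ?_, fun u hu => ?_⟩
  · obtain ⟨B, hB, hB'⟩ := hc.coneU v (m₂ hv)
    exact ⟨B, hB, fun u hu => hB' u (m₁ hu)⟩
  · obtain ⟨B, hB, hB'⟩ := hc.coneV u (m₁ hu)
    exact ⟨B, hB, fun v hv => hB' v (m₂ hv)⟩

theorem tangentPlane_swap (F : ℝ → ℝ → V4) (u v : ℝ) :
    tangentPlane (fun u v => F v u) u v = tangentPlane F v u := by
  unfold tangentPlane
  rw [show ({F v u, dU F v u, dV F v u} : Set V4) = {F v u, dV F v u, dU F v u} by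
    rw [Set.pair_comm]]
  rfl

theorem IsCharacteristicOn.swap {F : ℝ → ℝ → V4} {I₁ I₂ : Set ℝ} (hF : Smooth2 F)
    (h : IsCharacteristicOn F I₁ I₂) : IsCharacteristicOn (fun u v => F v u) I₂ I₁ where
  immersion u hu v hv := indep_swap_of_triple (h.immersion v hv u hu)
  conjugate u hu v hv := by
    rw [tangentPlane_swap]
    have := h.conjugate v hv u hu
    rw [hF.dU_dV_comm] at this
    exact this
  conicU v hv := h.conicV v hv
  conicV u hu := h.conicU u hu
  coneU v hv := by simpa only [tangentPlane_swap] using h.coneV v hv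
  coneV u hu := by simpa only [tangentPlane_swap] using h.coneU u hu

theorem IsRegularPatch.swap {F : ℝ → ℝ → V4} {E₁ E₂ : Set ℝ} (h : IsRegularPatch F E₁ E₂) :
    IsRegularPatch (fun u v => F v u) E₂ E₁ :=
  ⟨h.smooth.swap, h.finite₂, h.finite₁, h.char.swap h.smooth⟩

theorem IsSCPatch.swap {F : ℝ → ℝ → V4} (h : IsSCPatch F) : IsSCPatch fun u v => F v u := by
  obtain ⟨E₁, E₂, h₁, h₂, hc⟩ := h.characteristic
  exact ⟨Smooth2.swap h.smooth, h.boundaryV0, h.boundaryV1, h.boundaryU0, h.boundaryU1, E₂, E₁,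
    h₂, h₁, hc.swap h.smooth⟩

theorem finrank_tangentPlane {F : ℝ → ℝ → V4} {u v : ℝ}
    (h : LinearIndependent ℝ ![F u v, dU F u v, dV F u v]) :
    finrank ℝ (tangentPlane F u v) = 3 := finrank_span_triple h

/-- The plane of a parameter line does not contain the vertex of the cone that is enveloped by the
tangent planes along it. -/
theorem IsRegularPatch.exists_vertex {F : ℝ → ℝ → V4} {E₁ E₂ : Set ℝ}
    (h : IsRegularPatch F E₁ E₂) {v : ℝ} (hv : v ∈ regularSet E₂) :
    ∃ w : V4, w ∉ supportingPlane (fun u => F u v) ∧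
      ∀ u ∈ regularSet E₁, w ∈ tangentPlane F u v := by
  obtain ⟨B, ⟨hBs, hB1⟩, hB⟩ := h.char.coneU v hv
  have hγ := h.char.conicU v hv
  have hsm := h.smooth.curveU v
  set γ : ℝ → V4 := fun u => F u v with hγdef
  have hP := hγ.finrank_supportingPlane
  obtain ⟨⟨w, hwB⟩, hw0, -⟩ := finrank_eq_one_iff'.1 hB1
  have hw0 : w ≠ 0 := fun e => hw0 (Subtype.ext e)
  have hBw : ∀ p, B p w = 0 := fun p => by
    rw [show B p w = B w p from hBs.eq p w, LinearMap.mem_ker.1 hwB]; rfl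
  have hwT : ∀ u ∈ regularSet E₁, w ∈ tangentPlane F u v := fun u hu => by
    rw [(hB u hu).2.2]
    exact hBw _
  refine ⟨w, fun hwP => ?_, hwT⟩
  obtain ⟨C, hC, h0⟩ := hγ.exists_form
  -- Suppose `w` lies in the plane of the conic. Where the tangent plane is a different plane, `w`
  -- lies on the tangent of the conic, so `C(w, γ u) = 0`. If this happened infinitely often, `w`
  -- would be in the radical of `C`; hence `D` is finite.
  set D := {u ∈ regularSet E₁ | tangentPlane F u v ≠ supportingPlane γ} with hD
  have hDfin : D.Finite := by
    by_contra hinf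
    have hle : supportingPlane γ ≤ LinearMap.ker (C w) := by
      refine hγ.supportingPlane_le_of_infinite (S := D) hinf
        (fun u hu => regularSet_subset _ hu.1) fun u hu => ?_
      have huI := regularSet_subset _ hu.1
      have hT := finrank_tangentPlane (h.char.immersion u hu.1 v hv)
      have h2 := finrank_inf hT hP hu.2
      have e := span_pair_eq h2 (a := γ u) (b := deriv γ u)
        ⟨Submodule.subset_span (by simp [hγdef]), IsConicArc.mem_supportingPlane huI⟩
        ⟨Submodule.subset_span (by simp [hγdef, dU]), IsConicArc.deriv_mem hsm huI⟩
        (hγ.regular u huI)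
      have hw : w ∈ Submodule.span ℝ {γ u, deriv γ u} := by
        rw [e]; exact ⟨hwT u hu.1, hwP⟩
      obtain ⟨a, b, rfl⟩ := Submodule.mem_span_pair.1 hw
      have e1 := IsConicArc.form_deriv hC.symm hsm h0 hu.1.1
      rw [LinearMap.mem_ker, hC.symm]
      simp [h0 u huI, e1]
    exact hw0 (hC.nondeg w hwP fun q hq => hle hq)
  -- At the remaining parameters `B (γ u)` vanishes on the whole plane, so it is determined by its
  -- value at one point `q` off the plane. Three such points then yield two independent vectors in
  -- the one-dimensional kernel of `B`.
  have hinf : (regularSet E₁ \ D).Infinite := (infinite_regularSet h.finite₁).sdiff hDfin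
  obtain ⟨T, hT, hc⟩ := hinf.exists_subset_card_eq 3
  obtain ⟨a, b, c, hab, hac, hbc, rfl⟩ := Finset.card_eq_three.1 hc
  have ha := hT (show a ∈ _ by simp)
  have hb := hT (show b ∈ _ by simp)
  have hc := hT (show c ∈ _ by simp)
  have hi := hγ.indep_three (regularSet_subset _ ha.1) (regularSet_subset _ hb.1)
    (regularSet_subset _ hc.1) hab hac hbc
  have hker : ∀ u ∈ regularSet E₁ \ D, ∀ p ∈ supportingPlane γ, B (γ u) p = 0 := by
    intro u hu p hp
    have e : tangentPlane F u v = supportingPlane γ := by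
      by_contra hne
      exact hu.2 ⟨hu.1, hne⟩
    rw [← e, (hB u hu.1).2.2] at hp
    exact hp
  obtain ⟨q, -, hq⟩ := exists_mem_notMem (P := ⊤) (W := supportingPlane γ) (by rw [hP]; simp)
  obtain ⟨n, hnq, hn⟩ := exists_ker_eq_of_notMem hP hq
  have hzero : ∀ p : V4, (∀ r ∈ supportingPlane γ, B p r = 0) → B p q = 0 →
      p ∈ LinearMap.ker B := by
    intro p h1 h2
    rw [LinearMap.mem_ker]
    refine LinearMap.ext fun r => ?_
    have hr : r - n r • q ∈ supportingPlane γ := (hn _).1 (by simp [hnq])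
    have := h1 _ hr
    simpa [h2] using this
  have hqa : B (γ a) q ≠ 0 := fun e => (hB a ha.1).2.1 (hzero _ (hker a ha) e)
  refine dep_of_finrank_one hB1.le (a := B (γ b) q • γ a - B (γ a) q • γ b)
    (b := B (γ c) q • γ a - B (γ a) q • γ c) ?_ ?_ ?_
  · refine hzero _ (fun r hr => ?_) ?_
    · simp [hker a ha r hr, hker b hb r hr]
    · simp; ring
  · refine hzero _ (fun r hr => ?_) ?_
    · simp [hker a ha r hr, hker c hc r hr]
    · simp; ring
  · rw [indep_pair_iff]
    intro s t e
    obtain ⟨-, h2, h3⟩ := indep_triple_iff.1 hi (s * B (γ b) q + t * B (γ c) q)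
      (-(s * B (γ a) q)) (-(t * B (γ a) q)) (by rw [← e]; module)
    simpa [hqa] using And.intro h2 h3

/-- The derivatives across a parameter line all point to the vertex of the tangent cone. -/
theorem IsRegularPatch.exists_apex {F : ℝ → ℝ → V4} {E₁ E₂ : Set ℝ}
    (h : IsRegularPatch F E₁ E₂) {v : ℝ} (hv : v ∈ regularSet E₂) :
    ∃ w : V4, w ∉ supportingPlane (fun u => F u v) ∧
      (∀ u ∈ Icc (0 : ℝ) 1, ∃ a d : ℝ, dV F u v = a • F u v + d • w) ∧
      ∀ u ∈ regularSet E₁, w ∈ Submodule.span ℝ {F u v, dV F u v} := by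
  obtain ⟨w, hwP, hwT⟩ := h.exists_vertex hv
  have hγ := h.char.conicU v hv
  have hsm := h.smooth.curveU v
  obtain ⟨m, hmw, hm⟩ := exists_ker_eq_of_notMem hγ.finrank_supportingPlane hwP
  obtain ⟨C, hC, h0⟩ := hγ.exists_form
  set γ : ℝ → V4 := fun u => F u v with hγdef
  -- The projection from the vertex onto the plane of the conic; it maps each tangent plane to the
  -- tangent line of the conic.
  set g : V4 →ₗ[ℝ] V4 := LinearMap.id - m.smulRight w with hg
  have hgw : g w = 0 := by simp [hg, hmw]
  have hgP : ∀ p ∈ supportingPlane γ, g p = p := fun p hp => by simp [hg, (hm p).2 hp]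
  have hT : ∀ u ∈ regularSet E₁, ∀ p ∈ tangentPlane F u v,
      ∃ a b : ℝ, g p = a • γ u + b • deriv γ u := by
    intro u hu p hp
    have huI := regularSet_subset _ hu
    have hi : LinearIndependent ℝ ![γ u, deriv γ u, w] := by
      refine indep_triple_of_notMem (hγ.regular u huI) fun hw => hwP ?_
      exact span_pair_le (IsConicArc.mem_supportingPlane huI) (IsConicArc.deriv_mem hsm huI) hw
    rw [← span_triple_eq (finrank_tangentPlane (h.char.immersion u hu v hv)) (a := γ u)
      (b := deriv γ u) (c := w) (Submodule.subset_span (by simp [hγdef]))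
      (Submodule.subset_span (by simp [hγdef, dU])) (hwT u hu) hi] at hp
    obtain ⟨a, b, c, rfl⟩ := Submodule.mem_span_triple.1 hp
    exact ⟨a, b, by simp [hgw, hgP _ (IsConicArc.mem_supportingPlane huI),
      hgP _ (IsConicArc.deriv_mem hsm huI)]⟩
  have hCg : ∀ u ∈ regularSet E₁, ∀ p ∈ tangentPlane F u v, C (γ u) (g p) = 0 := by
    intro u hu p hp
    obtain ⟨a, b, e⟩ := hT u hu p hp
    rw [e]
    have e1 : C (γ u) (γ u) = 0 := h0 u (regularSet_subset _ hu)
    simp [e1, IsConicArc.form_deriv hC.symm hsm h0 hu.1]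
  have hreg : ∀ u ∈ regularSet E₁, ∃ a d : ℝ, dV F u v = a • F u v + d • w := by
    intro u hu
    have huI := regularSet_subset _ hu
    have hVT : ∀ s, dV F s v ∈ tangentPlane F s v := fun s => Submodule.subset_span (by simp)
    have d1 := (hsm.differentiable (by simp) u).hasDerivAt
    have d2 := hasDerivAt_map g (h.smooth.smooth_dV.hasDerivAt_dU u v)
    have d3 := hasDerivAt_bilin C d1 d2
    have e1 : (fun s => C (γ s) (g (dV F s v))) =ᶠ[𝓝 u] fun _ => 0 :=
      mem_of_superset (regularSet_mem_nhds h.finite₁ hu) fun s hs => hCg s hs _ (hVT s)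
    -- Differentiate `C(γ, g F_v) = 0` along the line. The term with `F_uv` vanishes, as conjugacy
    -- puts `F_uv` in the tangent plane. What remains is `C(γ', g F_v) = 0`, which removes the `γ'`
    -- component of `g F_v` because `C(γ',γ') ≠ 0`.
    have e2 := d3.unique ((hasDerivAt_const u (0 : ℝ)).congr_of_eventuallyEq e1)
    rw [hCg u hu _ (h.char.conjugate u hu v hv), add_zero] at e2
    obtain ⟨a, b, e⟩ := hT u hu _ (hVT u)
    have e3 := IsConicArc.form_deriv hC.symm hsm h0 hu.1
    have e4 := hC.not_isotropic hγ.finrank_supportingPlane (IsConicArc.mem_supportingPlane huI)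
      (IsConicArc.deriv_mem hsm huI) (hγ.regular u huI) (h0 u huI) e3
    rw [e] at e2
    have hb : b = 0 := by
      have : b * C (deriv γ u) (deriv γ u) = 0 := by
        simpa [hC.symm (deriv γ u) (γ u), e3] using e2
      exact (mul_eq_zero.1 this).resolve_right e4
    subst hb
    refine ⟨a, m (dV F u v), ?_⟩
    simp only [hg, LinearMap.sub_apply, LinearMap.id_apply, LinearMap.smulRight_apply, zero_smul,
      add_zero] at e
    rw [← sub_eq_iff_eq_add]
    exact e
  have hFw : ∀ u ∈ Icc (0 : ℝ) 1, LinearIndependent ℝ ![F u v, w] := fun u hu =>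
    indep_pair_of_ne (hγ.ne_zero hu) fun hw => hwP ((Submodule.span_singleton_le_iff_mem _ _).2
      (IsConicArc.mem_supportingPlane (γ := γ) hu) hw)
  refine ⟨w, hwP, fun u hu => ?_, fun u hu => ?_⟩
  · have hdep : ¬ LinearIndependent ℝ ![F u v, w, dV F u v] := by
      refine not_linearIndependent_of_mem_closure (f := fun u => ![F u v, w, dV F u v])
        (continuous_triple hsm.continuous continuous_const (h.smooth.smooth_dV.continuousU v))
        (S := regularSet E₁) (fun s hs hi => ?_) (Icc_subset_closure_diff h.finite₁ hu)
      obtain ⟨a, d, e⟩ := hreg s hs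
      exact notMem_span_pair hi (Submodule.mem_span_pair.2 ⟨a, d, e.symm⟩)
    by_contra hne
    refine hdep (indep_triple_of_notMem (hFw u hu) fun hmem => hne ?_)
    obtain ⟨a, d, e⟩ := Submodule.mem_span_pair.1 hmem
    exact ⟨a, d, e.symm⟩
  · obtain ⟨a, d, e⟩ := hreg u hu
    have hd : d ≠ 0 := by
      rintro rfl
      have := (indep_triple_iff.1 (h.char.immersion u hu v hv) a 0 (-1) (by rw [e]; module)).2.2
      norm_num at this
    refine Submodule.mem_span_pair.2 ⟨-(d⁻¹ * a), d⁻¹, ?_⟩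
    rw [e, smul_add, smul_smul, smul_smul, inv_mul_cancel₀ hd]
    module

/-! ### Functions with vanishing Wronskian -/

/-- Orders of zeros add: at the sum of the two vanishing orders only one term of the Leibniz formula
survives. -/
theorem exists_iteratedDeriv_mul_ne_zero {f g : ℝ → ℝ} (hf : ContDiff ℝ ∞ f)
    (hg : ContDiff ℝ ∞ g) {t : ℝ} (h1 : ∃ k, iteratedDeriv k f t ≠ 0)
    (h2 : ∃ k, iteratedDeriv k g t ≠ 0) : ∃ k, iteratedDeriv k (fun s => f s * g s) t ≠ 0 := by
  classical
  set a := Nat.find h1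
  set b := Nat.find h2
  have ha : iteratedDeriv a f t ≠ 0 := Nat.find_spec h1
  have hb : iteratedDeriv b g t ≠ 0 := Nat.find_spec h2
  refine ⟨a + b, ?_⟩
  rw [iteratedDeriv_fun_mul (hf.contDiffAt.of_le (by exact_mod_cast le_top))
    (hg.contDiffAt.of_le (by exact_mod_cast le_top)), Finset.sum_eq_single a]
  · have : ((a + b).choose a : ℝ) ≠ 0 := by
      exact_mod_cast (Nat.choose_pos (Nat.le_add_right a b)).ne'
    rw [Nat.add_sub_cancel_left]
    positivity
  · intro i hi hia
    rcases lt_or_gt_of_ne hia with h | h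
    · have := not_not.1 (Nat.find_min h1 h)
      rw [this]; ring
    · have hlt : a + b - i < b := by
        have := Finset.mem_range.1 hi
        omega
      have := not_not.1 (Nat.find_min h2 hlt)
      rw [this]; ring
  · intro h
    exact absurd (Finset.mem_range.2 (by omega)) h

theorem const_ratio_of_wronskian {f φ : ℝ → ℝ} (hf : ContDiff ℝ ∞ f) (hφ : ContDiff ℝ ∞ φ)
    {a b : ℝ} (hne : ∀ t ∈ Ioo a b, φ t ≠ 0)
    (hW : ∀ t ∈ Ioo a b, φ t * deriv f t = deriv φ t * f t) :
    ∃ c, ∀ t ∈ Ioo a b, f t = c * φ t := by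
  have hd : ∀ t ∈ Ioo a b, HasDerivAt (fun s => f s / φ s) 0 t := by
    intro t ht
    have := (hf.differentiable (by simp) t).hasDerivAt.div
      (hφ.differentiable (by simp) t).hasDerivAt (hne t ht)
    rwa [show deriv f t * φ t - f t * deriv φ t = 0 by linarith [hW t ht], zero_div] at this
  obtain ⟨c, hc⟩ := isOpen_Ioo.exists_is_const_of_deriv_eq_zero isPreconnected_Ioo
    (fun t ht => (hd t ht).differentiableAt.differentiableWithinAt) fun t ht => (hd t ht).deriv
  exact ⟨c, fun t ht => by rw [← hc t ht, div_mul_cancel₀ _ (hne t ht)]⟩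

theorem iteratedDeriv_eq_of_mem_closure {f φ : ℝ → ℝ} (hf : ContDiff ℝ ∞ f)
    (hφ : ContDiff ℝ ∞ φ) {a b c t : ℝ} (h : ∀ s ∈ Ioo a b, f s = c * φ s)
    (ht : t ∈ closure (Ioo a b)) (k : ℕ) : iteratedDeriv k f t = c * iteratedDeriv k φ t := by
  have hcl : IsClosed {s | iteratedDeriv k f s = c * iteratedDeriv k φ s} :=
    isClosed_eq (hf.continuous_iteratedDeriv k (by exact_mod_cast le_top))
      (continuous_const.mul (hφ.continuous_iteratedDeriv k (by exact_mod_cast le_top)))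
  refine closure_minimal (fun s hs => ?_) hcl ht
  have := Set.EqOn.iteratedDeriv_of_isOpen (f := f) (g := fun s => c * φ s) h isOpen_Ioo k hs
  rw [mem_ofPred_eq, this, iteratedDeriv_const_mul_field]

/-- The quotient is constant on each side of `t`. Comparing derivatives of an order at which `φ`
does not vanish at `t` identifies the two constants; at a flat zero they could differ. -/
theorem const_ratio_near {f φ : ℝ → ℝ} (hf : ContDiff ℝ ∞ f) (hφ : ContDiff ℝ ∞ φ)
    (hfin : {t ∈ Icc (0 : ℝ) 1 | φ t = 0}.Finite)
    (hW : ∀ t ∈ Ioo (0 : ℝ) 1, φ t * deriv f t = deriv φ t * f t) {t : ℝ}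
    (ht : t ∈ Ioo (0 : ℝ) 1) (hk : ∃ k, iteratedDeriv k φ t ≠ 0) :
    ∃ c, ∀ᶠ s in 𝓝 t, f s = c * φ s := by
  obtain ⟨k, hk⟩ := hk
  have hU : Ioo (0 : ℝ) 1 \ ({t ∈ Icc (0 : ℝ) 1 | φ t = 0} \ {t}) ∈ 𝓝 t := by
    refine (isOpen_Ioo.sdiff (hfin.subset sdiff_subset).isClosed).mem_nhds ⟨ht, fun h => h.2 rfl⟩
  obtain ⟨ε, hε, hball⟩ := Metric.mem_nhds_iff.1 hU
  have hmem : ∀ s, s ≠ t → |s - t| < ε → s ∈ Ioo (0 : ℝ) 1 ∧ φ s ≠ 0 := by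
    intro s hs hsε
    have h1 := hball (show s ∈ Metric.ball t ε by rwa [Metric.mem_ball, Real.dist_eq])
    exact ⟨h1.1, fun h0 => h1.2 ⟨⟨⟨h1.1.1.le, h1.1.2.le⟩, h0⟩, hs⟩⟩
  have hR : ∀ s ∈ Ioo t (t + ε), s ∈ Ioo (0 : ℝ) 1 ∧ φ s ≠ 0 := fun s hs =>
    hmem s hs.1.ne' (by rw [abs_of_pos (by linarith [hs.1])]; linarith [hs.2])
  have hL : ∀ s ∈ Ioo (t - ε) t, s ∈ Ioo (0 : ℝ) 1 ∧ φ s ≠ 0 := fun s hs =>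
    hmem s hs.2.ne (by rw [abs_of_neg (by linarith [hs.2])]; linarith [hs.1])
  obtain ⟨c, hc⟩ := const_ratio_of_wronskian hf hφ (fun s hs => (hR s hs).2)
    fun s hs => hW s (hR s hs).1
  obtain ⟨c', hc'⟩ := const_ratio_of_wronskian hf hφ (fun s hs => (hL s hs).2)
    fun s hs => hW s (hL s hs).1
  have m1 : t ∈ closure (Ioo t (t + ε)) := by
    rw [closure_Ioo (by linarith)]; exact ⟨le_rfl, by linarith⟩
  have m2 : t ∈ closure (Ioo (t - ε) t) := by
    rw [closure_Ioo (by linarith)]; exact ⟨by linarith, le_rfl⟩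
  have e1 := iteratedDeriv_eq_of_mem_closure hf hφ hc m1
  have e2 := iteratedDeriv_eq_of_mem_closure hf hφ hc' m2
  have hcc : c = c' := mul_right_cancel₀ hk ((e1 k).symm.trans (e2 k))
  subst hcc
  refine ⟨c, mem_of_superset (Ioo_mem_nhds (show t - ε < t by linarith)
    (show t < t + ε by linarith)) fun s hs => ?_⟩
  rcases lt_trichotomy s t with h | rfl | h
  · exact hc' s ⟨hs.1, h⟩
  · simpa using e1 0
  · exact hc s ⟨h, hs.2⟩

/-- A function whose Wronskian with `φ` vanishes is a multiple of `φ`, if `φ` has only zeros of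
finite order. -/
theorem exists_eq_mul_of_wronskian {f φ : ℝ → ℝ} (hf : ContDiff ℝ ∞ f) (hφ : ContDiff ℝ ∞ φ)
    (hfin : {t ∈ Icc (0 : ℝ) 1 | φ t = 0}.Finite)
    (hord : ∀ t ∈ Ioo (0 : ℝ) 1, ∃ k, iteratedDeriv k φ t ≠ 0)
    {E : Set ℝ} (hE : E.Finite)
    (hW : ∀ t ∈ Ioo (0 : ℝ) 1 \ E, φ t * deriv f t = deriv φ t * f t) :
    ∃ c, ∀ t ∈ Icc (0 : ℝ) 1, f t = c * φ t := by
  have hW' : ∀ t ∈ Ioo (0 : ℝ) 1, φ t * deriv f t = deriv φ t * f t := by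
    have hcl : IsClosed {t | φ t * deriv f t = deriv φ t * f t} :=
      isClosed_eq (hφ.continuous.mul (hf.continuous_deriv (by simp)))
        ((hφ.continuous_deriv (by simp)).mul hf.continuous)
    exact fun t ht => closure_minimal hW hcl (Icc_subset_closure_diff hE ⟨ht.1.le, ht.2.le⟩)
  have hloc := fun t (ht : t ∈ Ioo (0 : ℝ) 1) => const_ratio_near hf hφ hfin hW' ht (hord t ht)
  have hhalf : (1 / 2 : ℝ) ∈ Ioo (0 : ℝ) 1 := by constructor <;> norm_num
  obtain ⟨c, hc⟩ := hloc _ hhalf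
  have hopen : IsOpen {t | ∀ᶠ s in 𝓝 t, f s = c * φ s} := isOpen_setOfPred_eventually_nhds
  -- The set where the local constant is `c` is open. It is also relatively closed, since near a
  -- limit point two local constants are compared at a point with `φ ≠ 0`.
  have hall : Ioo (0 : ℝ) 1 ⊆ {t | ∀ᶠ s in 𝓝 t, f s = c * φ s} := by
    refine isPreconnected_Ioo.subset_of_closure_inter_subset hopen ⟨_, hhalf, hc⟩ ?_
    rintro t ⟨htc, ht⟩
    obtain ⟨c', hc'⟩ := hloc t ht
    have hnhds : ∀ᶠ s in 𝓝 t, s ∈ Ioo (0 : ℝ) 1 ∧ ∀ᶠ r in 𝓝 s, f r = c' * φ r :=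
      (Ioo_mem_nhds ht.1 ht.2 |> fun h => h : ∀ᶠ s in 𝓝 t, s ∈ Ioo (0 : ℝ) 1).and
        (eventually_eventually_nhds.2 hc')
    obtain ⟨s, hs, hsc⟩ := ((mem_closure_iff_frequently.1 htc).and_eventually hnhds).exists
    have hcl : s ∈ closure (Ioo (0 : ℝ) 1 \ {t ∈ Icc (0 : ℝ) 1 | φ t = 0}) :=
      Icc_subset_closure_diff hfin ⟨hsc.1.1.le, hsc.1.2.le⟩
    obtain ⟨r, hr, h1, h2⟩ :=
      ((mem_closure_iff_frequently.1 hcl).and_eventually (hs.and hsc.2)).exists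
    have hr0 : φ r ≠ 0 := fun h0 => hr.2 ⟨⟨hr.1.1.le, hr.1.2.le⟩, h0⟩
    have hcc : c' = c := mul_right_cancel₀ hr0 (h2.symm.trans h1)
    exact hcc ▸ hc'
  refine ⟨c, fun t ht => ?_⟩
  have hcl : IsClosed {t | f t = c * φ t} :=
    isClosed_eq hf.continuous (continuous_const.mul hφ.continuous)
  have hsub : Ioo (0 : ℝ) 1 \ ∅ ⊆ {t | f t = c * φ t} := fun s hs => (hall hs.1).self_of_nhds
  exact closure_minimal hsub hcl (Icc_subset_closure_diff Set.finite_empty ht)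

/-- A curve whose direction is constant outside a finite set of parameters. -/
theorem exists_eq_smul_of_wronskian {f : ℝ → V4} {φ : ℝ → ℝ} (hf : ContDiff ℝ ∞ f)
    (hφ : ContDiff ℝ ∞ φ) (hfin : {t ∈ Icc (0 : ℝ) 1 | φ t = 0}.Finite)
    (hord : ∀ t ∈ Ioo (0 : ℝ) 1, ∃ k, iteratedDeriv k φ t ≠ 0)
    {E : Set ℝ} (hE : E.Finite)
    (hW : ∀ t ∈ Ioo (0 : ℝ) 1 \ E, φ t • deriv f t = deriv φ t • f t) :
    ∃ y, ∀ t ∈ Icc (0 : ℝ) 1, f t = φ t • y := by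
  have key : ∀ i, ∃ c, ∀ t ∈ Icc (0 : ℝ) 1, f t i = c * φ t := by
    intro i
    have hfi : ContDiff ℝ ∞ fun t => f t i := contDiff_pi.1 hf i
    refine exists_eq_mul_of_wronskian hfi hφ hfin hord hE fun t ht => ?_
    have hd : deriv (fun t => f t i) t = deriv f t i :=
      (hasDerivAt_pi.1 (hf.differentiable (by simp) t).hasDerivAt i).deriv
    rw [hd]
    exact congrFun (hW t ht) i
  choose y hy using key
  exact ⟨y, fun t ht => funext fun i => by simp [hy i t ht, mul_comm]⟩

/-! ### Characteristic lines and perspectivities of a supercyclidic patch -/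

namespace IsRegularPatch

variable {F : ℝ → ℝ → V4} {E₁ E₂ : Set ℝ}

/-- The planes of the parameter lines of one family are not all equal. -/
theorem plane_not_const (h : IsRegularPatch F E₁ E₂) {S : Set ℝ} (hS : S.Finite)
    (Q : Submodule ℝ V4) :
    ¬ ∀ v ∈ regularSet (E₂ ∪ S), supportingPlane (fun u => F u v) = Q := by
  intro hQ
  have hfin := h.finite₂.union hS
  obtain ⟨v, hv⟩ := (infinite_regularSet hfin).nonempty
  obtain ⟨u, hu⟩ := (infinite_regularSet h.finite₁).nonempty
  obtain ⟨w, hw, -, hwF⟩ := h.exists_apex (regularSet_union _ _ hv)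
  have huI := regularSet_subset _ hu
  have hmem : ∀ t ∈ regularSet (E₂ ∪ S), F u t ∈ Q := fun t ht => by
    rw [← hQ t ht]
    exact IsConicArc.mem_supportingPlane (γ := fun u => F u t) huI
  refine hw ?_
  rw [hQ v hv]
  refine span_pair_le (hmem v hv) ?_ (hwF u hu)
  exact deriv_mem_of_eventually ((h.smooth.curveV u).differentiable (by simp) v)
    (mem_of_superset (regularSet_mem_nhds hfin hv) hmem)

/-- The planes of all parameter lines of one family contain the characteristic line. -/
theorem exists_axis (h : IsRegularPatch F E₁ E₂) : ∃ A : Submodule ℝ V4, finrank ℝ A = 2 ∧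
    ∀ v ∈ Icc (0 : ℝ) 1, IsConicArc (fun u => F u v) → A ≤ supportingPlane fun u => F u v := by
  -- `z u` is the vertex of the cone along the line with parameter `u` fixed. It lies on the
  -- tangents of all crossing lines, hence in their planes.
  choose! z hz1 hz2 hz3 using fun u hu => h.swap.exists_apex (v := u) hu
  have hzP : ∀ u ∈ regularSet E₁, ∀ v ∈ regularSet E₂,
      z u ∈ Submodule.span ℝ {F u v, dU F u v} := fun u hu v hv => hz3 u hu v hv
  set A := Submodule.span ℝ (z '' regularSet E₁) with hA
  have hAP : ∀ v ∈ regularSet E₂, A ≤ supportingPlane fun u => F u v := by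
    intro v hv
    refine Submodule.span_le.2 ?_
    rintro _ ⟨u, hu, rfl⟩
    have huI := regularSet_subset _ hu
    exact span_pair_le (IsConicArc.mem_supportingPlane (γ := fun u => F u v) huI)
      (IsConicArc.deriv_mem (h.smooth.curveU v) huI) (hzP u hu v hv)
  obtain ⟨v₀, hv₀⟩ := (infinite_regularSet h.finite₂).nonempty
  obtain ⟨u₀, hu₀⟩ := (infinite_regularSet h.finite₁).nonempty
  have hge : 2 ≤ finrank ℝ A := by
    have hz0 : z u₀ ≠ 0 := fun e => hz1 u₀ hu₀ (e ▸ Submodule.zero_mem _)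
    by_cases hex : ∃ u ∈ regularSet E₁, z u ∉ Submodule.span ℝ {z u₀}
    · obtain ⟨u, hu, hzu⟩ := hex
      rw [← finrank_span_pair (indep_pair_of_ne hz0 hzu)]
      exact Submodule.finrank_mono (span_pair_le (Submodule.subset_span ⟨_, hu₀, rfl⟩)
        (Submodule.subset_span ⟨_, hu, rfl⟩))
    · push Not at hex
      exfalso
      -- If all vertices coincided, infinitely many tangents of one conic would pass through one
      -- point, and that point would be in the radical of `C`.
      have hγ := h.char.conicU v₀ hv₀
      obtain ⟨C, hC, h0⟩ := hγ.exists_form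
      have hle : supportingPlane (fun u => F u v₀) ≤ LinearMap.ker (C (z u₀)) := by
        refine hγ.supportingPlane_le_of_infinite (infinite_regularSet h.finite₁)
          (regularSet_subset _) fun u hu => ?_
        have hzu0 : z u ≠ 0 := fun e => hz1 u hu (e ▸ Submodule.zero_mem _)
        have huI := regularSet_subset _ hu
        obtain ⟨c, hc⟩ := Submodule.mem_span_singleton.1 (hex u hu)
        have hc0 : c ≠ 0 := by rintro rfl; exact hzu0 (by simpa using hc.symm)
        obtain ⟨a, b, e⟩ := Submodule.mem_span_pair.1 (hzP u hu v₀ hv₀)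
        have e1 : C (F u v₀) (dU F u v₀) = 0 :=
          IsConicArc.form_deriv hC.symm (h.smooth.curveU v₀) h0 hu.1
        have e2 : C (F u v₀) (F u v₀) = 0 := h0 u huI
        have e3 : c * C (F u v₀) (z u₀) = 0 := by
          rw [← smul_eq_mul, ← map_smul, hc, ← e]
          simp [e1, e2]
        rw [LinearMap.mem_ker, hC.symm]
        exact (mul_eq_zero.1 e3).resolve_left hc0
      exact hz0 (hC.nondeg _ (hAP v₀ hv₀ (Submodule.subset_span ⟨_, hu₀, rfl⟩)) fun q hq => hle hq)
  -- Otherwise `A` would fill the plane of every regular parameter line, so that these planes would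
  -- all be equal.
  have hle : finrank ℝ A ≤ 2 := by
    by_contra hgt
    refine h.plane_not_const Set.finite_empty A fun v hv => ?_
    have hv' := regularSet_union _ _ hv
    exact (Submodule.eq_of_le_of_finrank_le (hAP v hv') (by
      rw [(h.char.conicU v hv').finrank_supportingPlane]; omega)).symm
  have hA2 : finrank ℝ A = 2 := le_antisymm hle hge
  refine ⟨A, hA2, fun v hv hγ a ha => ?_⟩
  have m0 : (0 : ℝ) ∈ Icc (0 : ℝ) 1 := by simp
  have m1 : (1 : ℝ) ∈ Icc (0 : ℝ) 1 := by simp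
  have m2 : (1 / 2 : ℝ) ∈ Icc (0 : ℝ) 1 := by constructor <;> norm_num
  have hdep : ¬ LinearIndependent ℝ ![F 0 v, F 1 v, F (1 / 2) v, a] := by
    refine not_linearIndependent_of_mem_closure
      (f := fun v => ![F 0 v, F 1 v, F (1 / 2) v, a])
      (continuous_quad (h.smooth.continuousV 0) (h.smooth.continuousV 1)
        (h.smooth.continuousV (1 / 2)) continuous_const)
      (S := regularSet E₂) (fun s hs hi => ?_) (Icc_subset_closure_diff h.finite₂ hv)
    have hi3 := (h.char.conicU s hs).indep_three m0 m1 m2 (by norm_num) (by norm_num)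
      (by norm_num)
    refine notMem_span_triple hi ?_
    rw [span_triple_eq (h.char.conicU s hs).finrank_supportingPlane
      (IsConicArc.mem_supportingPlane (γ := fun u => F u s) m0)
      (IsConicArc.mem_supportingPlane (γ := fun u => F u s) m1)
      (IsConicArc.mem_supportingPlane (γ := fun u => F u s) m2) hi3]
    exact hAP s hs ha
  by_contra hane
  refine hdep (indep_quad_of_notMem
    (hγ.indep_three m0 m1 m2 (by norm_num) (by norm_num) (by norm_num)) fun hmem => hane ?_)
  exact span_triple_le (IsConicArc.mem_supportingPlane (γ := fun u => F u v) m0)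
    (IsConicArc.mem_supportingPlane (γ := fun u => F u v) m1)
    (IsConicArc.mem_supportingPlane (γ := fun u => F u v) m2) hmem

/-- Two parameter lines in different planes are perspective from a point of the characteristic
line in which the planes of the other family meet. -/
theorem exists_perspective (h : IsRegularPatch F E₁ E₂) {A : Submodule ℝ V4}
    (hA2 : finrank ℝ A = 2)
    (hAP : ∀ v ∈ Icc (0 : ℝ) 1, IsConicArc (fun u => F u v) → A ≤ supportingPlane fun u => F u v)
    {a b : ℝ} (ha : a ∈ Icc (0 : ℝ) 1) (hb : b ∈ Icc (0 : ℝ) 1)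
    (hqa : IsConicArc fun v => F a v) (hqb : IsConicArc fun v => F b v)
    (hne : supportingPlane (fun v => F a v) ≠ supportingPlane fun v => F b v) :
    ∃ y ∈ A, y ∉ supportingPlane (fun v => F a v) ∧ y ∉ supportingPlane (fun v => F b v) ∧
      ∀ v ∈ Icc (0 : ℝ) 1, ¬ LinearIndependent ℝ ![F a v, F b v, y] := by
  have hsa := h.smooth.curveV a
  have hsb := h.smooth.curveV b
  obtain ⟨p₁, hp₁, hp₁'⟩ : ∃ p ∈ supportingPlane (fun v => F a v), p ∉ A :=
    exists_mem_notMem (by rw [hA2, hqa.finrank_supportingPlane]; norm_num)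
  obtain ⟨n, hn1, hnA⟩ := exists_form_notMem hp₁'
  obtain ⟨p₂, hp₂, hp₂'⟩ : ∃ p ∈ supportingPlane (fun v => F b v),
      p ∉ supportingPlane fun v => F a v := by
    by_contra! hc
    exact hne (Submodule.eq_of_le_of_finrank_eq (show supportingPlane (fun v => F b v) ≤ _ from hc)
      (by rw [hqa.finrank_supportingPlane, hqb.finrank_supportingPlane])).symm
  obtain ⟨m, hm1, hm⟩ := exists_ker_eq_of_notMem hqa.finrank_supportingPlane hp₂'
  have hma : ∀ v ∈ Icc (0 : ℝ) 1, m (F a v) = 0 := fun v hv =>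
    (hm _).2 (IsConicArc.mem_supportingPlane (γ := fun v => F a v) hv)
  have hn1' : n p₁ ≠ 0 := by rw [hn1]; norm_num
  have hm1' : m p₂ ≠ 0 := by rw [hm1]; norm_num
  have z1 := hqa.finite_zeros hp₁ hn1'
  have z2 := hqb.finite_zeros hp₂ hm1'
  -- The point of the chord with `n = 0`. The chord lies in the plane of a parameter line, and there
  -- `n = 0` cuts out `A`. The form `m` vanishes on the first conic, so `m (f v) = φ v`.
  set f : ℝ → V4 := fun v => n (F a v) • F b v - n (F b v) • F a v with hf
  set φ : ℝ → ℝ := fun v => n (F a v) * m (F b v) with hφ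
  have sna := contDiff_map n hsa
  have snb := contDiff_map n hsb
  have smb := contDiff_map m hsb
  have hfs : ContDiff ℝ ∞ f := (sna.smul hsb).sub (snb.smul hsa)
  have hφs : ContDiff ℝ ∞ φ := sna.mul smb
  have hmf : ∀ v ∈ Icc (0 : ℝ) 1, m (f v) = φ v := fun v hv => by
    simp [hf, hφ, hma v hv]
  set Z := E₂ ∪ {v ∈ Icc (0 : ℝ) 1 | n (F a v) = 0} with hZ
  have hZf : Z.Finite := h.finite₂.union z1
  have hZn : ∀ v ∈ regularSet Z, n (F a v) ≠ 0 := fun v hv h0 =>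
    hv.2 (Or.inr ⟨regularSet_subset _ hv, h0⟩)
  have hPA : ∀ v ∈ regularSet Z, ∀ p ∈ supportingPlane (fun u => F u v), n p = 0 → p ∈ A := by
    intro v hv p hp hnp
    have hv2 := regularSet_union _ _ hv
    have hc := h.char.conicU v hv2
    have hn0 : n ≠ 0 := by rintro rfl; simp at hn1
    have hne : LinearMap.ker n ≠ supportingPlane fun u => F u v := fun e => by
      have : F a v ∈ LinearMap.ker n := by
        rw [e]; exact IsConicArc.mem_supportingPlane (γ := fun u => F u v) ha
      exact hZn v hv this
    have e := Submodule.eq_of_le_of_finrank_eq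
      (le_inf (show A ≤ LinearMap.ker n from fun p hp => hnA p hp)
        (hAP v (regularSet_subset _ hv) hc))
      (by rw [hA2, finrank_inf (finrank_ker_form hn0) hc.finrank_supportingPlane hne])
    rw [e]
    exact ⟨hnp, hp⟩
  have hfA : ∀ v ∈ regularSet Z, f v ∈ A := by
    intro v hv
    refine hPA v hv _ ?_ ?_
    · exact Submodule.sub_mem _
        (Submodule.smul_mem _ _ (IsConicArc.mem_supportingPlane (γ := fun u => F u v) hb))
        (Submodule.smul_mem _ _ (IsConicArc.mem_supportingPlane (γ := fun u => F u v) ha))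
    · simp [hf, mul_comm]
  have hW : ∀ v ∈ Ioo (0 : ℝ) 1 \ Z, φ v • deriv f v = deriv φ v • f v := by
    intro v hv
    have hv2 := regularSet_union _ _ hv
    have hvI := regularSet_subset _ hv
    have hc := h.char.conicU v hv2
    obtain ⟨w, hw, hwF, -⟩ := h.exists_apex hv2
    obtain ⟨α, d, ea⟩ := hwF a ha
    obtain ⟨β, e, eb⟩ := hwF b hb
    have da := h.smooth.hasDerivAt_dV a v
    have db := h.smooth.hasDerivAt_dV b v
    have df : HasDerivAt f (n (F a v) • dV F b v + n (dV F a v) • F b v -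
        (n (F b v) • dV F a v + n (dV F b v) • F a v)) v :=
      ((hasDerivAt_map n da).smul db).sub ((hasDerivAt_map n db).smul da)
    have hd : deriv f v ∈ A := deriv_mem_of_eventually (hfs.differentiable (by simp) v)
      (mem_of_superset (regularSet_mem_nhds hZf hv) hfA)
    have hF' : deriv f v = (α + β) • f v + (n (F a v) * e - n (F b v) * d) • w +
        n w • (d • F b v - e • F a v) := by
      rw [df.deriv, ea, eb, hf]
      simp only [map_add, map_smul, smul_eq_mul]
      module
    have hAP' := hAP v hvI hc
    -- `f`, its derivative and the chord all lie in the plane of the parameter line, whereas `w`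
    -- does not; so the coefficient of `w` vanishes, and the rest of `f'` is a multiple of `f`.
    have hde : n (F a v) * e = n (F b v) * d := by
      by_contra hne
      refine hw ?_
      have hmem : (n (F a v) * e - n (F b v) * d) • w ∈ supportingPlane fun u => F u v := by
        have : (n (F a v) * e - n (F b v) * d) • w =
            deriv f v - (α + β) • f v - n w • (d • F b v - e • F a v) := by
          rw [hF']; module
        rw [this]
        refine Submodule.sub_mem _ (Submodule.sub_mem _ (hAP' hd)
          (Submodule.smul_mem _ _ (hAP' (hfA v hv)))) (Submodule.smul_mem _ _ ?_)
        exact Submodule.sub_mem _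
          (Submodule.smul_mem _ _ (IsConicArc.mem_supportingPlane (γ := fun u => F u v) hb))
          (Submodule.smul_mem _ _ (IsConicArc.mem_supportingPlane (γ := fun u => F u v) ha))
      exact (Submodule.smul_mem_iff _ (sub_ne_zero.2 hne)).1 hmem
    have hna := hZn v hv
    have hpar : deriv f v = (α + β + d / n (F a v) * n w) • f v := by
      have he : e = n (F b v) * d / n (F a v) := by
        rw [eq_div_iff hna, mul_comm]; exact hde
      have : d • F b v - e • F a v = (d / n (F a v)) • f v := by
        rw [he, hf]
        simp only [smul_sub, smul_smul]
        rw [div_mul_cancel₀ _ hna]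
        congr 2
        ring
      rw [hF', this, hde, sub_self]
      module
    have hφ' : deriv φ v = m (deriv f v) := by
      have h1 := hasDerivAt_map m (hfs.differentiable (by simp) v).hasDerivAt
      have h2 : φ =ᶠ[𝓝 v] fun s => m (f s) :=
        mem_of_superset (Ioo_mem_nhds hv.1.1 hv.1.2) fun s hs => (hmf s ⟨hs.1.le, hs.2.le⟩).symm
      exact (h1.congr_of_eventuallyEq h2).deriv
    rw [hφ', hpar, map_smul, hmf v hvI, smul_smul, smul_eq_mul, mul_comm]
  have hφfin : {v ∈ Icc (0 : ℝ) 1 | φ v = 0}.Finite := by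
    refine (z1.union z2).subset fun v hv => ?_
    rcases mul_eq_zero.1 hv.2 with h0 | h0
    · exact Or.inl ⟨hv.1, h0⟩
    · exact Or.inr ⟨hv.1, h0⟩
  -- `φ` is a product of linear forms along two conics, so its zeros have finite order and the
  -- direction of `f` cannot jump there.
  obtain ⟨y, hy⟩ := exists_eq_smul_of_wronskian hfs hφs hφfin (fun t ht =>
    exists_iteratedDeriv_mul_ne_zero sna smb (hqa.exists_iteratedDeriv_ne_zero hsa hp₁ hn1' ht)
      (hqb.exists_iteratedDeriv_ne_zero hsb hp₂ hm1' ht)) hZf hW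
  obtain ⟨v₁, hv₁⟩ := (infinite_regularSet (hZf.union hφfin)).nonempty
  have hv₁Z := regularSet_union _ _ hv₁
  have hv₁I := regularSet_subset _ hv₁
  have hφ1 : φ v₁ ≠ 0 := fun h0 => hv₁.2 (Or.inr ⟨hv₁I, h0⟩)
  have hyA : y ∈ A := by
    have := hfA v₁ hv₁Z
    rw [hy v₁ hv₁I] at this
    exact (Submodule.smul_mem_iff _ hφ1).1 this
  have hmy : m y = 1 := by
    have := hmf v₁ hv₁I
    rw [hy v₁ hv₁I, map_smul, smul_eq_mul] at this
    exact mul_left_cancel₀ hφ1 (by rw [this, mul_one])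
  have hdep : ∀ v ∈ Icc (0 : ℝ) 1, ¬ LinearIndependent ℝ ![F a v, F b v, y] := by
    intro v hv
    refine not_linearIndependent_of_mem_closure (f := fun v => ![F a v, F b v, y])
      (continuous_triple hsa.continuous hsb.continuous continuous_const) (S := regularSet Z)
      (fun s hs hi => ?_) (Icc_subset_closure_diff hZf hv)
    have e := hy s (regularSet_subset _ hs)
    have := (indep_triple_iff.1 hi (-n (F b s)) (n (F a s)) (-φ s) (by
      rw [neg_smul _ y, ← e, hf]; module)).2.1
    exact hZn s hs this
  refine ⟨y, hyA, fun hya => ?_, fun hyb => ?_, hdep⟩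
  · rw [(hm y).2 hya] at hmy
    norm_num at hmy
  -- If `y` were in the plane of the second conic, projecting from `y` would put the first conic
  -- into that plane too.
  · have hy0 : y ≠ 0 := by rintro rfl; simp at hmy
    refine hne ?_
    have hle : supportingPlane (fun v => F a v) ≤ supportingPlane fun v => F b v := by
      have hfy : {v ∈ Icc (0 : ℝ) 1 | F b v ∈ Submodule.span ℝ {y}}.Finite :=
        hqb.finite_mem (hqb.not_le_of_finrank_le_two (by
          rw [finrank_span_singleton hy0]; norm_num))
      refine hqa.supportingPlane_le_of_infinite (infinite_regularSet hfy)
        (regularSet_subset _) fun v hv => ?_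
      have hvI := regularSet_subset _ hv
      have hi : LinearIndependent ℝ ![y, F b v] := by
        refine indep_pair_of_ne hy0 fun hmem => hv.2 ⟨hvI, hmem⟩
      by_contra hna
      refine hdep v hvI ?_
      have := indep_triple_of_notMem hi fun hmem => hna
        (span_pair_le hyb (IsConicArc.mem_supportingPlane (γ := fun v => F b v) hvI) hmem)
      rw [indep_triple_iff] at this ⊢
      intro r s t e
      obtain ⟨e1, e2, e3⟩ := this t s r (by rw [← e]; abel)
      exact ⟨e3, e2, e1⟩
    exact Submodule.eq_of_le_of_finrank_eq hle
      (by rw [hqa.finrank_supportingPlane, hqb.finrank_supportingPlane])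

end IsRegularPatch

/-! ### Reparametrization of arcs -/

theorem exists_param_of_arc_subset {γ δ : ℝ → V4} (h : arc δ ⊆ arc γ) {t : ℝ}
    (ht : t ∈ Icc (0 : ℝ) 1) (h0 : δ t ≠ 0) :
    ∃ s ∈ Icc (0 : ℝ) 1, Submodule.span ℝ {δ t} = Submodule.span ℝ {γ s} := by
  obtain ⟨s, hs, e⟩ := h (show Projectivization.mk ℝ (δ t) h0 ∈ arc δ from
    ⟨t, ht, Projectivization.submodule_mk _ _⟩)
  exact ⟨s, hs, by rw [← e, Projectivization.submodule_mk]⟩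

theorem supportingPlane_le_of_arc_subset {γ δ : ℝ → V4} (h : arc δ ⊆ arc γ) :
    supportingPlane δ ≤ supportingPlane γ := by
  refine Submodule.span_le.2 ?_
  rintro _ ⟨t, ht, rfl⟩
  by_cases h0 : δ t = 0
  · rw [h0]; exact Submodule.zero_mem _
  obtain ⟨s, hs, e⟩ := exists_param_of_arc_subset h ht h0
  exact (mem_iff_of_span_eq e _).2 (IsConicArc.mem_supportingPlane hs)

theorem supportingPlane_eq_of_arc_eq {γ δ : ℝ → V4} (h : arc γ = arc δ) :
    supportingPlane γ = supportingPlane δ :=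
  le_antisymm (supportingPlane_le_of_arc_subset h.le) (supportingPlane_le_of_arc_subset h.ge)

theorem dep_of_span_eq {p q : V4} (h : Submodule.span ℝ {p} = Submodule.span ℝ {q}) :
    ¬ LinearIndependent ℝ ![p, q] := by
  intro hi
  have hq : q ∈ Submodule.span ℝ {p} := by rw [h]; exact Submodule.mem_span_singleton_self q
  obtain ⟨c, hc⟩ := Submodule.mem_span_singleton.1 hq
  have := (indep_pair_iff.1 hi c (-1) (by rw [hc]; module)).2
  norm_num at this

/-- Two conic arcs with the same points and the same end points differ by an increasing
reparametrization. -/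
theorem exists_reparam {γ δ : ℝ → V4} (hγ : IsConicArc γ) (hδ : IsConicArc δ)
    (cγ : Continuous γ) (cδ : Continuous δ) (h : arc γ = arc δ)
    (h0 : Submodule.span ℝ {δ 0} = Submodule.span ℝ {γ 0})
    (h1 : Submodule.span ℝ {δ 1} = Submodule.span ℝ {γ 1}) :
    ∃ τ : unitInterval ≃o unitInterval, ∀ s : unitInterval,
      Submodule.span ℝ {δ s} = Submodule.span ℝ {γ (τ s)} := by
  have hex : ∀ s : unitInterval, ∃ t : unitInterval,
      Submodule.span ℝ {δ s} = Submodule.span ℝ {γ t} := fun s => by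
    obtain ⟨t, ht, e⟩ := exists_param_of_arc_subset h.ge s.2 (hδ.ne_zero s.2)
    exact ⟨⟨t, ht⟩, e⟩
  choose τ hτ using hex
  have huniq : ∀ s t : unitInterval, Submodule.span ℝ {δ s} = Submodule.span ℝ {γ t} → τ s = t := by
    intro s t e
    by_contra hne
    exact dep_of_span_eq ((hτ s).symm.trans e)
      (hγ.injective _ (τ s).2 _ t.2 fun e => hne (Subtype.ext e))
  have hinj : Function.Injective τ := by
    intro s t e
    by_contra hne
    exact dep_of_span_eq ((hτ s).trans (e ▸ (hτ t).symm))
      (hδ.injective _ s.2 _ t.2 fun e => hne (Subtype.ext e))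
  have hsurj : Function.Surjective τ := by
    intro t
    obtain ⟨s, hs, e⟩ := exists_param_of_arc_subset h.le t.2 (hγ.ne_zero t.2)
    exact ⟨⟨s, hs⟩, huniq ⟨s, hs⟩ t e.symm⟩
  -- The graph is closed, being defined by linear dependence, and projection along a compact factor
  -- is a closed map.
  have hcont : Continuous τ := by
    have hgraph : IsClosed {p : unitInterval × unitInterval |
        ¬ LinearIndependent ℝ ![δ p.1, γ p.2]} := by
      refine (isOpen_setOfPred_linearIndependent.preimage (continuous_pair ?_ ?_)).isClosed_compl
      · exact cδ.comp (continuous_subtype_val.comp continuous_fst)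
      · exact cγ.comp (continuous_subtype_val.comp continuous_snd)
    have hg : ∀ s t : unitInterval, ¬ LinearIndependent ℝ ![δ s, γ t] ↔ τ s = t := fun s t =>
      ⟨fun hd => huniq s t (span_eq_of_dep (hδ.ne_zero s.2) (hγ.ne_zero t.2) hd), fun e =>
        dep_of_span_eq (e ▸ hτ s)⟩
    rw [continuous_iff_isClosed]
    intro C hC
    have e : τ ⁻¹' C = Prod.fst '' ({p : unitInterval × unitInterval |
        ¬ LinearIndependent ℝ ![δ p.1, γ p.2]} ∩ Prod.snd ⁻¹' C) := by
      ext s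
      constructor
      · intro hs
        exact ⟨(s, τ s), ⟨(hg s (τ s)).2 rfl, hs⟩, rfl⟩
      · rintro ⟨⟨s', t⟩, ⟨hd, ht⟩, rfl⟩
        have := (hg s' t).1 hd
        rw [mem_preimage, this]
        exact ht
    rw [e]
    exact isClosedMap_fst_of_compactSpace _ (hgraph.inter (hC.preimage continuous_snd))
  -- A continuous injection of an interval is strictly monotone; the end points exclude the
  -- decreasing case.
  have hmono : StrictMono τ := by
    refine hcont.strictMono_of_inj_boundedOrder ?_ hinj
    have e0 : τ ⊥ = ⊥ := huniq _ _ h0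
    have e1 : τ ⊤ = ⊤ := huniq _ _ h1
    rw [e0, e1]
    exact bot_le
  exact ⟨hmono.orderIsoOfSurjective τ hsurj, fun s => hτ s⟩

/-- `δ` is up to reparametrization the image of `γ` under the linear map `φ`. -/
def ArcMap (φ : V4 →ₗ[ℝ] V4) (γ δ : ℝ → V4) : Prop :=
  ∃ τ : unitInterval ≃o unitInterval, ∀ s : unitInterval,
    Submodule.span ℝ {δ s} = Submodule.span ℝ {φ (γ (τ s))}

theorem span_map_eq {p q : V4} (h : Submodule.span ℝ {p} = Submodule.span ℝ {q})
    (φ : V4 →ₗ[ℝ] V4) : Submodule.span ℝ {φ p} = Submodule.span ℝ {φ q} := by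
  have := congrArg (Submodule.map φ) h
  simpa [Submodule.map_span] using this

theorem ArcMap.comp {φ ψ : V4 →ₗ[ℝ] V4} {γ δ ε : ℝ → V4} (h : ArcMap φ γ δ) (k : ArcMap ψ δ ε) :
    ArcMap (ψ ∘ₗ φ) γ ε := by
  obtain ⟨τ, hτ⟩ := h
  obtain ⟨σ, hσ⟩ := k
  exact ⟨σ.trans τ, fun s => (hσ s).trans (span_map_eq (hτ (σ s)) ψ)⟩

theorem ArcMap.arc_eq {φ : V4 →ₗ[ℝ] V4} {γ δ : ℝ → V4} (h : ArcMap φ γ δ) :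
    arc δ = arc fun t => φ (γ t) := by
  obtain ⟨τ, hτ⟩ := h
  ext p
  constructor
  · rintro ⟨t, ht, e⟩
    exact ⟨τ ⟨t, ht⟩, (τ ⟨t, ht⟩).2, e.trans (hτ ⟨t, ht⟩)⟩
  · rintro ⟨t, ht, e⟩
    refine ⟨τ.symm ⟨t, ht⟩, (τ.symm ⟨t, ht⟩).2, e.trans ?_⟩
    rw [hτ, OrderIso.apply_symm_apply]

theorem ArcMap.of_span_eq {φ : V4 →ₗ[ℝ] V4} {γ δ : ℝ → V4}
    (h : ∀ t ∈ Icc (0 : ℝ) 1, Submodule.span ℝ {δ t} = Submodule.span ℝ {φ (γ t)}) :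
    ArcMap φ γ δ :=
  ⟨OrderIso.refl _, fun s => h s s.2⟩

theorem arcMap_id {γ δ : ℝ → V4} (hγ : IsConicArc γ) (hδ : IsConicArc δ)
    (cγ : Continuous γ) (cδ : Continuous δ) (h : arc γ = arc δ)
    (h0 : Submodule.span ℝ {δ 0} = Submodule.span ℝ {γ 0})
    (h1 : Submodule.span ℝ {δ 1} = Submodule.span ℝ {γ 1}) : ArcMap LinearMap.id γ δ :=
  exists_reparam hγ hδ cγ cδ h h0 h1

/-! ### Boundary curves determine a patch -/

theorem zero_mem_I : (0 : ℝ) ∈ Icc (0 : ℝ) 1 := by simp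

theorem one_mem_I : (1 : ℝ) ∈ Icc (0 : ℝ) 1 := by simp

namespace IsSCPatch

variable {F G : ℝ → ℝ → V4}

theorem smooth2 (h : IsSCPatch F) : Smooth2 F := h.smooth

/-- Parameter lines of one family are perspective from points of the intersection line of the
boundary planes of the other family. -/
theorem exists_perspective (h : IsSCPatch F) {E₁ E₂ : Set ℝ} (hr : IsRegularPatch F E₁ E₂)
    {a : ℝ} (ha : a ∈ regularSet E₁ ∨ a = 1)
    (hne : supportingPlane (fun v => F 0 v) ≠ supportingPlane fun v => F a v) :
    ∃ y ∈ (supportingPlane (fun u => F u 0) ⊓ supportingPlane fun u => F u 1 : Submodule ℝ V4),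
      y ∉ supportingPlane (fun v => F 0 v) ∧ y ∉ supportingPlane (fun v => F a v) ∧
      ∀ v ∈ Icc (0 : ℝ) 1, ¬ LinearIndependent ℝ ![F 0 v, F a v, y] := by
  obtain ⟨A, hA2, hAP⟩ := hr.exists_axis
  have haI : a ∈ Icc (0 : ℝ) 1 := by
    rcases ha with ha | rfl
    · exact regularSet_subset _ ha
    · exact one_mem_I
  have hqa : IsConicArc fun v => F a v := by
    rcases ha with ha | rfl
    · exact hr.char.conicV a ha
    · exact h.boundaryV1
  obtain ⟨y, hy, h1, h2, h3⟩ := hr.exists_perspective hA2 hAP zero_mem_I haI h.boundaryV0 hqa hne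
  exact ⟨y, ⟨hAP 0 zero_mem_I h.boundaryU0 hy, hAP 1 one_mem_I h.boundaryU1 hy⟩, h1, h2, h3⟩

/-- Opposite boundary curves are related by a perspectivity. -/
theorem exists_boundary_map (h : IsSCPatch F)
    (hne : supportingPlane (fun v => F 0 v) ≠ supportingPlane fun v => F 1 v) :
    ∃ (y : V4) (l : V4 →ₗ[ℝ] ℝ), y ∉ supportingPlane (fun v => F 0 v) ∧
      y ∈ Submodule.span ℝ {F 0 0, F 1 0} ∧ y ∈ Submodule.span ℝ {F 0 1, F 1 1} ∧
      ∀ v ∈ Icc (0 : ℝ) 1,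
        Submodule.span ℝ {F 1 v} = Submodule.span ℝ {F 0 v + l (F 0 v) • y} := by
  obtain ⟨E₁, E₂, hr⟩ := h.exists_regular
  obtain ⟨y, -, h1, h2, h3⟩ := h.exists_perspective hr (Or.inr rfl) hne
  obtain ⟨m, hmy, hm⟩ := exists_ker_eq_of_notMem h.boundaryV1.finrank_supportingPlane h2
  have hend : ∀ v ∈ Icc (0 : ℝ) 1, LinearIndependent ℝ ![F 0 v, F 1 v] →
      y ∈ Submodule.span ℝ {F 0 v, F 1 v} := fun v hv hi => by
    by_contra hy
    exact h3 v hv (indep_triple_of_notMem hi hy)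
  refine ⟨y, -m, h1, hend 0 zero_mem_I (h.boundaryU0.injective 0 zero_mem_I 1 one_mem_I (by simp)),
    hend 1 one_mem_I (h.boundaryU1.injective 0 zero_mem_I 1 one_mem_I (by simp)), fun v hv => ?_⟩
  have hF0 : F 0 v ≠ 0 := h.boundaryV0.ne_zero hv
  have hF1 : F 1 v ≠ 0 := h.boundaryV1.ne_zero hv
  have hi : LinearIndependent ℝ ![F 0 v, y] := indep_pair_of_ne hF0 fun hmem =>
    h1 ((Submodule.span_singleton_le_iff_mem _ _).2
      (IsConicArc.mem_supportingPlane (γ := fun v => F 0 v) hv) hmem)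
  have hmem : F 1 v ∈ Submodule.span ℝ {F 0 v, y} := by
    by_contra hc
    exact h3 v hv (indep_swap_of_triple (indep_triple_of_notMem hi hc))
  obtain ⟨a, b, e⟩ := Submodule.mem_span_pair.1 hmem
  have hm1 : m (F 1 v) = 0 :=
    (hm _).2 (IsConicArc.mem_supportingPlane (γ := fun v => F 1 v) hv)
  have hb : b = -(a * m (F 0 v)) := by
    rw [← e] at hm1
    simp only [map_add, map_smul, smul_eq_mul, hmy] at hm1
    linarith
  have ha : a ≠ 0 := by
    rintro rfl
    rw [hb] at e
    exact hF1 (by rw [← e]; simp)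
  refine span_singleton_eq_iff.2 ⟨a, ha, ?_⟩
  rw [← e, hb]
  simp only [LinearMap.neg_apply]
  module

end IsSCPatch

/-- The data at one parameter point that determine the point of the patch. -/
theorem dep_of_two_lines {x p q r r' y y' z z' : V4} {A B : Submodule ℝ V4}
    (hx : LinearIndependent ℝ ![x, q, p]) (hxA : x ∉ A) (hxB : x ∉ B) (hpA : p ∉ A)
    (hy : y ∈ A) (hy' : y' ∈ A) (hz : z ∈ B) (hz' : z' ∈ B)
    (hyxp : y ∈ Submodule.span ℝ {x, p}) (hyxp' : y' ∈ Submodule.span ℝ {x, p})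
    (hzxq : z ∈ Submodule.span ℝ {x, q}) (hzxq' : z' ∈ Submodule.span ℝ {x, q})
    (hr : r ∈ Submodule.span ℝ {q, y}) (hr' : r' ∈ Submodule.span ℝ {q, y'})
    (hs : r ∈ Submodule.span ℝ {p, z}) (hs' : r' ∈ Submodule.span ℝ {p, z'})
    (hqy : LinearIndependent ℝ ![q, y]) (hpz : LinearIndependent ℝ ![p, z]) :
    ¬ LinearIndependent ℝ ![r, r'] := by
  -- The line `xp` meets `A` in at most one point because `x ∉ A`; so the two centres agree.
  have hpar : ∀ {A : Submodule ℝ V4} {p y y' : V4}, x ∉ A → y ∈ A → y' ∈ A →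
      LinearIndependent ℝ ![x, p] → y ∈ Submodule.span ℝ {x, p} →
      y' ∈ Submodule.span ℝ {x, p} → y ≠ 0 → y' ∈ Submodule.span ℝ {y} := by
    intro A p y y' hxA hy hy' hi h h' hy0
    by_contra hc
    have hyy := indep_pair_of_ne hy0 hc
    have e := span_pair_eq (finrank_span_pair hi) h h' hyy
    exact hxA (span_pair_le hy hy' (by rw [e]; exact Submodule.subset_span (by simp)))
  have hxp : LinearIndependent ℝ ![x, p] := indep_pair_of_triple (indep_swap_of_triple hx)
  have hxq : LinearIndependent ℝ ![x, q] := indep_pair_of_triple hx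
  have k1 := hpar hxA hy hy' hxp hyxp hyxp' (right_ne_zero_of_indep hqy)
  have k2 := hpar hxB hz hz' hxq hzxq hzxq' (right_ne_zero_of_indep hpz)
  have sub : ∀ {q y y' : V4}, y' ∈ Submodule.span ℝ {y} →
      Submodule.span ℝ {q, y'} ≤ Submodule.span ℝ {q, y} := fun {q y y'} h =>
    span_pair_le (Submodule.subset_span (by simp))
      (Submodule.span_mono (by simp : ({y} : Set V4) ⊆ {q, y}) h)
  intro hi
  have e1 := span_pair_eq (finrank_span_pair hqy) hr (sub k1 hr') hi
  have e2 := span_pair_eq (finrank_span_pair hpz) hs (sub k2 hs') hi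
  -- If `r` and `r'` were different points, the lines `qy` and `pz` would coincide and contain `p`.
  -- As `y` is on the line `xp` and `x, q, p` are independent, `y` would be the point `p`, contrary
  -- to `p ∉ A`.
  have hp : p ∈ Submodule.span ℝ {q, y} := by
    rw [← e1, e2]; exact Submodule.subset_span (by simp)
  obtain ⟨s, t, e⟩ := Submodule.mem_span_pair.1 hp
  obtain ⟨α, β, e'⟩ := Submodule.mem_span_pair.1 hyxp
  obtain ⟨h1, -, h3⟩ := indep_triple_iff.1 hx (t * α) s (t * β - 1) (by
    rw [← e'] at e
    calc (t * α) • x + s • q + (t * β - 1) • p = s • q + t • (α • x + β • p) - p := by module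
      _ = 0 := by rw [e, sub_self])
  have ht : t ≠ 0 := by rintro rfl; norm_num at h3
  have hα : α = 0 := (mul_eq_zero.1 h1).resolve_left ht
  subst hα
  have hβ : β ≠ 0 := by rintro rfl; norm_num at h3
  refine hpA ((Submodule.smul_mem_iff A hβ).1 ?_)
  rw [zero_smul, zero_add] at e'
  rwa [e']

namespace IsSCPatch

variable {F G : ℝ → ℝ → V4}

/-- The centre lies on the line joining the two corners but not in the opposite boundary plane. If
that plane contained `F 0 0`, it would contain the whole line. -/
theorem corner_notMem (h : IsSCPatch F)
    (hne : supportingPlane (fun v => F 0 v) ≠ supportingPlane fun v => F 1 v) :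
    F 0 0 ∉ supportingPlane fun v => F 1 v := by
  obtain ⟨E₁, E₂, hr⟩ := h.exists_regular
  obtain ⟨y, -, -, h2, h3⟩ := h.exists_perspective hr (Or.inr rfl) hne
  intro hmem
  have hi : LinearIndependent ℝ ![F 0 0, F 1 0] :=
    h.boundaryU0.injective 0 zero_mem_I 1 one_mem_I (by simp)
  by_contra
  refine h3 0 zero_mem_I (indep_triple_of_notMem hi fun hy => h2 ?_)
  exact span_pair_le hmem
    (IsConicArc.mem_supportingPlane (γ := fun v => F 1 v) zero_mem_I) hy

/-- For all but finitely many `u`, the parameter line of each patch is perspective to the boundary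
curve with parameter zero. Both centres lie on the line joining `F 0 0` to `F u 0` and on the
intersection of the two boundary planes, which is common to both patches. This puts the two surface
points on lines through the same boundary point. -/
theorem exists_good_parameters (hF : IsSCPatch F) (hG : IsSCPatch G)
    {φ ψ : unitInterval ≃o unitInterval}
    (hφ : ∀ u : unitInterval, Submodule.span ℝ {F u 0} = Submodule.span ℝ {G (φ u) 0})
    (hψ : ∀ v : unitInterval, Submodule.span ℝ {F 0 v} = Submodule.span ℝ {G 0 (ψ v)})
    (eP0 : supportingPlane (fun u => F u 0) = supportingPlane fun u => G u 0)
    (eP1 : supportingPlane (fun u => F u 1) = supportingPlane fun u => G u 1)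
    (eQ0 : supportingPlane (fun v => F 0 v) = supportingPlane fun v => G 0 v)
    (c00 : Submodule.span ℝ {F 0 0} = Submodule.span ℝ {G 0 0})
    (hP : supportingPlane (fun u => F u 0) ≠ supportingPlane fun u => F u 1)
    (hPQ : supportingPlane (fun u => F u 0) ≠ supportingPlane fun v => F 0 v) :
    ∃ S : Set unitInterval, S.Finite ∧ ∀ u ∉ S, F u 0 ∉ supportingPlane (fun v => F 0 v) ∧
      F u 0 ∉ (supportingPlane (fun u => F u 0) ⊓ supportingPlane fun u => F u 1 :
        Submodule ℝ V4) ∧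
      ∃ y ∈ (supportingPlane (fun u => F u 0) ⊓ supportingPlane fun u => F u 1 : Submodule ℝ V4),
      ∃ y' ∈ (supportingPlane (fun u => F u 0) ⊓ supportingPlane fun u => F u 1 : Submodule ℝ V4),
        y ∈ Submodule.span ℝ {F 0 0, F u 0} ∧ y' ∈ Submodule.span ℝ {F 0 0, F u 0} ∧
        ∀ v : unitInterval, LinearIndependent ℝ ![F 0 v, y] ∧
          F u v ∈ Submodule.span ℝ {F 0 v, y} ∧
          G (φ u) (ψ v) ∈ Submodule.span ℝ {F 0 v, y'} := by
  obtain ⟨E₁, E₂, hr⟩ := hF.exists_regular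
  obtain ⟨E₁', E₂', hr'⟩ := hG.exists_regular
  have fin1 : {t ∈ Icc (0 : ℝ) 1 | F t 0 ∈ supportingPlane fun v => F 0 v}.Finite :=
    hF.boundaryU0.finite_mem fun hle => hPQ (Submodule.eq_of_le_of_finrank_eq hle
      (by rw [hF.boundaryU0.finrank_supportingPlane, hF.boundaryV0.finrank_supportingPlane]))
  have fin2 : {t ∈ Icc (0 : ℝ) 1 | F t 0 ∈ (supportingPlane (fun u => F u 0) ⊓
      supportingPlane fun u => F u 1 : Submodule ℝ V4)}.Finite :=
    hF.boundaryU0.finite_mem (hF.boundaryU0.not_le_of_finrank_le_two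
      (finrank_inf hF.boundaryU0.finrank_supportingPlane
        hF.boundaryU1.finrank_supportingPlane hP).le)
  set T : Set ℝ := {0, 1} ∪ E₁ ∪ ({t ∈ Icc (0 : ℝ) 1 | F t 0 ∈ supportingPlane fun v => F 0 v} ∪
    {t ∈ Icc (0 : ℝ) 1 | F t 0 ∈ (supportingPlane (fun u => F u 0) ⊓
      supportingPlane fun u => F u 1 : Submodule ℝ V4)}) with hT
  set T' : Set ℝ := {0, 1} ∪ E₁' with hT'
  have hTf : T.Finite := ((Set.toFinite {0, 1}).union hr.finite₁).union (fin1.union fin2)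
  have hTf' : T'.Finite := (Set.toFinite {0, 1}).union hr'.finite₁
  refine ⟨(fun u : unitInterval => (u : ℝ)) ⁻¹' T ∪ (fun u : unitInterval => (φ u : ℝ)) ⁻¹' T',
    (hTf.preimage Subtype.val_injective.injOn).union
      (hTf'.preimage (Subtype.val_injective.comp φ.injective).injOn), fun u hu => ?_⟩
  have huT : (u : ℝ) ∉ T := fun h => hu (Or.inl h)
  have huT' : (φ u : ℝ) ∉ T' := fun h => hu (Or.inr h)
  have hp1 : F u 0 ∉ supportingPlane fun v => F 0 v := fun h => huT (Or.inr (Or.inl ⟨u.2, h⟩))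
  have hp2 : F u 0 ∉ (supportingPlane (fun u => F u 0) ⊓
    supportingPlane fun u => F u 1 : Submodule ℝ V4) := fun h => huT (Or.inr (Or.inr ⟨u.2, h⟩))
  have hur : (u : ℝ) ∈ regularSet E₁ := by
    refine ⟨⟨lt_of_le_of_ne u.2.1 fun h => ?_, lt_of_le_of_ne u.2.2 fun h => ?_⟩, fun h => ?_⟩
    · exact huT (Or.inl (Or.inl (Or.inl h.symm)))
    · exact huT (Or.inl (Or.inl (Or.inr h)))
    · exact huT (Or.inl (Or.inr h))
  have hur' : (φ u : ℝ) ∈ regularSet E₁' := by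
    refine ⟨⟨lt_of_le_of_ne (φ u).2.1 fun h => ?_, lt_of_le_of_ne (φ u).2.2 fun h => ?_⟩,
      fun h => ?_⟩
    · exact huT' (Or.inl (Or.inl h.symm))
    · exact huT' (Or.inl (Or.inr h))
    · exact huT' (Or.inr h)
  have hne : supportingPlane (fun v => F 0 v) ≠ supportingPlane fun v => F u v := fun e =>
    hp1 (e ▸ IsConicArc.mem_supportingPlane (γ := fun v => F u v) zero_mem_I)
  have hne' : supportingPlane (fun v => G 0 v) ≠ supportingPlane fun v => G (φ u) v := fun e => by
    refine hp1 ((mem_iff_of_span_eq (hφ u) _).2 ?_)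
    rw [eQ0, e]
    exact IsConicArc.mem_supportingPlane (γ := fun v => G (φ u) v) zero_mem_I
  obtain ⟨y, hyA, hy0, -, hy⟩ := hF.exists_perspective hr (Or.inl hur) hne
  obtain ⟨y', hyA', hy0', -, hy'⟩ := hG.exists_perspective hr' (Or.inl hur') hne'
  have hi : LinearIndependent ℝ ![F 0 0, F u 0] :=
    hF.boundaryU0.injective 0 zero_mem_I u u.2 hur.1.1.ne
  have hqy : ∀ v : unitInterval, LinearIndependent ℝ ![F 0 v, y] := fun v =>
    indep_pair_of_ne (hF.boundaryV0.ne_zero v.2) fun hmem => hy0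
      ((Submodule.span_singleton_le_iff_mem _ _).2
        (IsConicArc.mem_supportingPlane (γ := fun v => F 0 v) v.2) hmem)
  have hqy' : ∀ v : unitInterval, LinearIndependent ℝ ![G 0 v, y'] := fun v =>
    indep_pair_of_ne (hG.boundaryV0.ne_zero v.2) fun hmem => hy0'
      ((Submodule.span_singleton_le_iff_mem _ _).2
        (IsConicArc.mem_supportingPlane (γ := fun v => G 0 v) v.2) hmem)
  have span_pair_congr : ∀ {a b a' b' : V4}, Submodule.span ℝ {a} = Submodule.span ℝ {a'} →
      Submodule.span ℝ {b} = Submodule.span ℝ {b'} →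
      Submodule.span ℝ {a, b} = Submodule.span ℝ {a', b'} := by
    intro a b a' b' h1 h2
    rw [Submodule.span_insert, Submodule.span_insert, h1, h2]
  refine ⟨hp1, hp2, y, hyA, y', ?_, ?_, ?_, fun v => ⟨hqy v, ?_, ?_⟩⟩
  · rw [eP0, eP1]; exact hyA'
  · by_contra hc
    exact hy 0 zero_mem_I (indep_triple_of_notMem hi hc)
  · rw [span_pair_congr c00 (hφ u)]
    by_contra hc
    refine hy' 0 zero_mem_I (indep_triple_of_notMem ?_ hc)
    exact hG.boundaryU0.injective 0 zero_mem_I _ (φ u).2 hur'.1.1.ne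
  · by_contra hc
    exact hy v v.2 (indep_swap_of_triple (indep_triple_of_notMem (hqy v) hc))
  · rw [span_pair_congr (hψ v) rfl]
    by_contra hc
    exact hy' _ (ψ v).2 (indep_swap_of_triple (indep_triple_of_notMem (hqy' (ψ v)) hc))

/-- A supercyclidic patch is determined by its boundary curves. -/
theorem samePatch_of_boundary (hF : IsSCPatch F) (hG : IsSCPatch G)
    (aU0 : arc (fun u => F u 0) = arc fun u => G u 0)
    (aU1 : arc (fun u => F u 1) = arc fun u => G u 1)
    (aV0 : arc (fun v => F 0 v) = arc fun v => G 0 v)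
    (aV1 : arc (fun v => F 1 v) = arc fun v => G 1 v)
    (c00 : Submodule.span ℝ {F 0 0} = Submodule.span ℝ {G 0 0})
    (c10 : Submodule.span ℝ {F 1 0} = Submodule.span ℝ {G 1 0})
    (c01 : Submodule.span ℝ {F 0 1} = Submodule.span ℝ {G 0 1})
    (hP : supportingPlane (fun u => F u 0) ≠ supportingPlane fun u => F u 1)
    (hQ : supportingPlane (fun v => F 0 v) ≠ supportingPlane fun v => F 1 v)
    (hPQ : supportingPlane (fun u => F u 0) ≠ supportingPlane fun v => F 0 v) :
    SamePatch F G := by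
  obtain ⟨φ, hφ⟩ := exists_reparam hG.boundaryU0 hF.boundaryU0
    (hG.smooth2.continuousU 0) (hF.smooth2.continuousU 0) aU0.symm c00 c10
  obtain ⟨ψ, hψ⟩ := exists_reparam hG.boundaryV0 hF.boundaryV0
    (hG.smooth2.continuousV 0) (hF.smooth2.continuousV 0) aV0.symm c00 c01
  have eP0 := supportingPlane_eq_of_arc_eq aU0
  have eP1 := supportingPlane_eq_of_arc_eq aU1
  have eQ0 := supportingPlane_eq_of_arc_eq aV0
  have eQ1 := supportingPlane_eq_of_arc_eq aV1
  obtain ⟨S, hS, hu⟩ := hF.exists_good_parameters hG hφ hψ eP0 eP1 eQ0 c00 hP hPQ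
  -- Exchanging the parameters gives a second line through each surface point.
  obtain ⟨S', hS', hv⟩ := hF.swap.exists_good_parameters hG.swap hψ hφ eQ0 eQ1 eP0 c00 hQ hPQ.symm
  have hxA : F 0 0 ∉ (supportingPlane (fun u => F u 0) ⊓
    supportingPlane fun u => F u 1 : Submodule ℝ V4) := fun h => hF.swap.corner_notMem hP h.2
  have hxB : F 0 0 ∉ (supportingPlane (fun v => F 0 v) ⊓
    supportingPlane fun v => F 1 v : Submodule ℝ V4) := fun h => hF.corner_notMem hQ h.2
  have key : ∀ p ∈ (Sᶜ ×ˢ (S' ∪ {0})ᶜ : Set (unitInterval × unitInterval)),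
      ¬ LinearIndependent ℝ ![F p.1 p.2, G (φ p.1) (ψ p.2)] := by
    rintro ⟨u, v⟩ ⟨hu', hv'⟩
    have hv0 : v ≠ 0 := fun e => hv' (Or.inr e)
    obtain ⟨hp1, hp2, y, hy, y', hy', m1, m2, hyv⟩ := hu u hu'
    obtain ⟨-, -, z, hz, z', hz', n1, n2, hzu⟩ := hv v fun h => hv' (Or.inl h)
    obtain ⟨i1, r1, r2⟩ := hyv v
    obtain ⟨i2, s1, s2⟩ := hzu u
    have hxq : LinearIndependent ℝ ![F 0 0, F 0 v] :=
      hF.boundaryV0.injective 0 zero_mem_I v v.2 fun e => hv0 (Subtype.ext e.symm)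
    refine dep_of_two_lines (indep_triple_of_notMem hxq fun hmem => hp1 ?_) hxA hxB hp2 hy hy' hz
      hz' m1 m2 n1 n2 r1 r2 s1 s2 i1 i2
    exact span_pair_le (IsConicArc.mem_supportingPlane (γ := fun v => F 0 v) zero_mem_I)
      (IsConicArc.mem_supportingPlane (γ := fun v => F 0 v) v.2) hmem
  have hdense : ∀ {S : Set unitInterval}, S.Finite → Dense Sᶜ := fun {S} hS => by
    rw [compl_eq_univ_sdiff]
    exact dense_univ.sdiff_finite hS
  -- Good parameter pairs are dense and dependence is closed, so the patches agree wherever both are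
  -- defined.
  have hall : ∀ p : unitInterval × unitInterval,
      ¬ LinearIndependent ℝ ![F p.1 p.2, G (φ p.1) (ψ p.2)] := fun p => by
    refine not_linearIndependent_of_mem_closure
      (f := fun p : unitInterval × unitInterval => ![F p.1 p.2, G (φ p.1) (ψ p.2)])
      (continuous_pair ?_ ?_) key
      ((hdense hS).prod (hdense (hS'.union (Set.finite_singleton 0))) p)
    · exact hF.smooth2.continuous.comp ((continuous_subtype_val.comp continuous_fst).prodMk
        (continuous_subtype_val.comp continuous_snd))
    · exact hG.smooth2.continuous.comp
        ((continuous_subtype_val.comp (φ.continuous.comp continuous_fst)).prodMk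
          (continuous_subtype_val.comp (ψ.continuous.comp continuous_snd)))
  exact ⟨φ, ψ, fun u v h1 h2 => span_eq_of_dep h1 h2 (hall (u, v))⟩

end IsSCPatch

/-! ### Translation patches -/

/-- The Wronskian of two independent forms along a conic vanishes only where the tangent passes
through their common zero `e` in the plane. Such points satisfy `C(e, δ t) = 0`, that is, they lie
on the polar of `e`, so there are finitely many. -/
theorem IsConicArc.finite_wronskian {δ : ℝ → V4} (hδ : IsConicArc δ) (sδ : ContDiff ℝ ∞ δ)
    {n l : V4 →ₗ[ℝ] ℝ} {b y : V4} (hb : b ∈ supportingPlane δ) (hy : y ∈ supportingPlane δ)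
    (nb : n b = 0) (lb : l b = 1) (ny : n y ≠ 0) :
    {t ∈ Ioo (0 : ℝ) 1 | n (δ t) * l (deriv δ t) - l (δ t) * n (deriv δ t) = 0}.Finite := by
  obtain ⟨C, hC, h0⟩ := hδ.exists_form
  obtain ⟨r, hr, hr'⟩ := exists_mem_notMem (P := supportingPlane δ)
    (W := Submodule.span ℝ {b, y}) (by
      rw [hδ.finrank_supportingPlane]
      have h2 : finrank ℝ (Submodule.span ℝ {b, y}) ≤ 2 := by
        refine (finrank_span_le_card ({b, y} : Set V4)).trans ?_
        rw [Set.toFinset_insert, Set.toFinset_singleton]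
        exact Finset.card_le_two
      omega)
  -- Correct `r` first by `b`, to kill `l`, and then by the part of `y` with `l = 0`, to kill `n`.
  -- It is nonzero since `r` is not in the span of `b` and `y`.
  set e : V4 := r - l r • b - (n r / n y) • (y - l y • b) with he
  have heP : e ∈ supportingPlane δ := Submodule.sub_mem _ (Submodule.sub_mem _ hr
    (Submodule.smul_mem _ _ hb)) (Submodule.smul_mem _ _ (Submodule.sub_mem _ hy
    (Submodule.smul_mem _ _ hb)))
  have ne : n e = 0 := by simp [he, nb, ny]
  have le : l e = 0 := by simp [he, lb]
  have he0 : e ≠ 0 := fun h => hr' (Submodule.mem_span_pair.2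
    ⟨l r - n r / n y * l y, n r / n y, by rw [← sub_eq_zero, ← neg_eq_zero, ← h, he]; module⟩)
  have hex : ∃ p ∈ supportingPlane δ, C e p ≠ 0 := by
    by_contra! hc
    exact he0 (hC.nondeg e heP hc)
  obtain ⟨p, hp, hCp⟩ := hex
  refine (hδ.finite_zeros (n := C e) hp hCp).subset fun t ht => ?_
  have htI : t ∈ Icc (0 : ℝ) 1 := ⟨ht.1.1.le, ht.1.2.le⟩
  refine ⟨htI, ?_⟩
  have m1 := IsConicArc.mem_supportingPlane (γ := δ) htI
  have m2 := IsConicArc.deriv_mem sδ htI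
  by_cases hmem : e ∈ Submodule.span ℝ {δ t, deriv δ t}
  · obtain ⟨a, c, e'⟩ := Submodule.mem_span_pair.1 hmem
    rw [hC.symm, ← e']
    simp [h0 t htI, IsConicArc.form_deriv hC.symm sδ h0 ht.1]
  · exfalso
    have hi := indep_triple_of_notMem (hδ.regular t htI) hmem
    have hspan := span_triple_eq hδ.finrank_supportingPlane m1 m2 heP hi
    have hκ : ∀ p ∈ supportingPlane δ, n (δ t) * l p - l (δ t) * n p = 0 := by
      intro p hp
      rw [← hspan] at hp
      obtain ⟨a₁, a₂, a₃, rfl⟩ := Submodule.mem_span_triple.1 hp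
      simp only [map_add, map_smul, smul_eq_mul, ne, le]
      linear_combination a₂ * ht.2
    have n0 : n (δ t) = 0 := by simpa [nb, lb] using hκ b hb
    have l0 : l (δ t) = 0 := by simpa [n0, ny] using hκ y hy
    have hall : ∀ p ∈ supportingPlane δ, n (deriv δ t) = 0 → n p = 0 := by
      intro p hp h1
      rw [← hspan] at hp
      obtain ⟨a₁, a₂, a₃, rfl⟩ := Submodule.mem_span_triple.1 hp
      simp [n0, ne, h1]
    refine ny (hall y hy ?_)
    rw [← hspan] at hb
    obtain ⟨a₁, a₂, a₃, e'⟩ := Submodule.mem_span_triple.1 hb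
    have k1 : a₂ * n (deriv δ t) = 0 := by
      have := congrArg n e'
      simpa [n0, ne, nb] using this
    have k2 : a₂ * l (deriv δ t) = 1 := by
      have := congrArg l e'
      simpa [l0, le, lb] using this
    refine (mul_eq_zero.1 k1).resolve_left ?_
    rintro rfl
    norm_num at k2

/-- The surface that arises from the affine translation surface of the curves `γ` and `δ`, in
homogeneous coordinates such that the lines at infinity of the planes of `γ` and `δ` are given by the linear
forms `l` and `m`. -/
def translationPatch (γ δ : ℝ → V4) (l m : V4 →ₗ[ℝ] ℝ) (b : V4) (u v : ℝ) : V4 :=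
  m (δ v) • γ u + l (γ u) • δ v - (l (γ u) * m (δ v)) • b

theorem translationPatch_swap (γ δ : ℝ → V4) (l m : V4 →ₗ[ℝ] ℝ) (b : V4) :
    (fun u v => translationPatch γ δ l m b v u) = translationPatch δ γ m l b := by
  funext u v
  simp only [translationPatch]
  rw [mul_comm]
  abel

/-- The collineation that maps the curve `γ` to the parameter line `v` of the translation patch. -/
def translationMap (δ : ℝ → V4) (l m : V4 →ₗ[ℝ] ℝ) (b : V4) (v : ℝ) : V4 →ₗ[ℝ] V4 :=
  m (δ v) • LinearMap.id + l.smulRight (δ v - m (δ v) • b)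

theorem translationMap_apply (δ : ℝ → V4) (l m : V4 →ₗ[ℝ] ℝ) (b : V4) (v : ℝ) (p : V4) :
    translationMap δ l m b v p = m (δ v) • p + l p • (δ v - m (δ v) • b) := rfl

theorem translationPatch_eq (γ δ : ℝ → V4) (l m : V4 →ₗ[ℝ] ℝ) (b : V4) (u v : ℝ) :
    translationPatch γ δ l m b u v = translationMap δ l m b v (γ u) := by
  rw [translationMap_apply, translationPatch]
  module

theorem smooth_translationPatch {γ δ : ℝ → V4} (sγ : ContDiff ℝ ∞ γ) (sδ : ContDiff ℝ ∞ δ)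
    (l m : V4 →ₗ[ℝ] ℝ) (b : V4) : Smooth2 (translationPatch γ δ l m b) := by
  have h1 : ContDiff ℝ ∞ fun p : ℝ × ℝ => γ p.1 := sγ.comp contDiff_fst
  have h2 : ContDiff ℝ ∞ fun p : ℝ × ℝ => δ p.2 := sδ.comp contDiff_snd
  have h3 := contDiff_map l h1
  have h4 := contDiff_map m h2
  exact ((h4.smul h1).add (h3.smul h2)).sub ((h3.mul h4).smul contDiff_const)

/-- The parameters of `δ` at which the parameter line of the translation patch is regular. -/
structure RegularParam (δ : ℝ → V4) (l m n : V4 →ₗ[ℝ] ℝ) (v : ℝ) : Prop where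
  mem : v ∈ Ioo (0 : ℝ) 1
  m_ne : m (δ v) ≠ 0
  n_ne : n (δ v) ≠ 0
  wronskian : n (δ v) * l (deriv δ v) - l (δ v) * n (deriv δ v) ≠ 0

section

variable {γ δ : ℝ → V4} {l m n : V4 →ₗ[ℝ] ℝ} {b : V4}

theorem translationMap_inj (hn : ∀ p, n p = 0 ↔ p ∈ supportingPlane γ)
    (nb : n b = 0) {v : ℝ} (hm : m (δ v) ≠ 0) (hnv : n (δ v) ≠ 0) :
    ∀ p ∈ supportingPlane γ, translationMap δ l m b v p = 0 → p = 0 := by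
  intro p hp e
  rw [translationMap_apply] at e
  have e1 := congrArg n e
  simp only [map_add, map_smul, map_sub, smul_eq_mul, (hn p).2 hp, nb, map_zero] at e1
  have hl : l p = 0 := by
    have : l p * n (δ v) = 0 := by linarith
    exact (mul_eq_zero.1 this).resolve_right hnv
  rw [hl] at e
  simpa [hm] using e

/-- Along a regular parameter line the translation patch is a supercyclide. -/
theorem translationPatch_regular (hγ : IsConicArc γ) (sγ : ContDiff ℝ ∞ γ) (sδ : ContDiff ℝ ∞ δ)
    (hn : ∀ p, n p = 0 ↔ p ∈ supportingPlane γ) (nb : n b = 0) (lb : l b = 1)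
    {v : ℝ} (hv : RegularParam δ l m n v) {I : Set ℝ} (hI : ∀ u ∈ I, u ∈ Ioo (0 : ℝ) 1)
    (hlI : ∀ u ∈ I, l (γ u) ≠ 0) :
    IsConicArc (fun u => translationPatch γ δ l m b u v) ∧
    (∀ u ∈ I, LinearIndependent ℝ ![translationPatch γ δ l m b u v,
      dU (translationPatch γ δ l m b) u v, dV (translationPatch γ δ l m b) u v]) ∧
    (∀ u ∈ I, dU (dV (translationPatch γ δ l m b)) u v ∈
      tangentPlane (translationPatch γ δ l m b) u v) ∧
    ∃ B, IsQuadraticCone B ∧ ∀ u ∈ I, TouchesConeAt B (translationPatch γ δ l m b u v)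
      (tangentPlane (translationPatch γ δ l m b) u v) := by
  set F := translationPatch γ δ l m b with hF
  set K := translationMap δ l m b v with hK
  have hKinj := translationMap_inj (l := l) (b := b) hn nb hv.m_ne hv.n_ne
  rw [← hK] at hKinj
  have hFK : ∀ u, F u v = K (γ u) := fun u => translationPatch_eq γ δ l m b u v
  have hIcc : ∀ u ∈ I, u ∈ Icc (0 : ℝ) 1 := fun u hu => ⟨(hI u hu).1.le, (hI u hu).2.le⟩
  have dγ : ∀ u, HasDerivAt γ (deriv γ u) u := fun u => (sγ.differentiable (by simp) u).hasDerivAt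
  have dδ : ∀ u, HasDerivAt δ (deriv δ u) u := fun u => (sδ.differentiable (by simp) u).hasDerivAt
  have hmv := hv.m_ne
  -- Chosen such that `m w = 0` for `w = δ' - c δ`; then the cross derivative is `c F + l(γ u) w`,
  -- and `w` is the vertex of the tangent cone.
  set c : ℝ := m (deriv δ v) / m (δ v) with hc
  have hcm : c * m (δ v) = m (deriv δ v) := div_mul_cancel₀ _ hmv
  set w : V4 := deriv δ v - c • δ v with hw
  have hdU : ∀ u, dU F u v = K (deriv γ u) := by
    intro u
    have h1 := hasDerivAt_map K (dγ u)
    have h2 : (fun s => F s v) = fun s => K (γ s) := funext hFK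
    rw [dU, h2]
    exact h1.deriv
  have hdV : ∀ u, dV F u v = c • F u v + l (γ u) • w := by
    intro u
    have h1 : HasDerivAt (fun t => m (δ t) • γ u + l (γ u) • δ t - (l (γ u) * m (δ t)) • b)
        (m (deriv δ v) • γ u + l (γ u) • deriv δ v - (l (γ u) * m (deriv δ v)) • b) v :=
      (((hasDerivAt_map m (dδ v)).smul_const (γ u)).add ((dδ v).const_smul (l (γ u)))).sub
        (((hasDerivAt_map m (dδ v)).const_mul (l (γ u))).smul_const b)
    have h2 : dV F u v = _ := h1.deriv
    rw [h2, hw, ← hcm, hF, translationPatch]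
    module
  have hdUV : ∀ u, dU (dV F) u v = c • K (deriv γ u) + l (deriv γ u) • w := by
    intro u
    have h1 : HasDerivAt (fun s => c • K (γ s) + l (γ s) • w)
        (c • K (deriv γ u) + l (deriv γ u) • w) u :=
      ((hasDerivAt_map K (dγ u)).const_smul c).add ((hasDerivAt_map l (dγ u)).smul_const w)
    have h2 : (fun s => dV F s v) = fun s => c • K (γ s) + l (γ s) • w := by
      funext s; rw [hdV, hFK]
    rw [dU, h2]
    exact h1.deriv
  -- The equation of the plane of the parameter line. Its value at `w` is the Wronskian, so
  -- regularity says that the vertex is off this plane.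
  set κ : V4 →ₗ[ℝ] ℝ := n (δ v) • l - l (δ v) • n with hκ
  have hκw : κ w ≠ 0 := by
    have : κ w = n (δ v) * l (deriv δ v) - l (δ v) * n (deriv δ v) := by
      simp only [hκ, hw, LinearMap.sub_apply, LinearMap.smul_apply, map_sub, map_smul, smul_eq_mul]
      ring
    rw [this]; exact hv.wronskian
  have hκK : ∀ p ∈ supportingPlane γ, κ (K p) = 0 := by
    intro p hp
    simp only [hκ, hK, translationMap_apply, LinearMap.sub_apply, LinearMap.smul_apply, map_sub,
      map_add, map_smul, smul_eq_mul, (hn p).2 hp, nb, lb]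
    ring
  have hconic : IsConicArc fun u => F u v := by
    rw [show (fun u => F u v) = fun u => K (γ u) from funext hFK]
    exact hγ.map sγ hKinj
  have himm : ∀ u ∈ I, LinearIndependent ℝ ![F u v, dU F u v, dV F u v] := by
    intro u hu
    have huI := hIcc u hu
    have m1 := IsConicArc.mem_supportingPlane (γ := γ) huI
    have m2 := IsConicArc.deriv_mem sγ huI
    rw [hdV, hFK, hdU]
    refine indep_triple_of_notMem (IsConicArc.indep_map hKinj m1 m2 (hγ.regular u huI))
      fun hmem => ?_
    obtain ⟨a, a', e⟩ := Submodule.mem_span_pair.1 hmem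
    have := congrArg κ e
    simp only [map_add, map_smul, hκK _ m1, hκK _ m2, smul_eq_mul, mul_zero, add_zero,
      zero_add] at this
    exact mul_ne_zero (hlI u hu) hκw this.symm
  refine ⟨hconic, himm, fun u hu => ?_, ?_⟩
  · have e : dU (dV F) u v = c • dU F u v + (l (deriv γ u) / l (γ u)) • (dV F u v - c • F u v) := by
      rw [hdUV, hdU, hdV, add_sub_cancel_left, smul_smul, div_mul_cancel₀ _ (hlI u hu)]
    have t1 : F u v ∈ tangentPlane F u v := Submodule.subset_span (by simp)
    have t2 : dU F u v ∈ tangentPlane F u v := Submodule.subset_span (by simp)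
    have t3 : dV F u v ∈ tangentPlane F u v := Submodule.subset_span (by simp)
    rw [e]
    exact Submodule.add_mem _ (Submodule.smul_mem _ _ t2) (Submodule.smul_mem _ _
      (Submodule.sub_mem _ t3 (Submodule.smul_mem _ _ t1)))
  · obtain ⟨C, hC, h0⟩ := hγ.exists_form
    obtain ⟨g₀, hg₀⟩ := IsConicArc.exists_leftInverse_on hKinj
    -- Projection from `w` onto the plane of the parameter line. Following it by the inverse of `K`
    -- and pulling `C` back gives the cone with vertex `w` over the parameter line.
    set pr : V4 →ₗ[ℝ] V4 := LinearMap.id - ((κ w)⁻¹ • κ).smulRight w with hpr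
    have hpr_apply : ∀ p, pr p = p - ((κ w)⁻¹ * κ p) • w := fun p => rfl
    set g : V4 →ₗ[ℝ] V4 := g₀ ∘ₗ pr with hg
    have hgK : ∀ p ∈ supportingPlane γ, g (K p) = p := by
      intro p hp
      rw [hg, LinearMap.comp_apply, hpr_apply, hκK p hp]
      simpa using hg₀ p hp
    have hgw : g w = 0 := by
      rw [hg, LinearMap.comp_apply, hpr_apply, inv_mul_cancel₀ hκw, one_smul, sub_self, map_zero]
    have hκ0 : κ ≠ 0 := by rintro h; rw [h] at hκw; simp at hκw
    have himage : (supportingPlane γ).map K = LinearMap.ker κ := by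
      refine Submodule.eq_of_le_of_finrank_eq ?_ ?_
      · rintro _ ⟨p, hp, rfl⟩
        exact hκK p hp
      · rw [IsConicArc.finrank_map_of_inj hKinj, hγ.finrank_supportingPlane, finrank_ker_form hκ0]
    have hprK : ∀ p, ∃ q ∈ supportingPlane γ, pr p = K q := by
      intro p
      have : pr p ∈ (supportingPlane γ).map K := by
        rw [himage, LinearMap.mem_ker, hpr_apply, map_sub, map_smul, smul_eq_mul]
        field_simp
        ring
      obtain ⟨q, hq, e⟩ := this
      exact ⟨q, hq, e.symm⟩
    set B : LinearMap.BilinForm ℝ V4 := C.compl₁₂ g g with hB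
    have hBapp : ∀ p q, B p q = C (g p) (g q) := fun p q => rfl
    have hw0 : w ≠ 0 := by rintro h; rw [h, map_zero] at hκw; exact hκw rfl
    have hker : LinearMap.ker B = Submodule.span ℝ {w} := by
      refine le_antisymm (fun p hp => ?_) ?_
      · obtain ⟨q, hq, e⟩ := hprK p
        have hgp : g p = q := by
          rw [hg, LinearMap.comp_apply, e]; exact hg₀ q hq
        have hq0 : q = 0 := hC.nondeg q hq fun r hr => by
          have := LinearMap.congr_fun (LinearMap.mem_ker.1 hp) (K r)
          rwa [hBapp, hgp, hgK r hr] at this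
        rw [hq0, map_zero, hpr_apply] at e
        exact Submodule.mem_span_singleton.2 ⟨_, (sub_eq_zero.1 e).symm⟩
      · rw [Submodule.span_singleton_le_iff_mem, LinearMap.mem_ker]
        refine LinearMap.ext fun r => ?_
        rw [hBapp, hgw]
        simp
    refine ⟨B, ⟨⟨fun p q => hC.symm _ _⟩, by rw [hker, finrank_span_singleton hw0]⟩, fun u hu => ?_⟩
    have huI := hIcc u hu
    have m1 := IsConicArc.mem_supportingPlane (γ := γ) huI
    have m2 := IsConicArc.deriv_mem sγ huI
    have gF : g (F u v) = γ u := by rw [hFK]; exact hgK _ m1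
    have hnot : F u v ∉ LinearMap.ker B := by
      rw [hker]
      intro hmem
      obtain ⟨a, e⟩ := Submodule.mem_span_singleton.1 hmem
      have := congrArg g e
      rw [map_smul, hgw, smul_zero, gF] at this
      exact hγ.ne_zero huI this.symm
    have e0 : C (γ u) (γ u) = 0 := h0 u huI
    have e1 := IsConicArc.form_deriv hC.symm sγ h0 (hI u hu)
    refine ⟨by rw [hBapp, gF, e0], hnot, Submodule.eq_of_le_of_finrank_eq ?_ ?_⟩
    · refine span_triple_le ?_ ?_ ?_
      · rw [LinearMap.mem_ker, hBapp, gF, e0]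
      · rw [LinearMap.mem_ker, hBapp, gF, hdU, hgK _ m2, e1]
      · rw [LinearMap.mem_ker, hBapp, hdV, map_add, map_smul, map_smul, hgw, gF]
        simp [e0]
    · rw [finrank_tangentPlane (himm u hu),
        finrank_ker_form (n := B (F u v)) fun h => hnot (LinearMap.mem_ker.2 h)]

theorem finite_not_regularParam (hδ : IsConicArc δ) (sδ : ContDiff ℝ ∞ δ) {y : V4}
    (hb : b ∈ supportingPlane δ) (hy : y ∈ supportingPlane δ) (nb : n b = 0) (lb : l b = 1)
    (mb : m b ≠ 0) (ny : n y ≠ 0) : ∃ E : Set ℝ, E.Finite ∧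
      ∀ v ∈ Icc (0 : ℝ) 1 \ E, RegularParam δ l m n v := by
  refine ⟨{0, 1} ∪ ({t ∈ Icc (0 : ℝ) 1 | m (δ t) = 0} ∪ ({t ∈ Icc (0 : ℝ) 1 | n (δ t) = 0} ∪
    {t ∈ Ioo (0 : ℝ) 1 | n (δ t) * l (deriv δ t) - l (δ t) * n (deriv δ t) = 0})),
    (Set.toFinite {0, 1}).union ((hδ.finite_zeros hb mb).union ((hδ.finite_zeros hy ny).union
      (hδ.finite_wronskian sδ hb hy nb lb ny))), fun v hv => ?_⟩
  have h01 : v ∈ Ioo (0 : ℝ) 1 := by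
    refine ⟨lt_of_le_of_ne hv.1.1 fun e => ?_, lt_of_le_of_ne hv.1.2 fun e => ?_⟩
    · exact hv.2 (Or.inl (Or.inl e.symm))
    · exact hv.2 (Or.inl (Or.inr e))
  exact ⟨h01, fun e => hv.2 (Or.inr (Or.inl ⟨hv.1, e⟩)),
    fun e => hv.2 (Or.inr (Or.inr (Or.inl ⟨hv.1, e⟩))),
    fun e => hv.2 (Or.inr (Or.inr (Or.inr ⟨h01, e⟩)))⟩

end

/-- Two conic arcs with a common point and perspectivities of their planes onto the planes of the
opposite boundary curves define a supercyclidic patch. -/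
theorem exists_translationPatch {γ δ : ℝ → V4} {l m : V4 →ₗ[ℝ] ℝ} {b y z : V4}
    (hγ : IsConicArc γ) (hδ : IsConicArc δ) (sγ : ContDiff ℝ ∞ γ) (sδ : ContDiff ℝ ∞ δ)
    (lb : l b = 1) (mb : m b = 1) (lz : l z = 0) (my : m y = 0)
    (γ0 : Submodule.span ℝ {γ 0} = Submodule.span ℝ {b})
    (δ0 : Submodule.span ℝ {δ 0} = Submodule.span ℝ {b})
    (γ1 : Submodule.span ℝ {γ 1} = Submodule.span ℝ {b + z})
    (δ1 : Submodule.span ℝ {δ 1} = Submodule.span ℝ {b + y})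
    (hy : y ∉ supportingPlane γ) (hz : z ∉ supportingPlane δ) :
    ∃ F : ℝ → ℝ → V4, IsSCPatch F ∧ ∀ t ∈ Icc (0 : ℝ) 1,
      Submodule.span ℝ {F t 0} = Submodule.span ℝ {γ t} ∧
      Submodule.span ℝ {F t 1} = Submodule.span ℝ {γ t + l (γ t) • y} ∧
      Submodule.span ℝ {F 0 t} = Submodule.span ℝ {δ t} ∧
      Submodule.span ℝ {F 1 t} = Submodule.span ℝ {δ t + m (δ t) • z} := by
  obtain ⟨c₀, hc₀, eδ0⟩ := span_singleton_eq_iff.1 δ0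
  obtain ⟨c₁, hc₁, eδ1⟩ := span_singleton_eq_iff.1 δ1
  obtain ⟨d₀, hd₀, eγ0⟩ := span_singleton_eq_iff.1 γ0
  obtain ⟨d₁, hd₁, eγ1⟩ := span_singleton_eq_iff.1 γ1
  set F := translationPatch γ δ l m b with hF
  have sF : Smooth2 F := smooth_translationPatch sγ sδ l m b
  have hbγ : b ∈ supportingPlane γ :=
    (mem_iff_of_span_eq γ0 _).1 (IsConicArc.mem_supportingPlane zero_mem_I)
  have hbδ : b ∈ supportingPlane δ :=
    (mem_iff_of_span_eq δ0 _).1 (IsConicArc.mem_supportingPlane zero_mem_I)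
  have hzγ : z ∈ supportingPlane γ := by
    have := (mem_iff_of_span_eq γ1 _).1 (IsConicArc.mem_supportingPlane one_mem_I)
    simpa using Submodule.sub_mem _ this hbγ
  have hyδ : y ∈ supportingPlane δ := by
    have := (mem_iff_of_span_eq δ1 _).1 (IsConicArc.mem_supportingPlane one_mem_I)
    simpa using Submodule.sub_mem _ this hbδ
  obtain ⟨n, ny, hn⟩ := exists_ker_eq_of_notMem hγ.finrank_supportingPlane hy
  obtain ⟨k, kz, hk⟩ := exists_ker_eq_of_notMem hδ.finrank_supportingPlane hz
  have nb : n b = 0 := (hn b).2 hbγ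
  have kb : k b = 0 := (hk b).2 hbδ
  have eU0 : (fun u => F u 0) = fun u => c₀ • γ u := by
    funext u
    simp only [hF, translationPatch, eδ0, map_smul, mb, smul_eq_mul, mul_one]
    module
  have eU1 : (fun u => F u 1) = fun u => c₁ • (γ u + l (γ u) • y) := by
    funext u
    simp only [hF, translationPatch, eδ1, map_smul, map_add, mb, my, smul_eq_mul]
    module
  have eV0 : (fun v => F 0 v) = fun v => d₀ • δ v := by
    funext v
    simp only [hF, translationPatch, eγ0, map_smul, lb, smul_eq_mul, mul_one]
    module
  have eV1 : (fun v => F 1 v) = fun v => d₁ • (δ v + m (δ v) • z) := by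
    funext v
    simp only [hF, translationPatch, eγ1, map_smul, map_add, lb, lz, smul_eq_mul]
    module
  have hpersp : ∀ {γ : ℝ → V4} {l n : V4 →ₗ[ℝ] ℝ} {y : V4} {c : ℝ}, IsConicArc γ →
      ContDiff ℝ ∞ γ → (∀ p, n p = 0 ↔ p ∈ supportingPlane γ) → n y = 1 → c ≠ 0 →
      IsConicArc fun u => c • (γ u + l (γ u) • y) := by
    intro γ l n y c hγ sγ hn ny hc
    refine hγ.map sγ (L := c • (LinearMap.id + l.smulRight y)) fun p hp e => ?_
    have e1 : p + l p • y = 0 :=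
      (smul_eq_zero.1 (show c • (p + l p • y) = 0 from e)).resolve_left hc
    have e2 := congrArg n e1
    simp only [map_add, map_smul, (hn p).2 hp, ny, smul_eq_mul, mul_one, zero_add, map_zero] at e2
    simpa [e2] using e1
  obtain ⟨E₂, hE₂, hreg₂⟩ := finite_not_regularParam (l := l) (m := m) (n := n) hδ sδ hbδ hyδ nb lb
    (by rw [mb]; norm_num) (by rw [ny]; norm_num)
  obtain ⟨E₁, hE₁, hreg₁⟩ := finite_not_regularParam (l := m) (m := l) (n := k) hγ sγ hbγ hzγ kb mb
    (by rw [lb]; norm_num) (by rw [kz]; norm_num)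
  -- `E₁` comes from the construction with `γ` and `δ` exchanged, where `m_ne` reads `l (γ u) ≠ 0`:
  -- exactly what immersion along the other family needs.
  have R := fun v (hv : v ∈ Icc (0 : ℝ) 1 \ E₂) => translationPatch_regular hγ sγ sδ hn nb lb
    (hreg₂ v hv) (I := Icc 0 1 \ E₁) (fun u hu => (hreg₁ u hu).mem) fun u hu => (hreg₁ u hu).m_ne
  have R' := fun u (hu : u ∈ Icc (0 : ℝ) 1 \ E₁) => translationPatch_regular hδ sδ sγ hk kb mb
    (hreg₁ u hu) (I := Icc 0 1 \ E₂) (fun v hv => (hreg₂ v hv).mem) fun v hv => (hreg₂ v hv).m_ne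
  refine ⟨F, ⟨sF, ?_, ?_, ?_, ?_, E₁, E₂, hE₁, hE₂, fun u hu v hv => (R v hv).2.1 u hu,
    fun u hu v hv => (R v hv).2.2.1 u hu, fun v hv => (R v hv).1, fun u hu => ?_,
    fun v hv => (R v hv).2.2.2, fun u hu => ?_⟩, fun t ht => ⟨?_, ?_, ?_, ?_⟩⟩
  · rw [eU0]
    exact hγ.map sγ (L := c₀ • LinearMap.id) fun p hp e => by simpa [hc₀] using e
  · rw [eU1]
    exact hpersp hγ sγ hn ny hc₁
  · rw [eV0]
    exact hδ.map sδ (L := d₀ • LinearMap.id) fun p hp e => by simpa [hd₀] using e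
  · rw [eV1]
    exact hpersp hδ sδ hk kz hd₁
  · have := (R' u hu).1
    rw [← translationPatch_swap] at this
    exact this
  · have := (R' u hu).2.2.2
    rw [← translationPatch_swap] at this
    simpa only [tangentPlane_swap] using this
  · rw [congrFun eU0 t]; exact span_smul_eq hc₀ _
  · rw [congrFun eU1 t]; exact span_smul_eq hc₁ _
  · rw [congrFun eV0 t]; exact span_smul_eq hd₀ _
  · rw [congrFun eV1 t]; exact span_smul_eq hd₁ _

/-- Two conic arcs with a common point and perspectivities that close up at the fourth vertex define
a supercyclidic patch. -/
theorem exists_patch {γ δ : ℝ → V4} {l m : V4 →ₗ[ℝ] ℝ} {b y z : V4}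
    (hγ : IsConicArc γ) (hδ : IsConicArc δ) (sγ : ContDiff ℝ ∞ γ) (sδ : ContDiff ℝ ∞ δ)
    (γ0 : Submodule.span ℝ {γ 0} = Submodule.span ℝ {b})
    (δ0 : Submodule.span ℝ {δ 0} = Submodule.span ℝ {b})
    (γ1 : Submodule.span ℝ {γ 1} = Submodule.span ℝ {b + m b • z})
    (δ1 : Submodule.span ℝ {δ 1} = Submodule.span ℝ {b + l b • y})
    (hcl : Submodule.span ℝ {γ 1 + l (γ 1) • y} = Submodule.span ℝ {δ 1 + m (δ 1) • z})
    (hy : y ∉ supportingPlane γ) (hz : z ∉ supportingPlane δ) :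
    ∃ F : ℝ → ℝ → V4, IsSCPatch F ∧ ∀ t ∈ Icc (0 : ℝ) 1,
      Submodule.span ℝ {F t 0} = Submodule.span ℝ {γ t} ∧
      Submodule.span ℝ {F t 1} = Submodule.span ℝ {γ t + l (γ t) • y} ∧
      Submodule.span ℝ {F 0 t} = Submodule.span ℝ {δ t} ∧
      Submodule.span ℝ {F 1 t} = Submodule.span ℝ {δ t + m (δ t) • z} := by
  have hbγ : b ∈ supportingPlane γ :=
    (mem_iff_of_span_eq γ0 _).1 (IsConicArc.mem_supportingPlane zero_mem_I)
  have hbδ : b ∈ supportingPlane δ :=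
    (mem_iff_of_span_eq δ0 _).1 (IsConicArc.mem_supportingPlane zero_mem_I)
  have hb0 : b ≠ 0 := ne_zero_of_span_eq γ0 (hγ.ne_zero zero_mem_I)
  have hl : l b ≠ 0 := fun e => by
    rw [e, zero_smul, add_zero] at δ1
    exact dep_of_span_eq (δ0.trans δ1.symm) (hδ.injective 0 zero_mem_I 1 one_mem_I (by simp))
  have hm : m b ≠ 0 := fun e => by
    rw [e, zero_smul, add_zero] at γ1
    exact dep_of_span_eq (γ0.trans γ1.symm) (hγ.injective 0 zero_mem_I 1 one_mem_I (by simp))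
  have hy' : l b • y ∉ supportingPlane γ := fun h => hy ((Submodule.smul_mem_iff _ hl).1 h)
  have hz' : m b • z ∉ supportingPlane δ := fun h => hz ((Submodule.smul_mem_iff _ hm).1 h)
  have hyδ : l b • y ∈ supportingPlane δ := by
    have := (mem_iff_of_span_eq δ1 _).1 (IsConicArc.mem_supportingPlane one_mem_I)
    simpa using Submodule.sub_mem _ this hbδ
  have hby : LinearIndependent ℝ ![b, l b • y] := indep_pair_of_ne hb0 fun h =>
    hy' ((Submodule.span_singleton_le_iff_mem _ _).2 hbγ h)
  have hi : LinearIndependent ℝ ![b, l b • y, m b • z] :=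
    indep_triple_of_notMem hby fun h => hz' (span_pair_le hbδ hyδ h)
  obtain ⟨c, hc, ec⟩ := span_singleton_eq_iff.1 δ1
  obtain ⟨d, hd, ed⟩ := span_singleton_eq_iff.1 γ1
  obtain ⟨e, he, ee⟩ := span_singleton_eq_iff.1 hcl
  rw [ec, ed] at ee
  simp only [map_add, map_smul, smul_eq_mul] at ee
  -- Comparing coefficients of the fourth vertex in the basis `b, l b • y, m b • z`: closing up
  -- means `l z = 0` and `m y = 0`, the normal form of a translation patch.
  obtain ⟨h1, h2, h3⟩ := indep_triple_iff.1 hi (d - e * c)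
    (d * (l b + m b * l z) * (l b)⁻¹ - e * c) (d - e * c * (m b + l b * m y) * (m b)⁻¹) (by
      have k1 : (d * (l b + m b * l z) * (l b)⁻¹) • (l b • y) = (d * (l b + m b * l z)) • y := by
        rw [smul_smul, inv_mul_cancel_right₀ hl]
      have k2 : (e * c * (m b + l b * m y) * (m b)⁻¹) • (m b • z) =
          (e * c * (m b + l b * m y)) • z := by
        rw [smul_smul, inv_mul_cancel_right₀ hm]
      rw [sub_smul _ _ (l b • y), sub_smul _ _ (m b • z), k1, k2, ← sub_eq_zero.2 ee]
      module)
  have hdc : d = e * c := sub_eq_zero.1 h1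
  have lz : l z = 0 := by
    rw [← hdc] at h2
    field_simp at h2
    have : d * (m b * l z) = 0 := by linear_combination h2
    simpa [hd, hm] using this
  have my : m y = 0 := by
    rw [← hdc] at h3
    field_simp at h3
    have : d * (l b * m y) = 0 := by linear_combination -h3
    simpa [hd, hl] using this
  obtain ⟨F, hF, hF'⟩ := exists_translationPatch (l := (l b)⁻¹ • l) (m := (m b)⁻¹ • m)
    (y := l b • y) (z := m b • z) hγ hδ sγ sδ (by simp [hl]) (by simp [hm]) (by simp [lz])
    (by simp [my]) γ0 δ0 γ1 δ1 hy' hz'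
  refine ⟨F, hF, fun t ht => ?_⟩
  have e1 : ((l b)⁻¹ • l) (γ t) • l b • y = l (γ t) • y := by
    rw [LinearMap.smul_apply, smul_eq_mul, smul_smul]
    congr 1
    field_simp
  have e2 : ((m b)⁻¹ • m) (δ t) • m b • z = m (δ t) • z := by
    rw [LinearMap.smul_apply, smul_eq_mul, smul_smul]
    congr 1
    field_simp
  have := hF' t ht
  rwa [e1, e2] at this

/-! ### Perspectivities between the edges of one direction -/

/-- The linear map that induces the perspectivity with centre `y`. -/
def persp (l : V4 →ₗ[ℝ] ℝ) (y : V4) : V4 →ₗ[ℝ] V4 := LinearMap.id + l.smulRight y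

theorem persp_apply (l : V4 →ₗ[ℝ] ℝ) (y p : V4) : persp l y p = p + l p • y := rfl

theorem persp_inj {l : V4 →ₗ[ℝ] ℝ} {y : V4} {P : Submodule ℝ V4} (hy : y ∉ P) :
    ∀ p ∈ P, persp l y p = 0 → p = 0 := by
  intro p hp e
  rw [persp_apply] at e
  by_cases hl : l p = 0
  · simpa [hl] using e
  · refine absurd ((Submodule.smul_mem_iff P hl).1 ?_) hy
    rw [← neg_eq_of_add_eq_zero_right e]
    exact Submodule.neg_mem _ hp

/-- By monotonicity, if `σ s ≠ s` then `s`, `σ s`, `σ (σ s)` are distinct. The corresponding points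
of the conic are independent, so the hypothesis at `s` and at `σ s` gives two independent vectors in
a space of dimension at most one. -/
theorem eq_self_of_shift {γ : ℝ → V4} (hγ : IsConicArc γ) {M : Submodule ℝ V4}
    (hM : finrank ℝ (M ⊓ supportingPlane γ : Submodule ℝ V4) ≤ 1)
    (σ : unitInterval ≃o unitInterval)
    (h : ∀ s : unitInterval, ∃ κ : ℝ, γ s - κ • γ (σ s) ∈ M) (s : unitInterval) : σ s = s := by
  by_contra hne
  have hd : s ≠ σ (σ s) ∧ σ s ≠ σ (σ s) := by
    rcases lt_or_gt_of_ne hne with h | h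
    · have h2 := σ.strictMono h
      exact ⟨(h2.trans h).ne', h2.ne'⟩
    · have h2 := σ.strictMono h
      exact ⟨(h.trans h2).ne, h2.ne⟩
  have hi := hγ.indep_three s.2 (σ s).2 (σ (σ s)).2 (fun e => hne (Subtype.ext e.symm))
    (fun e => hd.1 (Subtype.ext e)) fun e => hd.2 (Subtype.ext e)
  obtain ⟨κ, h1⟩ := h s
  obtain ⟨κ', h2⟩ := h (σ s)
  have m := fun s : unitInterval => IsConicArc.mem_supportingPlane (γ := γ) s.2
  refine dep_of_finrank_one hM
    ⟨h1, Submodule.sub_mem _ (m _) (Submodule.smul_mem _ _ (m _))⟩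
    ⟨h2, Submodule.sub_mem _ (m _) (Submodule.smul_mem _ _ (m _))⟩ (indep_pair_iff.2 ?_)
  intro a b e
  obtain ⟨e1, e2, -⟩ := indep_triple_iff.1 hi a (b - a * κ) (-(b * κ')) (by rw [← e]; module)
  refine ⟨e1, ?_⟩
  rw [e1] at e2
  simpa using e2

/-- Two collineations of a conic arc onto another one that agree modulo a line are equal. -/
theorem eq_on_plane_of_arcMap {γ c : ℝ → V4} (hγ : IsConicArc γ) {M : Submodule ℝ V4}
    (hM : finrank ℝ M = 2) {y : V4} (hyM : y ∈ M) (hy : y ∉ supportingPlane γ)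
    {φ ψ : V4 →ₗ[ℝ] V4} (hφ : ∀ p, φ p - p ∈ M) (hψ : ∀ p, ψ p - p ∈ M)
    (h : ArcMap φ γ c) (k : ArcMap ψ γ c) : ∀ p ∈ supportingPlane γ, φ p = ψ p := by
  obtain ⟨τ₁, h₁⟩ := h
  obtain ⟨τ₂, h₂⟩ := k
  have hspan : ∀ s : unitInterval, ∃ κ : ℝ, φ (γ s) = κ • ψ (γ (τ₁.symm.trans τ₂ s)) := by
    intro s
    have e := (h₁ (τ₁.symm s)).symm.trans (h₂ (τ₁.symm s))
    rw [OrderIso.apply_symm_apply] at e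
    obtain ⟨κ, -, hκ⟩ := span_singleton_eq_iff.1 e
    exact ⟨κ, hκ⟩
  -- Both maps are the identity modulo `M`, so equality of `φ (γ s)` with a multiple of `ψ (γ (σ
  -- s))` says that `γ s - κ γ (σ s)` is in `M`.
  have hσ := eq_self_of_shift hγ
    (finrank_inf_line hγ.finrank_supportingPlane hM fun hle => hy (hle hyM)).le
    (τ₁.symm.trans τ₂) fun s => by
      obtain ⟨κ, hκ⟩ := hspan s
      refine ⟨κ, ?_⟩
      have := Submodule.sub_mem _ (Submodule.smul_mem _ κ (hψ (γ (τ₁.symm.trans τ₂ s))))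
        (hφ (γ s))
      rw [hκ] at this
      convert this using 1
      module
  have hfin := hγ.finite_mem (hγ.not_le_of_finrank_le_two hM.le)
  have hinf : (Icc (0 : ℝ) 1 \ {t ∈ Icc (0 : ℝ) 1 | γ t ∈ M}).Infinite :=
    (Icc_infinite zero_lt_one).sdiff hfin
  have hle : supportingPlane γ ≤ LinearMap.ker (φ - ψ) := by
    refine hγ.supportingPlane_le_of_infinite hinf sdiff_subset fun t ht => ?_
    obtain ⟨κ, hκ⟩ := hspan ⟨t, ht.1⟩
    rw [hσ] at hκ
    have hκ' : φ (γ t) = κ • ψ (γ t) := hκ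
    have hmem : (1 - κ) • γ t ∈ M := by
      have := Submodule.sub_mem _ (Submodule.smul_mem _ κ (hψ (γ t))) (hφ (γ t))
      rw [hκ'] at this
      convert this using 1
      module
    -- Off `M` the factor is forced, since both images are congruent to `γ t`. So the vectors agree,
    -- not only the points, at infinitely many parameters, and linearity extends this to the plane.
    have hκ1 : κ = 1 := by
      by_contra hne
      exact ht.2 ⟨ht.1, (Submodule.smul_mem_iff M (sub_ne_zero.2 (Ne.symm hne))).1 hmem⟩
    rw [LinearMap.mem_ker, LinearMap.sub_apply, hκ', hκ1, one_smul, sub_self]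
  intro p hp
  have := hle hp
  rwa [LinearMap.mem_ker, LinearMap.sub_apply, sub_eq_zero] at this

theorem persp_comp_sub_mem {M : Submodule ℝ V4} {l l' : V4 →ₗ[ℝ] ℝ} {y y' : V4} (hy : y ∈ M)
    (hy' : y' ∈ M) (p : V4) : (persp l' y' ∘ₗ persp l y) p - p ∈ M := by
  have : (persp l' y' ∘ₗ persp l y) p - p = l p • y + l' (p + l p • y) • y' := by
    rw [LinearMap.comp_apply, persp_apply, persp_apply]; abel
  rw [this]
  exact Submodule.add_mem _ (Submodule.smul_mem _ _ hy) (Submodule.smul_mem _ _ hy')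

/-- The last edge of one direction is determined by the perspectivities to the first one. -/
theorem last_edge_unique {γ c c₁ : ℝ → V4} (hγ : IsConicArc γ) {M A B : Submodule ℝ V4}
    (hM : finrank ℝ M = 2) (hA : A ≤ M) (hB : B ≤ M) (hAB : ∀ p ∈ A, p ∈ B → p = 0)
    {la lb la' lb' la₁ lb₁ : V4 →ₗ[ℝ] ℝ} {ya yb ya' yb' ya₁ yb₁ : V4}
    (hya : ya ∈ M) (hyb : yb ∈ M) (hyγ : ya ∉ supportingPlane γ)
    (hya' : ya' ∈ A) (hyb' : yb' ∈ B) (hya₁ : ya₁ ∈ A) (hyb₁ : yb₁ ∈ B)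
    (ha : ArcMap (persp la' ya' ∘ₗ persp la ya) γ c)
    (hb : ArcMap (persp lb' yb' ∘ₗ persp lb yb) γ c)
    (ha₁ : ArcMap (persp la₁ ya₁ ∘ₗ persp la ya) γ c₁)
    (hb₁ : ArcMap (persp lb₁ yb₁ ∘ₗ persp lb yb) γ c₁) : arc c = arc c₁ := by
  have e := eq_on_plane_of_arcMap hγ hM hya hyγ (persp_comp_sub_mem hya (hA hya'))
    (persp_comp_sub_mem hyb (hB hyb')) ha hb
  have e₁ := eq_on_plane_of_arcMap hγ hM hya hyγ (persp_comp_sub_mem hya (hA hya₁))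
    (persp_comp_sub_mem hyb (hB hyb₁)) ha₁ hb₁
  -- Along one path the two composites differ by a vector of `A`. By `e` and `e₁` the same
  -- difference can be computed along the other path, where it is in `B`.
  have key : ∀ p ∈ supportingPlane γ,
      (persp la' ya' ∘ₗ persp la ya) p = (persp la₁ ya₁ ∘ₗ persp la ya) p := by
    intro p hp
    rw [← sub_eq_zero]
    have k := e p hp
    have k₁ := e₁ p hp
    refine hAB _ ?_ ?_
    · have : (persp la' ya' ∘ₗ persp la ya) p - (persp la₁ ya₁ ∘ₗ persp la ya) p =
          la' (persp la ya p) • ya' - la₁ (persp la ya p) • ya₁ := by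
        simp only [LinearMap.comp_apply, persp_apply]; abel
      rw [this]
      exact Submodule.sub_mem _ (Submodule.smul_mem _ _ hya') (Submodule.smul_mem _ _ hya₁)
    · have : (persp lb' yb' ∘ₗ persp lb yb) p - (persp lb₁ yb₁ ∘ₗ persp lb yb) p =
          lb' (persp lb yb p) • yb' - lb₁ (persp lb yb p) • yb₁ := by
        simp only [LinearMap.comp_apply, persp_apply]; abel
      rw [k, k₁, this]
      exact Submodule.sub_mem _ (Submodule.smul_mem _ _ hyb') (Submodule.smul_mem _ _ hyb₁)
  rw [ha.arc_eq, ha₁.arc_eq]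
  ext p
  constructor
  · rintro ⟨t, ht, hp⟩
    exact ⟨t, ht, by rw [hp]; dsimp only; rw [key _ (IsConicArc.mem_supportingPlane ht)]⟩
  · rintro ⟨t, ht, hp⟩
    exact ⟨t, ht, by rw [hp]; dsimp only; rw [← key _ (IsConicArc.mem_supportingPlane ht)]⟩

/-- Two perspectivities can be completed to a closed chain of four perspectivities with prescribed
centres. -/
theorem exists_closing_forms {P : Submodule ℝ V4} {la lb : V4 →ₗ[ℝ] ℝ} {ya yb ya' yb' : V4}
    (hya : ya ∉ P) (hyb : yb ∉ P) (ha : ya ∈ Submodule.span ℝ {ya', yb'})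
    (hb : yb ∈ Submodule.span ℝ {ya', yb'}) : ∃ la' lb' : V4 →ₗ[ℝ] ℝ, ∀ p ∈ P,
      persp la' ya' (persp la ya p) = persp lb' yb' (persp lb yb p) := by
  obtain ⟨α, β, ea⟩ := Submodule.mem_span_pair.1 ha
  obtain ⟨α', β', eb⟩ := Submodule.mem_span_pair.1 hb
  obtain ⟨ga, hga⟩ := IsConicArc.exists_leftInverse_on (persp_inj (l := la) hya)
  obtain ⟨gb, hgb⟩ := IsConicArc.exists_leftInverse_on (persp_inj (l := lb) hyb)
  -- Equating the coefficients of `ya'` and `yb'` in the two composites gives these forms on `P`;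
  -- the left inverses `ga`, `gb` carry them to the images of `P`.
  refine ⟨(α' • lb - α • la) ∘ₗ ga, (β • la - β' • lb) ∘ₗ gb, fun p hp => ?_⟩
  rw [persp_apply _ ya', persp_apply _ yb', LinearMap.comp_apply, LinearMap.comp_apply, hga p hp,
    hgb p hp, persp_apply, persp_apply, ← ea, ← eb]
  simp only [LinearMap.sub_apply, LinearMap.smul_apply, smul_eq_mul]
  module

theorem mem_span_singleton_of_pairs {a b c p : V4} (h : LinearIndependent ℝ ![a, b, c])
    (h1 : p ∈ Submodule.span ℝ {a, c}) (h2 : p ∈ Submodule.span ℝ {b, c}) :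
    p ∈ Submodule.span ℝ {c} := by
  obtain ⟨s, t, e⟩ := Submodule.mem_span_pair.1 h1
  obtain ⟨s', t', e'⟩ := Submodule.mem_span_pair.1 h2
  have hs := (indep_triple_iff.1 h s (-s') (t - t') (by
    rw [← sub_eq_zero.2 (e.trans e'.symm)]; module)).1
  rw [hs, zero_smul, zero_add] at e
  exact Submodule.mem_span_singleton.2 ⟨t, e⟩

/-- The line `ac` meets the plane `N'` in a point. That point lies in `G` and in `N'`, and these
planes meet in the line `a'c'`. -/
theorem exists_laplace_point {a c a' c' : V4} {N N' G : Submodule ℝ V4}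
    (hN' : finrank ℝ N' = 3) (hG : finrank ℝ G = 3)
    (haN : a ∈ N) (hcN : c ∈ N) (ha'N : a' ∈ N') (hc'N : c' ∈ N') (haG : a ∈ G) (hcG : c ∈ G)
    (ha'G : a' ∈ G) (hc'G : c' ∈ G) (hac : LinearIndependent ℝ ![a, c])
    (hac' : LinearIndependent ℝ ![a', c']) (hc : c ∉ N') :
    ∃ y ∈ (N ⊓ N' : Submodule ℝ V4), y ≠ 0 ∧ y ∈ Submodule.span ℝ {a, c} ∧
      y ∈ Submodule.span ℝ {a', c'} := by
  have h1 := finrank_inf_line hN' (finrank_span_pair hac)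
    fun hle => hc (hle (Submodule.subset_span (by simp)))
  obtain ⟨⟨y, hy⟩, hy0, -⟩ := finrank_eq_one_iff'.1 h1
  refine ⟨y, ⟨span_pair_le haN hcN hy.1, hy.2⟩, fun e => hy0 (Subtype.ext e), hy.1, ?_⟩
  rw [span_pair_eq (finrank_inf hG hN' fun e => hc (e ▸ hcG)) ⟨ha'G, ha'N⟩ ⟨hc'G, hc'N⟩ hac']
  exact ⟨span_pair_le haG hcG hy.1, hy.2⟩

/-- A plane through the edge `aa'` and the Laplace point of its two adjacent sides is the face plane
`G`, which is excluded for boundary planes. -/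
theorem laplace_notMem {a c a' y : V4} {N N' G P : Submodule ℝ V4} (hG : finrank ℝ G = 3)
    (hP : finrank ℝ P = 3) (haN : a ∈ N) (hcN : c ∈ N) (ha'N : a' ∈ N') (haN' : a ∉ N')
    (ha'N' : a' ∉ N) (haG : a ∈ G) (hcG : c ∈ G) (ha'G : a' ∈ G) (haP : a ∈ P) (ha'P : a' ∈ P)
    (hne : P ≠ G) (hyN' : y ∈ N') (hy0 : y ≠ 0) (hy : y ∈ Submodule.span ℝ {a, c}) : y ∉ P := by
  intro hyP
  have hyN : y ∈ N := span_pair_le haN hcN hy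
  have h1 : LinearIndependent ℝ ![y, a'] := indep_pair_of_ne hy0 fun h =>
    ha'N' ((Submodule.span_singleton_le_iff_mem _ _).2 hyN h)
  have h2 : LinearIndependent ℝ ![y, a', a] := indep_triple_of_notMem h1 fun h =>
    haN' (span_pair_le hyN' ha'N h)
  exact hne (plane_eq hP hG h2 hyP ha'P haP (span_pair_le haG hcG hy) ha'G haG)

/-- Construction of the last edge of one direction. -/
theorem exists_last_edge {x a b c x' a' b' c' ya yb : V4} {la lb : V4 →ₗ[ℝ] ℝ}
    {P Pa Pb N N' Ga Gb : Submodule ℝ V4} (hxP : x ∈ P) (hx'P : x' ∈ P)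
    (hPa : finrank ℝ Pa = 3) (hPb : finrank ℝ Pb = 3) (hN : finrank ℝ N = 3)
    (hN' : finrank ℝ N' = 3) (hGa : finrank ℝ Ga = 3) (hGb : finrank ℝ Gb = 3)
    (haN : a ∈ N) (hbN : b ∈ N) (hcN : c ∈ N) (ha'N : a' ∈ N') (hb'N : b' ∈ N') (hc'N : c' ∈ N')
    (haG : a ∈ Ga) (hcGa : c ∈ Ga) (ha'G : a' ∈ Ga) (hc'Ga : c' ∈ Ga)
    (hbG : b ∈ Gb) (hcGb : c ∈ Gb) (hb'G : b' ∈ Gb) (hc'Gb : c' ∈ Gb)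
    (haP : a ∈ Pa) (ha'P : a' ∈ Pa) (hbP : b ∈ Pb) (hb'P : b' ∈ Pb) (hPaG : Pa ≠ Ga)
    (hPbG : Pb ≠ Gb) (habc : LinearIndependent ℝ ![a, b, c])
    (habc' : LinearIndependent ℝ ![a', b', c']) (haN' : a ∉ N') (hbN' : b ∉ N') (hcN' : c ∉ N')
    (ha'N' : a' ∉ N) (hb'N' : b' ∉ N) (hya : ya ∉ P) (hyb : yb ∉ P)
    (hyaN : ya ∈ (N ⊓ N' : Submodule ℝ V4)) (hybN : yb ∈ (N ⊓ N' : Submodule ℝ V4))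
    (exa : Submodule.span ℝ {persp la ya x} = Submodule.span ℝ {a})
    (exa' : Submodule.span ℝ {persp la ya x'} = Submodule.span ℝ {a'})
    (exb : Submodule.span ℝ {persp lb yb x} = Submodule.span ℝ {b})
    (exb' : Submodule.span ℝ {persp lb yb x'} = Submodule.span ℝ {b'}) :
    ∃ (la' lb' : V4 →ₗ[ℝ] ℝ) (ya' yb' : V4), ya' ∉ Pa ∧ yb' ∉ Pb ∧
      Submodule.span ℝ {persp la' ya' a} = Submodule.span ℝ {c} ∧
      Submodule.span ℝ {persp la' ya' a'} = Submodule.span ℝ {c'} ∧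
      Submodule.span ℝ {persp lb' yb' b} = Submodule.span ℝ {c} ∧
      Submodule.span ℝ {persp lb' yb' b'} = Submodule.span ℝ {c'} ∧
      ∀ p ∈ P, persp la' ya' (persp la ya p) = persp lb' yb' (persp lb yb p) := by
  have hac := indep_pair_of_triple (indep_swap_of_triple habc)
  have hbc := indep_pair_of_triple (indep_rotate_of_triple habc)
  have hac' := indep_pair_of_triple (indep_swap_of_triple habc')
  have hbc' := indep_pair_of_triple (indep_rotate_of_triple habc')
  obtain ⟨ya', hyM, hy0, hy1, hy2⟩ := exists_laplace_point hN' hGa haN hcN ha'N hc'N haG hcGa ha'G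
    hc'Ga hac hac' hcN'
  obtain ⟨yb', hzM, hz0, hz1, hz2⟩ := exists_laplace_point hN' hGb hbN hcN hb'N hc'N hbG hcGb hb'G
    hc'Gb hbc hbc' hcN'
  have hNN' : N ≠ N' := fun e => hcN' (e ▸ hcN)
  -- If the centres coincided, they would be the common point `c` of the lines `ac` and `bc`, but
  -- `c` is not in `N'`.
  have hyz : LinearIndependent ℝ ![ya', yb'] := by
    refine indep_pair_of_ne hy0 fun h => ?_
    obtain ⟨s, e⟩ := Submodule.mem_span_singleton.1 h
    have h1 : yb' ∈ Submodule.span ℝ {a, c} := e ▸ Submodule.smul_mem _ s hy1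
    obtain ⟨r, e'⟩ := Submodule.mem_span_singleton.1 (mem_span_singleton_of_pairs habc h1 hz1)
    have hr : r ≠ 0 := by rintro rfl; exact hz0 (by rw [← e', zero_smul])
    exact hcN' ((Submodule.smul_mem_iff N' hr).1 (e' ▸ hzM.2))
  have hspan := span_pair_eq (finrank_inf hN hN' hNN') hyM hzM hyz
  obtain ⟨la', lb', hcl⟩ := exists_closing_forms (la := la) (lb := lb) hya hyb
    (by rw [hspan]; exact hyaN) (by rw [hspan]; exact hybN)
  -- Along one path the image of the end point stays on the line `ac`, along the other on `bc`. The
  -- paths agree, so the image is `c`: the corners impose no further condition.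
  have corner : ∀ {x a b c : V4}, x ∈ P → LinearIndependent ℝ ![a, b, c] →
      ya' ∈ Submodule.span ℝ {a, c} → yb' ∈ Submodule.span ℝ {b, c} →
      a ∉ Submodule.span ℝ {ya'} → b ∉ Submodule.span ℝ {yb'} →
      Submodule.span ℝ {persp la ya x} = Submodule.span ℝ {a} →
      Submodule.span ℝ {persp lb yb x} = Submodule.span ℝ {b} →
      Submodule.span ℝ {persp la' ya' a} = Submodule.span ℝ {c} ∧
      Submodule.span ℝ {persp lb' yb' b} = Submodule.span ℝ {c} := by
    intro x a b c hx hi h1 h2 h3 h4 ea eb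
    have k := congrArg (fun p => Submodule.span ℝ {p}) (hcl x hx)
    have k' : Submodule.span ℝ {persp la' ya' a} = Submodule.span ℝ {persp lb' yb' b} := by
      rw [← span_map_eq ea, ← span_map_eq eb, k]
    have hmem : ∀ {a y : V4} (l : V4 →ₗ[ℝ] ℝ), y ∈ Submodule.span ℝ {a, c} →
        persp l y a ∈ Submodule.span ℝ {a, c} := fun l hy =>
      Submodule.add_mem _ (Submodule.subset_span (by simp)) (Submodule.smul_mem _ _ hy)
    have hne : persp la' ya' a ≠ 0 := fun e => h3 (Submodule.mem_span_singleton.2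
      ⟨-la' a, by rw [persp_apply] at e; rw [neg_smul]; exact neg_eq_of_add_eq_zero_left e⟩)
    have hin := mem_span_singleton_of_pairs hi (hmem la' h1)
      ((mem_iff_of_span_eq k' _).2 (hmem lb' h2))
    obtain ⟨s, e⟩ := Submodule.mem_span_singleton.1 hin
    have hs : s ≠ 0 := by rintro rfl; exact hne (by rw [← e, zero_smul])
    have r := span_singleton_eq_iff.2 ⟨s, hs, e.symm⟩
    exact ⟨r, k'.symm.trans r⟩
  have single : ∀ {y : V4} {W : Submodule ℝ V4} {a : V4}, y ∈ W → a ∉ W →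
      a ∉ Submodule.span ℝ {y} := fun hy ha h =>
    ha ((Submodule.span_singleton_le_iff_mem _ _).2 hy h)
  obtain ⟨r1, r2⟩ := corner hxP habc hy1 hz1 (single hyM.2 haN') (single hzM.2 hbN') exa exb
  obtain ⟨r3, r4⟩ := corner hx'P habc' hy2 hz2 (single hyM.1 ha'N') (single hzM.1 hb'N') exa' exb'
  exact ⟨la', lb', ya', yb',
    laplace_notMem hGa hPa haN hcN ha'N haN' ha'N' haG hcGa ha'G haP ha'P hPaG hyM.2 hy0 hy1,
    laplace_notMem hGb hPb hbN hcN hb'N hbN' hb'N' hbG hcGb hb'G hbP hb'P hPbG hzM.2 hz0 hz1,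
    r1, r3, r2, r4, hcl⟩

/-! ### Generic vertices -/

theorem fin3_one_one (k : Fin 3) : k + 1 + 1 = k + 2 := by decide +revert
theorem fin3_one_two (k : Fin 3) : k + 1 + 2 = k := by decide +revert
theorem fin3_two_one (k : Fin 3) : k + 2 + 1 = k := by decide +revert
theorem fin3_two_two (k : Fin 3) : k + 2 + 2 = k + 1 := by decide +revert

/-- The plane of the face at `x` with normal direction `k`. -/
def nearSpan (x : V4) (p : Fin 3 → V4) (k : Fin 3) : Submodule ℝ V4 :=
  Submodule.span ℝ {x, p (k + 1), p (k + 2)}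

/-- The plane of the opposite face with normal direction `k`. -/
def farSpan (p q : Fin 3 → V4) (k : Fin 3) : Submodule ℝ V4 :=
  Submodule.span ℝ {p k, q (k + 1), q (k + 2)}

/-- Homogeneous coordinates of seven generic vertices of a Q-cube. -/
structure GenericVectors (x : V4) (p q : Fin 3 → V4) : Prop where
  near : ∀ k, LinearIndependent ℝ ![x, p (k + 1), p (k + 2)]
  left : ∀ k, LinearIndependent ℝ ![x, p (k + 1), q k]
  right : ∀ k, LinearIndependent ℝ ![x, p (k + 2), q k]
  opposite : ∀ k, LinearIndependent ℝ ![p (k + 1), p (k + 2), q k]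
  corner : ∀ k, p k ∉ nearSpan x p k
  far : ∀ k, LinearIndependent ℝ ![p k, q (k + 1), q (k + 2), q k]
  planar : ∀ k, q k ∈ nearSpan x p k

namespace GenericVectors

variable {x : V4} {p q : Fin 3 → V4}

theorem x_mem (k : Fin 3) : x ∈ nearSpan x p k := Submodule.subset_span (by simp)
theorem p_one_mem (k : Fin 3) : p (k + 1) ∈ nearSpan x p k := Submodule.subset_span (by simp)
theorem p_two_mem (k : Fin 3) : p (k + 2) ∈ nearSpan x p k := Submodule.subset_span (by simp)
theorem p_mem_far (k : Fin 3) : p k ∈ farSpan p q k := Submodule.subset_span (by simp)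
theorem q_one_mem (k : Fin 3) : q (k + 1) ∈ farSpan p q k := Submodule.subset_span (by simp)
theorem q_two_mem (k : Fin 3) : q (k + 2) ∈ farSpan p q k := Submodule.subset_span (by simp)

theorem q_mem_one (k : Fin 3) : q k ∈ farSpan p q (k + 1) := by
  have := q_two_mem (p := p) (q := q) (k + 1)
  rwa [fin3_one_two] at this

theorem q_mem_two (k : Fin 3) : q k ∈ farSpan p q (k + 2) := by
  have := q_one_mem (p := p) (q := q) (k + 2)
  rwa [fin3_two_one] at this

theorem q_two_mem_one (k : Fin 3) : q (k + 2) ∈ farSpan p q (k + 1) := by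
  have := q_one_mem (p := p) (q := q) (k + 1)
  rwa [fin3_one_one] at this

theorem q_one_mem_two (k : Fin 3) : q (k + 1) ∈ farSpan p q (k + 2) := by
  have := q_two_mem (p := p) (q := q) (k + 2)
  rwa [fin3_two_two] at this

theorem finrank_near (h : GenericVectors x p q) (k : Fin 3) : finrank ℝ (nearSpan x p k) = 3 :=
  finrank_span_triple (h.near k)

theorem far_triple (h : GenericVectors x p q) (k : Fin 3) :
    LinearIndependent ℝ ![p k, q (k + 1), q (k + 2)] :=
  indep_triple_iff.2 fun a b c e =>
    have := indep_quad_iff.1 (h.far k) a b c 0 (by rw [zero_smul, add_zero, e])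
    ⟨this.1, this.2.1, this.2.2.1⟩

theorem finrank_far (h : GenericVectors x p q) (k : Fin 3) : finrank ℝ (farSpan p q k) = 3 :=
  finrank_span_triple (h.far_triple k)

theorem q_notMem_far (h : GenericVectors x p q) (k : Fin 3) : q k ∉ farSpan p q k :=
  notMem_span_triple (h.far k)

/-- Otherwise two near planes would share three independent points, which puts the four points `x, p
0, p 1, p 2` into one plane. -/
theorem q_two_notMem_near (h : GenericVectors x p q) (k : Fin 3) : q (k + 2) ∉ nearSpan x p k := by
  intro hq
  have hi := h.right (k + 2)
  have hp := p_two_mem (x := x) (p := p) (k + 2)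
  have hk := p_one_mem (x := x) (p := p) (k + 2)
  rw [fin3_two_two] at hi hp
  rw [fin3_two_one] at hk
  have e := plane_eq (h.finrank_near k) (h.finrank_near (k + 2)) hi (x_mem k) (p_one_mem k) hq
    (x_mem _) hp (h.planar _)
  exact h.corner k (e ▸ hk)

theorem q_one_notMem_near (h : GenericVectors x p q) (k : Fin 3) : q (k + 1) ∉ nearSpan x p k := by
  intro hq
  have hi := h.left (k + 1)
  have hp := p_one_mem (x := x) (p := p) (k + 1)
  have hk := p_two_mem (x := x) (p := p) (k + 1)
  rw [fin3_one_one] at hi hp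
  rw [fin3_one_two] at hk
  have e := plane_eq (h.finrank_near k) (h.finrank_near (k + 1)) hi (x_mem k) (p_two_mem k) hq
    (x_mem _) hp (h.planar _)
  exact h.corner k (e ▸ hk)

/-- Otherwise this far plane would equal the near plane `k + 2`, which would then contain `q (k +
1)`. -/
theorem p_one_notMem_far (h : GenericVectors x p q) (k : Fin 3) : p (k + 1) ∉ farSpan p q k := by
  intro hp
  have hi := h.opposite (k + 2)
  have h1 := p_one_mem (x := x) (p := p) (k + 2)
  have h2 := p_two_mem (x := x) (p := p) (k + 2)
  have hn := h.q_two_notMem_near (k + 2)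
  rw [fin3_two_one] at hi h1
  rw [fin3_two_two] at hi h2 hn
  have e := plane_eq (h.finrank_far k) (h.finrank_near (k + 2)) hi (p_mem_far k) hp (q_two_mem k)
    h1 h2 (h.planar _)
  exact hn (e ▸ q_one_mem k)

theorem p_two_notMem_far (h : GenericVectors x p q) (k : Fin 3) : p (k + 2) ∉ farSpan p q k := by
  intro hp
  have hi := h.opposite (k + 1)
  have h1 := p_one_mem (x := x) (p := p) (k + 1)
  have h2 := p_two_mem (x := x) (p := p) (k + 1)
  have hn := h.q_one_notMem_near (k + 1)
  rw [fin3_one_one] at hi h1 hn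
  rw [fin3_one_two] at hi h2
  have e := plane_eq (h.finrank_far k) (h.finrank_near (k + 1)) hi hp (p_mem_far k) (q_one_mem k)
    h1 h2 (h.planar _)
  exact hn (e ▸ q_two_mem k)

theorem near_ne_far (h : GenericVectors x p q) (k : Fin 3) : nearSpan x p k ≠ farSpan p q k :=
  fun e => h.q_notMem_far k (e ▸ h.planar k)

/-- Each of the other two far planes contains `t` and just one of the two points `q`, which kills
the coefficients in a relation one by one. -/
theorem far_triple_last (h : GenericVectors x p q) {t : V4} (ht : ∀ k, t ∈ farSpan p q k)
    (ht0 : t ≠ 0) (k : Fin 3) :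
    LinearIndependent ℝ ![q (k + 2), q (k + 1), t] := by
  refine indep_triple_of_notMem ?_ fun hm => ?_
  · exact indep_pair_of_triple (indep_rotate_of_triple (indep_swap_of_triple (h.far_triple k)))
  · obtain ⟨a, b, e⟩ := Submodule.mem_span_pair.1 hm
    have hb : b = 0 := by
      by_contra hb
      refine h.q_notMem_far (k + 1) ((Submodule.smul_mem_iff _ hb).1 ?_)
      have : b • q (k + 1) = t - a • q (k + 2) := by rw [← e]; module
      rw [this]
      exact Submodule.sub_mem _ (ht _) (Submodule.smul_mem _ _ (q_two_mem_one k))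
    have ha : a = 0 := by
      by_contra ha
      refine h.q_notMem_far (k + 2) ((Submodule.smul_mem_iff _ ha).1 ?_)
      have : a • q (k + 2) = t - b • q (k + 1) := by rw [← e]; module
      rw [this]
      exact Submodule.sub_mem _ (ht _) (Submodule.smul_mem _ _ (q_one_mem_two k))
    exact ht0 (by rw [← e, ha, hb]; simp)

/-- The first two far planes meet in a line containing `q 2`, and `q 2` is not in the third. -/
theorem finrank_inf_far (h : GenericVectors x p q) :
    finrank ℝ (farSpan p q 2 ⊓ (farSpan p q 0 ⊓ farSpan p q 1) : Submodule ℝ V4) = 1 := by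
  rw [inf_comm]
  have e : farSpan p q 0 ≠ farSpan p q 1 := fun e =>
    h.q_notMem_far 1 (e ▸ q_one_mem (p := p) (q := q) 0)
  refine finrank_inf_line (h.finrank_far 2) (finrank_inf (h.finrank_far 0) (h.finrank_far 1) e)
    fun hle => h.q_notMem_far 2 (hle ⟨q_two_mem (p := p) (q := q) 0, q_one_mem (p := p) (q := q) 1⟩)

theorem exists_last (h : GenericVectors x p q) : ∃ t, t ≠ 0 ∧ ∀ k, t ∈ farSpan p q k := by
  obtain ⟨⟨t, ht⟩, h0, -⟩ := finrank_eq_one_iff'.1 h.finrank_inf_far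
  refine ⟨t, fun e => h0 (Subtype.ext e), fun k => ?_⟩
  fin_cases k
  exacts [ht.2.1, ht.2.2, ht.1]

theorem last_unique (h : GenericVectors x p q) {s t : V4} (hs : ∀ k, s ∈ farSpan p q k)
    (ht : ∀ k, t ∈ farSpan p q k)
    (hs0 : s ≠ 0) (ht0 : t ≠ 0) : Submodule.span ℝ {s} = Submodule.span ℝ {t} :=
  span_eq_of_dep hs0 ht0 (dep_of_finrank_one h.finrank_inf_far.le ⟨hs 2, hs 0, hs 1⟩
    ⟨ht 2, ht 0, ht 1⟩)

end GenericVectors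

/-! ### Patches over generic vertices -/

/-- The patch `F` is adapted to the quadrilateral with homogeneous coordinates `a, b, d, c`. -/
structure AdaptedTo (F : ℝ → ℝ → V4) (a b d c : V4) : Prop where
  patch : IsSCPatch F
  v00 : Submodule.span ℝ {F 0 0} = Submodule.span ℝ {a}
  v10 : Submodule.span ℝ {F 1 0} = Submodule.span ℝ {b}
  v11 : Submodule.span ℝ {F 1 1} = Submodule.span ℝ {d}
  v01 : Submodule.span ℝ {F 0 1} = Submodule.span ℝ {c}

theorem mem_supportingPlane_of_span_eq {γ : ℝ → V4} {t : ℝ} (ht : t ∈ Icc (0 : ℝ) 1) {a : V4}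
    (h : Submodule.span ℝ {γ t} = Submodule.span ℝ {a}) : a ∈ supportingPlane γ :=
  (mem_iff_of_span_eq h _).1 (IsConicArc.mem_supportingPlane ht)

theorem span_pair_congr {a b a' b' : V4} (ha : Submodule.span ℝ {a} = Submodule.span ℝ {a'})
    (hb : Submodule.span ℝ {b} = Submodule.span ℝ {b'}) :
    Submodule.span ℝ {a, b} = Submodule.span ℝ {a', b'} := by
  rw [Submodule.span_insert, Submodule.span_insert a', ha, hb]

namespace AdaptedTo

variable {F : ℝ → ℝ → V4} {a b c d : V4}

theorem swap (h : AdaptedTo F a b d c) : AdaptedTo (fun u v => F v u) a c d b :=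
  ⟨h.patch.swap, h.v00, h.v01, h.v11, h.v10⟩

theorem span_swap (a b c : V4) : Submodule.span ℝ {a, c, b} = Submodule.span ℝ {a, b, c} := by
  rw [Set.pair_comm]

theorem planeV_eq (h : AdaptedTo F a b d c) (hi : LinearIndependent ℝ ![a, b, c])
    (hb : b ∈ supportingPlane fun v => F 0 v) :
    (supportingPlane fun v => F 0 v) = Submodule.span ℝ {a, b, c} :=
  (span_triple_eq h.patch.boundaryV0.finrank_supportingPlane
    (mem_supportingPlane_of_span_eq zero_mem_I h.v00) hb
    (mem_supportingPlane_of_span_eq (γ := fun v => F 0 v) one_mem_I h.v01) hi).symm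

/-- If opposite boundary planes coincided, their plane would contain `a, b, c` and hence be the face
plane. -/
theorem planeV_ne (h : AdaptedTo F a b d c) (hi : LinearIndependent ℝ ![a, b, c])
    (hV : (supportingPlane fun v => F 0 v) ≠ Submodule.span ℝ {a, b, c}) :
    (supportingPlane fun v => F 0 v) ≠ supportingPlane fun v => F 1 v := fun e =>
  hV (h.planeV_eq hi (e ▸ mem_supportingPlane_of_span_eq (γ := fun v => F 1 v) zero_mem_I h.v10))

theorem planeU_ne_planeV (h : AdaptedTo F a b d c) (hi : LinearIndependent ℝ ![a, b, c])
    (hV : (supportingPlane fun v => F 0 v) ≠ Submodule.span ℝ {a, b, c}) :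
    (supportingPlane fun u => F u 0) ≠ supportingPlane fun v => F 0 v := fun e =>
  hV (h.planeV_eq hi (e ▸ mem_supportingPlane_of_span_eq (γ := fun u => F u 0) one_mem_I h.v10))

theorem planeU_ne (h : AdaptedTo F a b d c) (hi : LinearIndependent ℝ ![a, b, c])
    (hU : (supportingPlane fun u => F u 0) ≠ Submodule.span ℝ {a, b, c}) :
    (supportingPlane fun u => F u 0) ≠ supportingPlane fun u => F u 1 :=
  h.swap.planeV_ne (indep_swap_of_triple hi) (by rwa [span_swap])

theorem exists_mapV (h : AdaptedTo F a b d c) (hi : LinearIndependent ℝ ![a, b, c])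
    (hV : (supportingPlane fun v => F 0 v) ≠ Submodule.span ℝ {a, b, c}) :
    ∃ (y : V4) (l : V4 →ₗ[ℝ] ℝ), y ∉ (supportingPlane fun v => F 0 v) ∧
      y ∈ Submodule.span ℝ {a, b} ∧ y ∈ Submodule.span ℝ {c, d} ∧ ∀ v ∈ Icc (0 : ℝ) 1,
        Submodule.span ℝ {F 1 v} = Submodule.span ℝ {persp l y (F 0 v)} := by
  obtain ⟨y, l, h1, h2, h3, h4⟩ := h.patch.exists_boundary_map (h.planeV_ne hi hV)
  rw [span_pair_congr h.v00 h.v10] at h2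
  rw [span_pair_congr h.v01 h.v11] at h3
  exact ⟨y, l, h1, h2, h3, h4⟩

theorem exists_mapU (h : AdaptedTo F a b d c) (hi : LinearIndependent ℝ ![a, b, c])
    (hU : (supportingPlane fun u => F u 0) ≠ Submodule.span ℝ {a, b, c}) :
    ∃ (y : V4) (l : V4 →ₗ[ℝ] ℝ), y ∉ (supportingPlane fun u => F u 0) ∧
      y ∈ Submodule.span ℝ {a, c} ∧ y ∈ Submodule.span ℝ {b, d} ∧ ∀ u ∈ Icc (0 : ℝ) 1,
        Submodule.span ℝ {F u 1} = Submodule.span ℝ {persp l y (F u 0)} :=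
  h.swap.exists_mapV (indep_swap_of_triple hi) (by rwa [span_swap])

end AdaptedTo

/-- Three patches over generic vertices with common boundary curves that are in general position. -/
structure CauchyPatches (x : V4) (p q : Fin 3 → V4) (f : Fin 3 → ℝ → ℝ → V4) : Prop where
  generic : GenericVectors x p q
  adapted : ∀ k, AdaptedTo (f k) x (p (k + 1)) (q k) (p (k + 2))
  commonBoundary : ∀ i, arc (fun t => f (i + 2) t 0) = arc fun t => f (i + 1) 0 t
  planesNear : ∀ k, (supportingPlane fun t => f k t 0) ≠ nearSpan x p k ∧
    (supportingPlane fun t => f k 0 t) ≠ nearSpan x p k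
  planesFar : ∀ k, (supportingPlane fun t => f k t 1) ≠ farSpan p q (k + 2) ∧
    (supportingPlane fun t => f k 1 t) ≠ farSpan p q (k + 1)

/-- Three patches that complete `f` to an SC-cube. -/
structure FarPatches (p q : Fin 3 → V4) (t : V4) (f g : Fin 3 → ℝ → ℝ → V4) : Prop where
  adapted : ∀ k, AdaptedTo (g k) (p k) (q (k + 2)) t (q (k + 1))
  boundaryU : ∀ k, arc (fun s => g k s 0) = arc fun s => f (k + 2) 1 s
  boundaryV : ∀ k, arc (fun s => f (k + 1) s 1) = arc fun s => g k 0 s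
  last : ∀ i, arc (fun s => g (i + 2) s 1) = arc fun s => g (i + 1) 1 s

namespace CauchyPatches

variable {x : V4} {p q : Fin 3 → V4} {f : Fin 3 → ℝ → ℝ → V4}

theorem plane_eq (h : CauchyPatches x p q f) (i : Fin 3) :
    (supportingPlane fun t => f (i + 2) t 0) = supportingPlane fun t => f (i + 1) 0 t :=
  supportingPlane_eq_of_arc_eq (h.commonBoundary i)

theorem arcMap (h : CauchyPatches x p q f) (i : Fin 3) :
    ArcMap LinearMap.id (fun t => f (i + 1) 0 t) fun t => f (i + 2) t 0 := by
  have h1 := h.adapted (i + 1)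
  have h2 := h.adapted (i + 2)
  rw [fin3_one_two] at h1
  rw [fin3_two_one] at h2
  exact arcMap_id h1.patch.boundaryV0 h2.patch.boundaryU0 (h1.patch.smooth2.continuousV 0)
    (h2.patch.smooth2.continuousU 0) (h.commonBoundary i).symm (h2.v00.trans h1.v00.symm)
    (h2.v10.trans h1.v01.symm)

/-- Each centre is a Laplace point: one of the sides through it lies in the near plane with normal
direction `i`, the other in the far plane. So both centres are on the intersection of these planes.
-/
theorem exists_maps (h : CauchyPatches x p q f) (i : Fin 3) :
    ∃ (ya yb : V4) (la lb : V4 →ₗ[ℝ] ℝ),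
      ya ∉ (supportingPlane fun t => f (i + 1) 0 t) ∧
      yb ∉ (supportingPlane fun t => f (i + 1) 0 t) ∧
      ya ∈ (nearSpan x p i ⊓ farSpan p q i : Submodule ℝ V4) ∧
      yb ∈ (nearSpan x p i ⊓ farSpan p q i : Submodule ℝ V4) ∧
      (∀ s ∈ Icc (0 : ℝ) 1, Submodule.span ℝ {f (i + 2) s 1} =
        Submodule.span ℝ {persp la ya (f (i + 2) s 0)}) ∧
      ∀ s ∈ Icc (0 : ℝ) 1, Submodule.span ℝ {f (i + 1) 1 s} =
        Submodule.span ℝ {persp lb yb (f (i + 1) 0 s)} := by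
  obtain ⟨ya, la, a1, a2, a3, a4⟩ := (h.adapted (i + 2)).exists_mapU (h.generic.near _)
    (h.planesNear (i + 2)).1
  obtain ⟨yb, lb, b1, b2, b3, b4⟩ := (h.adapted (i + 1)).exists_mapV (h.generic.near _)
    (h.planesNear (i + 1)).2
  rw [fin3_two_two] at a2
  rw [fin3_two_one] at a3
  rw [fin3_one_one] at b2
  rw [fin3_one_two] at b3
  rw [h.plane_eq] at a1
  exact ⟨ya, yb, la, lb, a1, b1,
    ⟨span_pair_le (GenericVectors.x_mem i) (GenericVectors.p_one_mem i) a2,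
      span_pair_le (GenericVectors.p_mem_far i) (GenericVectors.q_two_mem i) a3⟩,
    ⟨span_pair_le (GenericVectors.x_mem i) (GenericVectors.p_two_mem i) b2,
      span_pair_le (GenericVectors.p_mem_far i) (GenericVectors.q_one_mem i) b3⟩, a4, b4⟩

end CauchyPatches

namespace FarPatches

variable {x t : V4} {p q : Fin 3 → V4} {f g g' : Fin 3 → ℝ → ℝ → V4}

theorem indep (h : CauchyPatches x p q f) (k : Fin 3) :
    LinearIndependent ℝ ![p k, q (k + 2), q (k + 1)] :=
  indep_swap_of_triple (h.generic.far_triple k)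

theorem planeU_ne (hg : FarPatches p q t f g) (h : CauchyPatches x p q f) (k : Fin 3) :
    (supportingPlane fun s => g k s 0) ≠ Submodule.span ℝ {p k, q (k + 2), q (k + 1)} := by
  rw [supportingPlane_eq_of_arc_eq (hg.boundaryU k), AdaptedTo.span_swap]
  have := (h.planesFar (k + 2)).2
  rwa [fin3_two_one] at this

theorem planeV_ne (hg : FarPatches p q t f g) (h : CauchyPatches x p q f) (k : Fin 3) :
    (supportingPlane fun s => g k 0 s) ≠ Submodule.span ℝ {p k, q (k + 2), q (k + 1)} := by
  rw [← supportingPlane_eq_of_arc_eq (hg.boundaryV k), AdaptedTo.span_swap]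
  have := (h.planesFar (k + 1)).1
  rwa [fin3_one_two] at this

/-- The last edge of the direction `i` is obtained in two ways from the first one. -/
theorem exists_arcMaps (hg : FarPatches p q t f g) (h : CauchyPatches x p q f)
    (ht : ∀ k, t ∈ farSpan p q k) (i : Fin 3)
    {ya yb : V4} {la lb : V4 →ₗ[ℝ] ℝ}
    (ha : ∀ s ∈ Icc (0 : ℝ) 1, Submodule.span ℝ {f (i + 2) s 1} =
      Submodule.span ℝ {persp la ya (f (i + 2) s 0)})
    (hb : ∀ s ∈ Icc (0 : ℝ) 1, Submodule.span ℝ {f (i + 1) 1 s} =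
      Submodule.span ℝ {persp lb yb (f (i + 1) 0 s)}) :
    ∃ (la' lb' : V4 →ₗ[ℝ] ℝ) (ya' yb' : V4),
      ya' ∈ (Submodule.span ℝ {p (i + 1), q i} ⊓ farSpan p q i : Submodule ℝ V4) ∧
      yb' ∈ (Submodule.span ℝ {p (i + 2), q i} ⊓ farSpan p q i : Submodule ℝ V4) ∧
      ArcMap (persp la' ya' ∘ₗ persp la ya) (fun s => f (i + 1) 0 s) (fun s => g (i + 2) s 1) ∧
      ArcMap (persp lb' yb' ∘ₗ persp lb yb) (fun s => f (i + 1) 0 s) (fun s => g (i + 2) s 1) := by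
  have f1 := h.adapted (i + 1)
  have f2 := h.adapted (i + 2)
  have g1 := hg.adapted (i + 1)
  have g2 := hg.adapted (i + 2)
  have i1 := indep h (i + 1)
  have i2 := indep h (i + 2)
  have n1 := hg.planeV_ne h (i + 1)
  have n2 := hg.planeU_ne h (i + 2)
  have e1 := hg.boundaryV (i + 1)
  have e2 := hg.boundaryU (i + 2)
  simp only [fin3_one_one, fin3_one_two, fin3_two_one, fin3_two_two]
    at f1 f2 g1 g2 i1 i2 n1 n2 e1 e2
  obtain ⟨ya', la', a1, a2, a3, a4⟩ := g1.exists_mapV i1 n1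
  obtain ⟨yb', lb', b1, b2, b3, b4⟩ := g2.exists_mapU i2 n2
  have j1 : ArcMap LinearMap.id (fun s => f (i + 2) s 1) fun s => g (i + 1) 0 s :=
    arcMap_id f2.patch.boundaryU1 g1.patch.boundaryV0 (f2.patch.smooth2.continuousU 1)
      (g1.patch.smooth2.continuousV 0) e1 (g1.v00.trans f2.v01.symm) (g1.v01.trans f2.v11.symm)
  have j2 : ArcMap LinearMap.id (fun s => f (i + 1) 1 s) fun s => g (i + 2) s 0 :=
    arcMap_id f1.patch.boundaryV1 g2.patch.boundaryU0 (f1.patch.smooth2.continuousV 1)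
      (g2.patch.smooth2.continuousU 0) e2.symm (g2.v00.trans f1.v10.symm) (g2.v10.trans f1.v11.symm)
  have j3 : ArcMap LinearMap.id (fun s => g (i + 1) 1 s) fun s => g (i + 2) s 1 :=
    arcMap_id g1.patch.boundaryV1 g2.patch.boundaryU1 (g1.patch.smooth2.continuousV 1)
      (g2.patch.smooth2.continuousU 1) (hg.last i).symm (g2.v01.trans g1.v10.symm)
      (g2.v11.trans g1.v11.symm)
  refine ⟨la', lb', ya', yb', ⟨a2, ?_⟩, ⟨b2, ?_⟩, ?_, ?_⟩
  · exact span_pair_le (GenericVectors.q_two_mem i) (ht i) a3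
  · exact span_pair_le (GenericVectors.q_one_mem i) (ht i) b3
  · exact ((((h.arcMap i).comp (ArcMap.of_span_eq ha)).comp j1).comp (ArcMap.of_span_eq a4)).comp j3
  · exact ((ArcMap.of_span_eq hb).comp j2).comp (ArcMap.of_span_eq b4)

/-- Instance of `last_edge_unique`. The last two centres can only lie on the lines from `q i` to `p
(i + 1)` and `p (i + 2)`, within the far plane. These lines meet only in `q i`, which is off the far
plane, so `A` and `B` have zero intersection. -/
theorem last_arc_eq (hg : FarPatches p q t f g) (hg' : FarPatches p q t f g')
    (h : CauchyPatches x p q f) (ht : ∀ k, t ∈ farSpan p q k) (i : Fin 3) :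
    arc (fun s => g (i + 2) s 1) = arc fun s => g' (i + 2) s 1 := by
  obtain ⟨ya, yb, la, lb, a1, -, a2, b2, a3, b3⟩ := h.exists_maps i
  obtain ⟨la', lb', ya', yb', c1, c2, c3, c4⟩ := hg.exists_arcMaps h ht i a3 b3
  obtain ⟨la₁, lb₁, ya₁, yb₁, d1, d2, d3, d4⟩ := hg'.exists_arcMaps h ht i a3 b3
  have hG := h.generic
  refine last_edge_unique (h.adapted (i + 1)).patch.boundaryV0
    (M := nearSpan x p i ⊓ farSpan p q i)
    (A := Submodule.span ℝ {p (i + 1), q i} ⊓ farSpan p q i)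
    (B := Submodule.span ℝ {p (i + 2), q i} ⊓ farSpan p q i)
    (finrank_inf (hG.finrank_near i) (hG.finrank_far i) (hG.near_ne_far i))
    (inf_le_inf_right _ (span_pair_le (GenericVectors.p_one_mem i) (hG.planar i)))
    (inf_le_inf_right _ (span_pair_le (GenericVectors.p_two_mem i) (hG.planar i)))
    (fun y hA hB => ?_) a2 b2 a1 c1 c2 d1 d2 c3 c4 d3 d4
  obtain ⟨r, e⟩ := Submodule.mem_span_singleton.1
    (mem_span_singleton_of_pairs (hG.opposite i) hA.1 hB.1)
  by_contra hy
  have hr : r ≠ 0 := by rintro rfl; exact hy (by rw [← e, zero_smul])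
  exact hG.q_notMem_far i ((Submodule.smul_mem_iff _ hr).1 (e ▸ hA.2))

theorem samePatch (hg : FarPatches p q t f g) (hg' : FarPatches p q t f g')
    (h : CauchyPatches x p q f) (ht : ∀ k, t ∈ farSpan p q k) (k : Fin 3) :
    SamePatch (g k) (g' k) := by
  have a := hg.adapted k
  have a' := hg'.adapted k
  have hi := indep h k
  have nU := hg.planeU_ne h k
  have nV := hg.planeV_ne h k
  have l1 := hg.last_arc_eq hg' h ht (k + 1)
  have l2 := hg.last_arc_eq hg' h ht (k + 2)
  rw [hg.last (k + 2), hg'.last (k + 2)] at l2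
  simp only [fin3_one_two, fin3_two_one] at l1 l2
  exact a.patch.samePatch_of_boundary a'.patch ((hg.boundaryU k).trans (hg'.boundaryU k).symm) l1
    ((hg.boundaryV k).symm.trans (hg'.boundaryV k)) l2 (a.v00.trans a'.v00.symm)
    (a.v10.trans a'.v10.symm) (a.v01.trans a'.v01.symm) (a.planeU_ne hi nU) (a.planeV_ne hi nV)
    (a.planeU_ne_planeV hi nV)

end FarPatches

/-! ### Existence of the opposite patches -/

theorem arc_congr {γ δ : ℝ → V4}
    (h : ∀ s ∈ Icc (0 : ℝ) 1, Submodule.span ℝ {γ s} = Submodule.span ℝ {δ s}) :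
    arc γ = arc δ :=
  (ArcMap.of_span_eq (φ := LinearMap.id) h).arc_eq

namespace CauchyPatches

variable {x t : V4} {p q : Fin 3 → V4} {f : Fin 3 → ℝ → ℝ → V4}

/-- Instance of `exists_last_edge` for the four edges of direction `i`: they start at `x`, `p (i +
1)`, `p (i + 2)`, `q i` and end at `p i`, `q (i + 2)`, `q (i + 1)`, `t`. -/
theorem exists_last (h : CauchyPatches x p q f) (ht : ∀ k, t ∈ farSpan p q k) (ht0 : t ≠ 0)
    (i : Fin 3) : ∃ (la' lb' : V4 →ₗ[ℝ] ℝ) (ya' yb' : V4),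
      ya' ∉ (supportingPlane fun s => f (i + 2) s 1) ∧
      yb' ∉ (supportingPlane fun s => f (i + 1) 1 s) ∧
      Submodule.span ℝ {persp la' ya' (p (i + 1))} = Submodule.span ℝ {q i} ∧
      Submodule.span ℝ {persp la' ya' (q (i + 2))} = Submodule.span ℝ {t} ∧
      Submodule.span ℝ {persp lb' yb' (p (i + 2))} = Submodule.span ℝ {q i} ∧
      Submodule.span ℝ {persp lb' yb' (q (i + 1))} = Submodule.span ℝ {t} ∧
      arc (fun s => persp la' ya' (f (i + 2) s 1)) =
        arc fun s => persp lb' yb' (f (i + 1) 1 s) := by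
  obtain ⟨ya, yb, la, lb, a1, b1, a2, b2, a3, b3⟩ := h.exists_maps i
  have f1 := h.adapted (i + 1)
  have f2 := h.adapted (i + 2)
  have n1 := (h.planesFar (i + 1)).2
  have n2 := (h.planesFar (i + 2)).1
  simp only [fin3_one_one, fin3_one_two, fin3_two_one, fin3_two_two] at f1 f2 n1 n2
  have hG := h.generic
  obtain ⟨la', lb', ya', yb', c1, c2, c3, c4, c5, c6, c7⟩ := exists_last_edge
    (mem_supportingPlane_of_span_eq zero_mem_I f1.v00)
    (mem_supportingPlane_of_span_eq (γ := fun s => f (i + 1) 0 s) one_mem_I f1.v01)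
    f2.patch.boundaryU1.finrank_supportingPlane f1.patch.boundaryV1.finrank_supportingPlane
    (hG.finrank_near i) (hG.finrank_far i) (hG.finrank_far (i + 1)) (hG.finrank_far (i + 2))
    (GenericVectors.p_one_mem i) (GenericVectors.p_two_mem i) (hG.planar i)
    (GenericVectors.q_two_mem i) (GenericVectors.q_one_mem i) (ht i)
    (GenericVectors.p_mem_far (i + 1)) (GenericVectors.q_mem_one i)
    (GenericVectors.q_two_mem_one i) (ht (i + 1)) (GenericVectors.p_mem_far (i + 2))
    (GenericVectors.q_mem_two i) (GenericVectors.q_one_mem_two i) (ht (i + 2))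
    (mem_supportingPlane_of_span_eq (γ := fun s => f (i + 2) s 1) zero_mem_I f2.v01)
    (mem_supportingPlane_of_span_eq (γ := fun s => f (i + 2) s 1) one_mem_I f2.v11)
    (mem_supportingPlane_of_span_eq (γ := fun s => f (i + 1) 1 s) zero_mem_I f1.v10)
    (mem_supportingPlane_of_span_eq (γ := fun s => f (i + 1) 1 s) one_mem_I f1.v11)
    n2 n1 (hG.opposite i) (hG.far_triple_last ht ht0 i) (hG.p_one_notMem_far i)
    (hG.p_two_notMem_far i) (hG.q_notMem_far i) (hG.q_two_notMem_near i) (hG.q_one_notMem_near i)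
    a1 b1 a2 b2
    ((span_map_eq f2.v00.symm _).trans ((a3 0 zero_mem_I).symm.trans f2.v01))
    ((span_map_eq f2.v10.symm _).trans ((a3 1 one_mem_I).symm.trans f2.v11))
    ((span_map_eq f1.v00.symm _).trans ((b3 0 zero_mem_I).symm.trans f1.v10))
    ((span_map_eq f1.v01.symm _).trans ((b3 1 one_mem_I).symm.trans f1.v11))
  refine ⟨la', lb', ya', yb', c1, c2, c3, c4, c5, c6, ?_⟩
  have ma := (((h.arcMap i).comp (ArcMap.of_span_eq a3)).comp
    (ArcMap.of_span_eq (φ := persp la' ya') fun _ _ => rfl)).arc_eq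
  have mb := ((ArcMap.of_span_eq (γ := fun s => f (i + 1) 0 s) b3).comp
    (ArcMap.of_span_eq (φ := persp lb' yb') fun _ _ => rfl)).arc_eq
  rw [ma, mb]
  refine arc_congr fun s hs => ?_
  have := c7 _ (IsConicArc.mem_supportingPlane (γ := fun s => f (i + 1) 0 s) hs)
  simp only [LinearMap.comp_apply, LinearMap.id_apply, this]

/-- The opposite patches of an SC-cube exist. -/
theorem exists_farPatches (h : CauchyPatches x p q f) (ht : ∀ k, t ∈ farSpan p q k)
    (ht0 : t ≠ 0) : ∃ g, FarPatches p q t f g := by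
  choose la lb ya yb c1 c2 c3 c4 c5 c6 c7 using h.exists_last ht ht0
  have main : ∀ k, ∃ G : ℝ → ℝ → V4, IsSCPatch G ∧ ∀ s ∈ Icc (0 : ℝ) 1,
      Submodule.span ℝ {G s 0} = Submodule.span ℝ {f (k + 2) 1 s} ∧
      Submodule.span ℝ {G s 1} =
        Submodule.span ℝ {persp (lb (k + 1)) (yb (k + 1)) (f (k + 2) 1 s)} ∧
      Submodule.span ℝ {G 0 s} = Submodule.span ℝ {f (k + 1) s 1} ∧
      Submodule.span ℝ {G 1 s} =
        Submodule.span ℝ {persp (la (k + 2)) (ya (k + 2)) (f (k + 1) s 1)} := by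
    intro k
    have f1 := h.adapted (k + 1)
    have f2 := h.adapted (k + 2)
    have d1 := c1 (k + 2)
    have d2 := c2 (k + 1)
    have d3 := c3 (k + 2)
    have d4 := c4 (k + 2)
    have d5 := c5 (k + 1)
    have d6 := c6 (k + 1)
    simp only [fin3_one_one, fin3_one_two, fin3_two_one, fin3_two_two] at f1 f2 d1 d2 d3 d4 d5 d6
    have e1 := span_map_eq f2.v11 (persp (lb (k + 1)) (yb (k + 1)))
    have e2 := span_map_eq f1.v11 (persp (la (k + 2)) (ya (k + 2)))
    -- The closing condition of `exists_patch`: the perspectivities of the directions `k + 1` and `k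
    -- + 2` both lead to the eighth vertex.
    have e3 := e1.trans (d6.trans (d4.symm.trans e2.symm))
    have e4 := f2.v11.trans d3.symm
    have e5 := f1.v11.trans d5.symm
    simp only [persp_apply] at e3 e4 e5 ⊢
    exact exists_patch f2.patch.boundaryV1 f1.patch.boundaryU1 (f2.patch.smooth2.curveV 1)
      (f1.patch.smooth2.curveU 1) f2.v10 f1.v01 e4 e5 e3 d2 d1
  choose g hg hb using main
  refine ⟨g, ⟨fun k => ?_, fun k => arc_congr fun s hs => (hb k s hs).1,
    fun k => arc_congr fun s hs => (hb k s hs).2.2.1.symm, fun i => ?_⟩⟩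
  · have f1 := h.adapted (k + 1)
    have f2 := h.adapted (k + 2)
    have d6 := c6 (k + 1)
    simp only [fin3_one_one, fin3_one_two, fin3_two_one, fin3_two_two] at f1 f2 d6
    exact ⟨hg k, (hb k 0 zero_mem_I).1.trans f2.v10, (hb k 1 one_mem_I).1.trans f2.v11,
      (hb k 1 one_mem_I).2.1.trans
        ((span_map_eq f2.v11 (persp (lb (k + 1)) (yb (k + 1)))).trans d6),
      (hb k 1 one_mem_I).2.2.1.trans f1.v11⟩
  · have e1 := fun s hs => (hb (i + 2) s hs).2.1
    have e2 := fun s hs => (hb (i + 1) s hs).2.2.2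
    simp only [fin3_one_one, fin3_one_two, fin3_two_one, fin3_two_two] at e1 e2
    exact (arc_congr e1).trans ((c7 i).symm.trans (arc_congr e2).symm)

end CauchyPatches

/-! ### Points and homogeneous coordinates -/

theorem independent_three {a b c : RP3} :
    Projectivization.Independent ![a, b, c] ↔ LinearIndependent ℝ ![a.rep, b.rep, c.rep] := by
  rw [Projectivization.independent_iff]
  have : Projectivization.rep ∘ ![a, b, c] = ![a.rep, b.rep, c.rep] := by
    ext i; fin_cases i <;> rfl
  rw [this]

theorem independent_four {a b c d : RP3} : Projectivization.Independent ![a, b, c, d] ↔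
    LinearIndependent ℝ ![a.rep, b.rep, c.rep, d.rep] := by
  rw [Projectivization.independent_iff]
  have : Projectivization.rep ∘ ![a, b, c, d] = ![a.rep, b.rep, c.rep, d.rep] := by
    ext i; fin_cases i <;> rfl
  rw [this]

theorem indep_quad_swap {a b c d : V4} (h : LinearIndependent ℝ ![a, b, c, d]) :
    LinearIndependent ℝ ![a, b, d, c] :=
  indep_quad_iff.2 fun s t u v e => by
    have := indep_quad_iff.1 h s t v u (by rw [← e]; module)
    tauto

theorem dependent_four_iff {a b c d : RP3} (h : LinearIndependent ℝ ![a.rep, b.rep, c.rep]) :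
    Projectivization.Dependent ![a, b, d, c] ↔
      d.rep ∈ Submodule.span ℝ {a.rep, b.rep, c.rep} := by
  rw [Projectivization.dependent_iff_not_independent, independent_four, not_iff_comm]
  exact ⟨fun hd => indep_quad_swap (indep_quad_of_notMem h hd),
    fun hi => notMem_span_triple (indep_quad_swap hi)⟩

theorem nearPlane_eq (x : RP3) (x₁ : Fin 3 → RP3) (k : Fin 3) :
    nearPlane x x₁ k = nearSpan x.rep (fun i => (x₁ i).rep) k := by
  rw [nearPlane, nearSpan, Projectivization.submodule_eq, Projectivization.submodule_eq,
    Projectivization.submodule_eq, Submodule.span_insert, Submodule.span_insert, sup_assoc]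

theorem farPlane_eq (x₁ x₂ : Fin 3 → RP3) (k : Fin 3) :
    farPlane x₁ x₂ k = farSpan (fun i => (x₁ i).rep) (fun i => (x₂ i).rep) k := by
  rw [farPlane, farSpan, Projectivization.submodule_eq, Projectivization.submodule_eq,
    Projectivization.submodule_eq, Submodule.span_insert, Submodule.span_insert, sup_assoc]

theorem isAdaptedSCPatch_iff {F : ℝ → ℝ → V4} {a b d c : RP3} :
    IsAdaptedSCPatch F a b d c ↔ AdaptedTo F a.rep b.rep d.rep c.rep := by
  simp only [IsAdaptedSCPatch, HasVertices, Projectivization.submodule_eq]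
  exact ⟨fun h => ⟨h.1, h.2.1.symm, h.2.2.1.symm, h.2.2.2.1.symm, h.2.2.2.2.symm⟩,
    fun h => ⟨h.patch, h.v00.symm, h.v10.symm, h.v11.symm, h.v01.symm⟩⟩

theorem rep_injective {a b : RP3} (h : Submodule.span ℝ {a.rep} = Submodule.span ℝ {b.rep}) :
    a = b :=
  Projectivization.submodule_injective
    (by rw [Projectivization.submodule_eq, Projectivization.submodule_eq, h])

theorem genericVectors {x : RP3} {x₁ x₂ : Fin 3 → RP3} (h : VerticesGeneric x x₁ x₂)
    (hp : ∀ k, (x₂ k).rep ∈ nearSpan x.rep (fun i => (x₁ i).rep) k) :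
    GenericVectors x.rep (fun i => (x₁ i).rep) (fun i => (x₂ i).rep) where
  near k := independent_three.1 (h.1 k).1
  left k := independent_three.1 (h.1 k).2.1
  right k := independent_three.1 (h.1 k).2.2.1
  opposite k := independent_three.1 (h.1 k).2.2.2
  corner k := by
    have hi := independent_four.1 h.2.1
    refine notMem_span_triple (indep_quad_iff.2 fun a b c d e => ?_)
    have key := indep_quad_iff.1 hi
    fin_cases k
    · have := key a d b c (by rw [← e]; simp; module)
      tauto
    · have := key a c d b (by rw [← e]; simp; module)
      tauto
    · have := key a b c d (by rw [← e]; simp)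
      tauto
  far k := independent_four.1 (h.2.2 k)
  planar := hp

/-- Planarity of the faces at `x` is not part of the data: it follows because the centre of the
perspectivity is a common point of the lines `ab` and `cd`. -/
theorem AdaptedTo.mem_span {F : ℝ → ℝ → V4} {a b c d : V4} (h : AdaptedTo F a b d c)
    (hi : LinearIndependent ℝ ![a, b, c])
    (hV : (supportingPlane fun v => F 0 v) ≠ Submodule.span ℝ {a, b, c}) :
    d ∈ Submodule.span ℝ {a, b, c} := by
  obtain ⟨y, l, h1, h2, h3, -⟩ := h.exists_mapV hi hV
  obtain ⟨s, r, e⟩ := Submodule.mem_span_pair.1 h3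
  have hy : y ≠ 0 := by rintro rfl; exact h1 (Submodule.zero_mem _)
  have hab : Submodule.span ℝ {a, b} ≤ Submodule.span ℝ {a, b, c} :=
    span_pair_le (Submodule.subset_span (by simp)) (Submodule.subset_span (by simp))
  by_cases hr : r = 0
  · rw [hr, zero_smul, add_zero] at e
    have hs : s ≠ 0 := by rintro rfl; exact hy (by rw [← e, zero_smul])
    exact absurd ((Submodule.smul_mem_iff _ hs).1 (e ▸ h2)) (notMem_span_pair hi)
  · refine (Submodule.smul_mem_iff _ hr).1 ?_
    have : r • d = y - s • c := by rw [← e]; module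
    rw [this]
    exact Submodule.sub_mem _ (hab h2)
      (Submodule.smul_mem _ _ (Submodule.subset_span (by simp)))

theorem IsCauchyData.cauchyPatches {x : RP3} {x₁ x₂ : Fin 3 → RP3} {f : Fin 3 → ℝ → ℝ → V4}
    (h : IsCauchyData x x₁ x₂ f) :
    CauchyPatches x.rep (fun i => (x₁ i).rep) (fun i => (x₂ i).rep) f := by
  have had := fun k => isAdaptedSCPatch_iff.1 (h.adapted k)
  have hn : ∀ k, (supportingPlane fun t => f k t 0) ≠ nearSpan x.rep (fun i => (x₁ i).rep) k ∧
      (supportingPlane fun t => f k 0 t) ≠ nearSpan x.rep (fun i => (x₁ i).rep) k := by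
    intro k
    rw [← nearPlane_eq]
    exact ⟨(h.planesNear k).1, (h.planesNear k).2.2.1⟩
  refine ⟨genericVectors h.vertices fun k => ?_, had, h.commonBoundary, hn, fun k => ?_⟩
  · exact (had k).mem_span (independent_three.1 (h.vertices.1 k).1) (hn k).2
  · rw [← farPlane_eq, ← farPlane_eq]
    exact h.planesFar k

/-! ### The vertices of a cube -/

section cubeVertex

variable (k : Fin 3)

theorem cubeVertex_0_00 : cubeVertex k 0 0 0 = 0 := by
  decide +revert
theorem cubeVertex_0_10 : cubeVertex k 0 1 0 = Function.update (0 : Fin 3 → Fin 2) (k + 1) 1 := by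
  decide +revert
theorem cubeVertex_0_11 : cubeVertex k 0 1 1 = Function.update (1 : Fin 3 → Fin 2) k 0 := by
  decide +revert
theorem cubeVertex_0_01 : cubeVertex k 0 0 1 = Function.update (0 : Fin 3 → Fin 2) (k + 2) 1 := by
  decide +revert
theorem cubeVertex_1_00 : cubeVertex k 1 0 0 = Function.update (0 : Fin 3 → Fin 2) k 1 := by
  decide +revert
theorem cubeVertex_1_10 : cubeVertex k 1 1 0 = Function.update (1 : Fin 3 → Fin 2) (k + 2) 0 := by
  decide +revert
theorem cubeVertex_1_11 : cubeVertex k 1 1 1 = 1 := by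
  decide +revert
theorem cubeVertex_1_01 : cubeVertex k 1 0 1 = Function.update (1 : Fin 3 → Fin 2) (k + 1) 0 := by
  decide +revert

end cubeVertex

theorem isQCube_iff {X : (Fin 3 → Fin 2) → RP3} : IsQCube X ↔ ∀ k,
    Projectivization.Dependent ![vertex0 X, vertex1 X (k + 1), vertex2 X k, vertex1 X (k + 2)] ∧
    Projectivization.Dependent ![vertex1 X k, vertex2 X (k + 2), X 1, vertex2 X (k + 1)] := by
  refine forall_congr' fun k => ?_
  rw [Fin.forall_fin_two, cubeVertex_0_00, cubeVertex_0_01, cubeVertex_0_10, cubeVertex_0_11,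
    cubeVertex_1_00, cubeVertex_1_01, cubeVertex_1_10, cubeVertex_1_11]
  rfl

theorem isQCube_iff_mem {X : (Fin 3 → Fin 2) → RP3}
    (h : VerticesGeneric (vertex0 X) (vertex1 X) (vertex2 X)) : IsQCube X ↔
      (∀ k, (vertex2 X k).rep ∈ nearSpan (vertex0 X).rep (fun i => (vertex1 X i).rep) k) ∧
      ∀ k, (X 1).rep ∈ farSpan (fun i => (vertex1 X i).rep) (fun i => (vertex2 X i).rep) k := by
  rw [isQCube_iff, forall_and]
  refine and_congr (forall_congr' fun k => ?_) (forall_congr' fun k => ?_)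
  · exact dependent_four_iff (independent_three.1 (h.1 k).1)
  · have hi := independent_four.1 (h.2.2 k)
    rw [dependent_four_iff, AdaptedTo.span_swap]
    · rfl
    · exact indep_swap_of_triple (indep_triple_iff.2 fun a b c e =>
        have := indep_quad_iff.1 hi a b c 0 (by rw [zero_smul, add_zero, e])
        ⟨this.1, this.2.1, this.2.2.1⟩)

/-- The cube with vertices `x`, `x₁ k`, `x₂ k`, `t`. -/
def cubeOf (x : RP3) (x₁ x₂ : Fin 3 → RP3) (t : RP3) : (Fin 3 → Fin 2) → RP3 := fun z =>
  ![![![x, x₁ 2], ![x₁ 1, x₂ 0]], ![![x₁ 0, x₂ 1], ![x₂ 2, t]]] (z 0) (z 1) (z 2)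

theorem vertex0_cubeOf (x : RP3) (x₁ x₂ : Fin 3 → RP3) (t : RP3) :
    vertex0 (cubeOf x x₁ x₂ t) = x := rfl

theorem vertex1_cubeOf (x : RP3) (x₁ x₂ : Fin 3 → RP3) (t : RP3) :
    vertex1 (cubeOf x x₁ x₂ t) = x₁ := by
  ext1 k; fin_cases k <;> rfl

theorem vertex2_cubeOf (x : RP3) (x₁ x₂ : Fin 3 → RP3) (t : RP3) :
    vertex2 (cubeOf x x₁ x₂ t) = x₂ := by
  ext1 k; fin_cases k <;> rfl

theorem cube_ext {X Y : (Fin 3 → Fin 2) → RP3} (h0 : vertex0 X = vertex0 Y)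
    (h1 : vertex1 X = vertex1 Y) (h2 : vertex2 X = vertex2 Y) (h3 : X 1 = Y 1) : X = Y := by
  have hz : ∀ z : Fin 3 → Fin 2, z = 0 ∨ z = 1 ∨
      (∃ k, z = Function.update (0 : Fin 3 → Fin 2) k 1) ∨
      ∃ k, z = Function.update (1 : Fin 3 → Fin 2) k 0 := by decide
  ext1 z
  obtain rfl | rfl | ⟨k, rfl⟩ | ⟨k, rfl⟩ := hz z
  exacts [h0, h3, congrFun h1 k, congrFun h2 k]

/-! ### SC-cubes and opposite patches -/

/-- The six patches of a cube. -/
def cubePatches (f g : Fin 3 → ℝ → ℝ → V4) (k : Fin 3) : Fin 2 → ℝ → ℝ → V4 := ![f k, g k]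

theorem isSCCube_of_farPatches {X : (Fin 3 → Fin 2) → RP3} {f g : Fin 3 → ℝ → ℝ → V4}
    (hX : IsQCube X) (hf : CauchyPatches (vertex0 X).rep (fun i => (vertex1 X i).rep)
      (fun i => (vertex2 X i).rep) f)
    (hg : FarPatches (fun i => (vertex1 X i).rep) (fun i => (vertex2 X i).rep) (X 1).rep f g) :
    IsSCCube X (cubePatches f g) where
  planar := hX
  adapted k := by
    rw [Fin.forall_fin_two, cubeVertex_0_00, cubeVertex_0_01, cubeVertex_0_10, cubeVertex_0_11,
      cubeVertex_1_00, cubeVertex_1_01, cubeVertex_1_10, cubeVertex_1_11, isAdaptedSCPatch_iff,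
      isAdaptedSCPatch_iff]
    exact ⟨hf.adapted k, hg.adapted k⟩
  commonBoundary i := by
    have e1 := hg.boundaryU (i + 1)
    have e2 := hg.boundaryU (i + 2)
    have e3 := hg.boundaryV (i + 1)
    simp only [fin3_one_one, fin3_one_two, fin3_two_two] at e1 e2 e3
    simp only [Fin.forall_fin_two, Fin.val_zero, Fin.val_one, Nat.cast_zero, Nat.cast_one]
    -- The four edges of direction `i`: the one at `x`, two between a near and a far face, and the
    -- one at the eighth vertex.
    exact ⟨⟨hf.commonBoundary i, e2⟩, e3, hg.last i⟩

theorem IsSCCube.farPatches {X : (Fin 3 → Fin 2) → RP3} {F : Fin 3 → Fin 2 → ℝ → ℝ → V4}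
    (h : IsSCCube X F) : FarPatches (fun i => (vertex1 X i).rep) (fun i => (vertex2 X i).rep)
      (X 1).rep (fun k => F k 0) (fun k => F k 1) where
  adapted k := by
    have := h.adapted k 1
    rwa [cubeVertex_1_00, cubeVertex_1_01, cubeVertex_1_10, cubeVertex_1_11,
      isAdaptedSCPatch_iff] at this
  boundaryU k := by
    have := h.commonBoundary (k + 1) 0 1
    simpa only [fin3_one_one, fin3_one_two, Fin.val_zero, Fin.val_one, Nat.cast_zero, Nat.cast_one]
      using this
  boundaryV k := by
    have := h.commonBoundary (k + 2) 1 0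
    simpa only [fin3_two_one, fin3_two_two, Fin.val_zero, Fin.val_one, Nat.cast_zero, Nat.cast_one]
      using this
  last i := by
    have := h.commonBoundary i 1 1
    simpa only [Fin.val_one, Nat.cast_one] using this

theorem IsSCCube.vertices_eq {X : (Fin 3 → Fin 2) → RP3} {F : Fin 3 → Fin 2 → ℝ → ℝ → V4}
    (h : IsSCCube X F) {x : RP3} {x₁ x₂ : Fin 3 → RP3}
    (hf : ∀ k, IsAdaptedSCPatch (F k 0) x (x₁ (k + 1)) (x₂ k) (x₁ (k + 2))) :
    vertex0 X = x ∧ vertex1 X = x₁ ∧ vertex2 X = x₂ := by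
  have ha : ∀ k, IsAdaptedSCPatch (F k 0) (vertex0 X) (vertex1 X (k + 1)) (vertex2 X k)
      (vertex1 X (k + 2)) := by
    intro k
    have := h.adapted k 0
    rwa [cubeVertex_0_00, cubeVertex_0_01, cubeVertex_0_10, cubeVertex_0_11] at this
  refine ⟨Projectivization.submodule_injective ((ha 0).2.1.trans (hf 0).2.1.symm), ?_, ?_⟩
  · ext1 k
    have := (ha (k + 2)).2.2.1.trans (hf (k + 2)).2.2.1.symm
    rw [fin3_two_one] at this
    exact Projectivization.submodule_injective this
  · ext1 k
    exact Projectivization.submodule_injective ((ha k).2.2.2.1.trans (hf k).2.2.2.1.symm)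

/-! ### Existence of admissible data -/

theorem exists_form_of_indep {a b c : V4} (h : LinearIndependent ℝ ![a, b, c]) (r s t : ℝ) :
    ∃ l : V4 →ₗ[ℝ] ℝ, l a = r ∧ l b = s ∧ l c = t := by
  obtain ⟨l, hl⟩ := LinearMap.exists_extend ((Basis.span h).constr ℝ ![r, s, t])
  have key : ∀ i, l (![a, b, c] i) = ![r, s, t] i := by
    intro i
    have h1 := LinearMap.congr_fun hl (Basis.span h i)
    rw [Basis.constr_basis, LinearMap.comp_apply, Submodule.subtype_apply, Basis.span_apply] at h1
    exact h1
  exact ⟨l, key 0, key 1, key 2⟩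

/-- The conic arc from `x` to `p` with tangents through `e`. -/
def bezierConic (x e p : V4) (t : ℝ) : V4 := (1 - t) ^ 2 • x + (t * (1 - t)) • e + t ^ 2 • p

theorem contDiff_bezierConic (x e p : V4) : ContDiff ℝ ∞ (bezierConic x e p) := by
  unfold bezierConic
  fun_prop

theorem bezierConic_zero (x e p : V4) : bezierConic x e p 0 = x := by simp [bezierConic]

theorem bezierConic_one (x e p : V4) : bezierConic x e p 1 = p := by simp [bezierConic]

theorem deriv_bezierConic (x e p : V4) (t : ℝ) : deriv (bezierConic x e p) t =
    (-2 * (1 - t)) • x + (1 - 2 * t) • e + (2 * t) • p := by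
  have h1 : HasDerivAt (fun t : ℝ => (1 - t) ^ 2) (-2 * (1 - t)) t := by
    exact (((hasDerivAt_id t).const_sub 1).fun_pow 2).congr_deriv (by simp)
  have h2 : HasDerivAt (fun t : ℝ => t * (1 - t)) (1 - 2 * t) t := by
    exact ((hasDerivAt_id t).fun_mul ((hasDerivAt_id t).const_sub 1)).congr_deriv (by simp; ring)
  have h3 : HasDerivAt (fun t : ℝ => t ^ 2) (2 * t) t := by
    simpa using hasDerivAt_pow 2 t
  exact (((h1.smul_const x).add (h2.smul_const e)).add (h3.smul_const p)).deriv

theorem isConicArc_bezierConic {x e p : V4} (h : LinearIndependent ℝ ![x, e, p]) :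
    IsConicArc (bezierConic x e p) := by
  have hi := indep_triple_iff.1 h
  refine ⟨fun t _ => ?_, fun s _ t _ hst => ?_, ?_⟩
  · rw [deriv_bezierConic, indep_pair_iff]
    intro a b e'
    obtain ⟨e1, e2, e3⟩ := hi (a * (1 - t) ^ 2 - 2 * b * (1 - t))
      (a * (t * (1 - t)) + b * (1 - 2 * t)) (a * t ^ 2 + 2 * b * t)
      (by rw [← e', bezierConic]; module)
    -- The weights satisfy `(1-t)² + 2t(1-t) + t² = 1`, so this combination isolates `a`; the
    -- derivative contributes zero.
    have ha : a = 0 := by linear_combination e1 + 2 * e2 + e3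
    subst ha
    exact ⟨rfl, by linear_combination e3 / 2 - e1 / 2⟩
  · rw [indep_pair_iff]
    intro a b e'
    obtain ⟨e1, e2, e3⟩ := hi (a * (1 - s) ^ 2 + b * (1 - t) ^ 2)
      (a * (s * (1 - s)) + b * (t * (1 - t))) (a * s ^ 2 + b * t ^ 2)
      (by rw [← e', bezierConic, bezierConic]; module)
    have hab : a + b = 0 := by linear_combination e1 + 2 * e2 + e3
    have ha : a * (s - t) = 0 := by linear_combination -e1 / 2 + e3 / 2 + (1 / 2 - t) * hab
    have ha0 := (mul_eq_zero.1 ha).resolve_right (sub_ne_zero.2 hst)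
    exact ⟨ha0, by linear_combination hab - ha0⟩
  · obtain ⟨a, a1, a2, a3⟩ := exists_form_of_indep h 1 0 0
    obtain ⟨b, b1, b2, b3⟩ := exists_form_of_indep h 0 1 0
    obtain ⟨c, c1, c2, c3⟩ := exists_form_of_indep h 0 0 1
    -- In the coordinates `a, b, c` with respect to `x, e, p` the arc satisfies `b² = a c`; this is
    -- the polar form of `2 (b² - a c)`.
    set B : LinearMap.BilinForm ℝ V4 :=
      (2 : ℝ) • b.smulRight b - a.smulRight c - c.smulRight a with hB
    have hBa : ∀ v w, B v w = 2 * (b v * b w) - a v * c w - c v * a w := by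
      intro v w
      simp [hB]
    have hs : ∀ v w, B v w = B w v := fun v w => by rw [hBa, hBa]; ring
    have hm : ∀ y ∈ ({x, e, p} : Set V4), y ∈ Submodule.span ℝ {x, e, p} :=
      fun y hy => Submodule.subset_span hy
    have key : ∀ v ∈ Submodule.span ℝ {x, e, p},
        (∀ w ∈ Submodule.span ℝ {x, e, p}, B v w = 0) → v = 0 := by
      intro v hv hw
      obtain ⟨r, s, t, rfl⟩ := Submodule.mem_span_triple.1 hv
      have w1 := hw x (hm x (by simp))
      have w2 := hw e (hm e (by simp))
      have w3 := hw p (hm p (by simp))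
      simp [hBa, a1, a2, a3, b1, b2, b3, c1, c2, c3] at w1 w2 w3
      simp [w1, w2, w3]
    refine ⟨Submodule.span ℝ {x, e, p}, B, finrank_span_triple h, ⟨fun v w => hs v w⟩,
      ⟨fun v hv => ?_, fun v hv => ?_⟩, fun t _ => ⟨?_, ?_⟩⟩
    · exact Subtype.ext (key v v.2 fun w hw => by simpa using hv ⟨w, hw⟩)
    · exact Subtype.ext (key v v.2 fun w hw => by rw [hs]; simpa using hv ⟨w, hw⟩)
    · exact Submodule.mem_span_triple.2 ⟨_, _, _, rfl⟩
    · rw [hBa]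
      simp only [bezierConic, map_add, map_smul, smul_eq_mul, a1, a2, a3, b1, b2, b3, c1, c2, c3]
      ring

theorem mem_supportingPlane_bezierConic (L : V4 →ₗ[ℝ] V4) (x e p : V4) :
    L e ∈ supportingPlane fun t => L (bezierConic x e p t) := by
  have hm := fun t ht => IsConicArc.mem_supportingPlane
    (γ := fun t => L (bezierConic x e p t)) (t := t) ht
  have key : e = (4 : ℝ) • bezierConic x e p (1 / 2) - bezierConic x e p 0 -
      bezierConic x e p 1 := by
    rw [bezierConic_zero, bezierConic_one, bezierConic]
    module
  have : L e = (4 : ℝ) • L (bezierConic x e p (1 / 2)) - L (bezierConic x e p 0) -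
      L (bezierConic x e p 1) := by
    rw [← map_smul, ← map_sub, ← map_sub, ← key]
  rw [this]
  exact Submodule.sub_mem _ (Submodule.sub_mem _
    (Submodule.smul_mem _ _ (hm (1 / 2) (by norm_num))) (hm 0 zero_mem_I)) (hm 1 one_mem_I)

/-- A vector space over an infinite field is not a finite union of proper subspaces. -/
theorem exists_notMem_four {A B C D : Submodule ℝ V4} (hA : finrank ℝ A = 3)
    (hB : finrank ℝ B = 3) (hC : finrank ℝ C = 3) (hD : finrank ℝ D = 3) :
    ∃ e, e ∉ A ∧ e ∉ B ∧ e ∉ C ∧ e ∉ D := by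
  by_contra! hc
  obtain ⟨i, hi⟩ := Subspace.exists_eq_top_of_iUnion_eq_univ (p := ![A, B, C, D]) (by
    refine Set.eq_univ_of_forall fun e => Set.mem_iUnion.2 ?_
    by_cases h1 : e ∈ A
    · exact ⟨0, h1⟩
    by_cases h2 : e ∈ B
    · exact ⟨1, h2⟩
    by_cases h3 : e ∈ C
    · exact ⟨2, h3⟩
    exact ⟨3, hc e h1 h2 h3⟩)
  have : ∀ W : Submodule ℝ V4, finrank ℝ W = 3 → W ≠ ⊤ := by
    rintro W hW rfl
    simp at hW
  fin_cases i
  exacts [this A hA hi, this B hB hi, this C hC hi, this D hD hi]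

/-- If the plane of the conic contained `y`, it would contain `x, p, b` and so equal `W`, but it
also contains the control point `e`. -/
theorem notMem_supportingPlane_bezierConic {x e p b y : V4} {W : Submodule ℝ V4}
    (hW : finrank ℝ W = 3) (h : LinearIndependent ℝ ![x, e, p])
    (hi : LinearIndependent ℝ ![x, p, b])
    (hx : x ∈ W) (hp : p ∈ W) (hb : b ∈ W) (he : e ∉ W) {α γ : ℝ} (hγ : γ ≠ 0)
    (hy : y = α • x + γ • b) : y ∉ supportingPlane (bezierConic x e p) := by
  intro hm
  have hc := isConicArc_bezierConic h
  have h0 : x ∈ supportingPlane (bezierConic x e p) := by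
    simpa [bezierConic_zero] using
      IsConicArc.mem_supportingPlane (γ := bezierConic x e p) zero_mem_I
  have h1 : p ∈ supportingPlane (bezierConic x e p) := by
    simpa [bezierConic_one] using IsConicArc.mem_supportingPlane (γ := bezierConic x e p) one_mem_I
  have h2 : b ∈ supportingPlane (bezierConic x e p) := by
    refine (Submodule.smul_mem_iff _ hγ).1 ?_
    have : γ • b = y - α • x := by rw [hy]; module
    rw [this]
    exact Submodule.sub_mem _ hm (Submodule.smul_mem _ _ h0)
  have e1 := plane_eq hc.finrank_supportingPlane hW hi h0 h1 h2 hx hp hb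
  exact he (e1 ▸ mem_supportingPlane_bezierConic LinearMap.id x e p)

/-- A patch over a planar quadrilateral with boundary curves through `x` whose tangents pass through
points `e₁`, `e₂` outside the plane of the quadrilateral. -/
theorem exists_patch_of_quad {x b₁ b₂ q e₁ e₂ : V4} (hn : LinearIndependent ℝ ![x, b₁, b₂])
    (h₁ : LinearIndependent ℝ ![x, b₁, q]) (h₂ : LinearIndependent ℝ ![x, b₂, q])
    (h₃ : LinearIndependent ℝ ![b₁, b₂, q]) (hq : q ∈ Submodule.span ℝ {x, b₁, b₂})
    (he₁ : e₁ ∉ Submodule.span ℝ {x, b₁, b₂}) (he₂ : e₂ ∉ Submodule.span ℝ {x, b₁, b₂}) :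
    ∃ F, AdaptedTo F x b₁ q b₂ ∧ (∀ t ∈ Icc (0 : ℝ) 1,
        Submodule.span ℝ {F t 0} = Submodule.span ℝ {bezierConic x e₁ b₁ t} ∧
        Submodule.span ℝ {F 0 t} = Submodule.span ℝ {bezierConic x e₂ b₂ t}) ∧
      e₁ ∈ (supportingPlane fun t => F t 0) ∧ e₁ ∈ (supportingPlane fun t => F t 1) ∧
      e₂ ∈ (supportingPlane fun t => F 0 t) ∧ e₂ ∈ supportingPlane fun t => F 1 t := by
  obtain ⟨α, β, γ, hqe⟩ := Submodule.mem_span_triple.1 hq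
  have hx : x ∈ Submodule.span ℝ {x, b₁, b₂} := Submodule.subset_span (by simp)
  have hb₁ : b₁ ∈ Submodule.span ℝ {x, b₁, b₂} := Submodule.subset_span (by simp)
  have hb₂ : b₂ ∈ Submodule.span ℝ {x, b₁, b₂} := Submodule.subset_span (by simp)
  have hα : α ≠ 0 := by
    rintro rfl
    have := (indep_triple_iff.1 h₃ β γ (-1) (by rw [← hqe]; module)).2.2
    norm_num at this
  have hβ : β ≠ 0 := by
    rintro rfl
    have := (indep_triple_iff.1 h₂ α γ (-1) (by rw [← hqe]; module)).2.2
    norm_num at this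
  have hγ : γ ≠ 0 := by
    rintro rfl
    have := (indep_triple_iff.1 h₁ α β (-1) (by rw [← hqe]; module)).2.2
    norm_num at this
  have hi₁ : LinearIndependent ℝ ![x, e₁, b₁] := indep_swap_of_triple
    (indep_triple_of_notMem (indep_pair_of_triple hn) fun h => he₁ (span_pair_le hx hb₁ h))
  have hi₂ : LinearIndependent ℝ ![x, e₂, b₂] := indep_swap_of_triple
    (indep_triple_of_notMem (indep_pair_of_triple (indep_swap_of_triple hn))
      fun h => he₂ (span_pair_le hx hb₂ h))
  -- With centre `y = α x + γ b₂ = q - β b₁`, the Laplace point of the sides `x b₂` and `b₁ q`,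
  -- these values send `x` to a multiple of `b₂` and `b₁` to a multiple of `q`. The value zero fixes
  -- `e₁`, which therefore stays in the opposite boundary plane. The form `m` and the centre `z` are
  -- the analogue for the other pair of sides.
  obtain ⟨l, lx, le, lb⟩ := exists_form_of_indep hi₁ (-α⁻¹) 0 β⁻¹
  obtain ⟨m, mx, me, mb⟩ := exists_form_of_indep hi₂ (-α⁻¹) 0 γ⁻¹
  set y := α • x + γ • b₂ with hy
  set z := α • x + β • b₁ with hz
  have c1 : b₁ = (-(α * β⁻¹)) • (x + m x • z) := by
    rw [mx, hz, smul_add, smul_smul, smul_add, smul_smul, smul_smul]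
    have k1 : -(α * β⁻¹) * -α⁻¹ * α = α * β⁻¹ := by field_simp
    have k2 : -(α * β⁻¹) * -α⁻¹ * β = 1 := by field_simp
    rw [k1, k2]
    module
  have c2 : b₂ = (-(α * γ⁻¹)) • (x + l x • y) := by
    rw [lx, hy, smul_add, smul_smul, smul_add, smul_smul, smul_smul]
    have k1 : -(α * γ⁻¹) * -α⁻¹ * α = α * γ⁻¹ := by field_simp
    have k2 : -(α * γ⁻¹) * -α⁻¹ * γ = 1 := by field_simp
    rw [k1, k2]
    module
  have c3 : b₁ + l b₁ • y = β⁻¹ • q := by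
    have : β⁻¹ • q = (β⁻¹ * β) • b₁ + β⁻¹ • y := by rw [← hqe, hy]; module
    rw [this, inv_mul_cancel₀ hβ, one_smul, lb]
  have c4 : b₂ + m b₂ • z = γ⁻¹ • q := by
    have : γ⁻¹ • q = (γ⁻¹ * γ) • b₂ + γ⁻¹ • z := by rw [← hqe, hz]; module
    rw [this, inv_mul_cancel₀ hγ, one_smul, mb]
  have d1 : Submodule.span ℝ {b₁} = Submodule.span ℝ {x + m x • z} := by
    conv_lhs => rw [c1]
    exact span_smul_eq (neg_ne_zero.2 (mul_ne_zero hα (inv_ne_zero hβ))) _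
  have d2 : Submodule.span ℝ {b₂} = Submodule.span ℝ {x + l x • y} := by
    conv_lhs => rw [c2]
    exact span_smul_eq (neg_ne_zero.2 (mul_ne_zero hα (inv_ne_zero hγ))) _
  have d3 : Submodule.span ℝ {b₁ + l b₁ • y} = Submodule.span ℝ {q} := by
    rw [c3, span_smul_eq (inv_ne_zero hβ)]
  have d4 : Submodule.span ℝ {b₂ + m b₂ • z} = Submodule.span ℝ {q} := by
    rw [c4, span_smul_eq (inv_ne_zero hγ)]
  obtain ⟨F, hF, hb⟩ := exists_patch (l := l) (m := m) (b := x) (y := y) (z := z)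
    (isConicArc_bezierConic hi₁)
    (isConicArc_bezierConic hi₂) (contDiff_bezierConic _ _ _) (contDiff_bezierConic _ _ _)
    (by rw [bezierConic_zero]) (by rw [bezierConic_zero]) (by rwa [bezierConic_one])
    (by rwa [bezierConic_one]) (by rw [bezierConic_one, bezierConic_one, d3, d4])
    (notMem_supportingPlane_bezierConic (finrank_span_triple hn) hi₁ hn hx hb₁ hb₂ he₁ hγ hy)
    (notMem_supportingPlane_bezierConic (finrank_span_triple hn) hi₂ (indep_swap_of_triple hn)
      hx hb₂ hb₁ he₂ hβ hz)
  have b0 := hb 0 zero_mem_I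
  have b1 := hb 1 one_mem_I
  have plane : ∀ {δ : ℝ → V4} {e b : V4} (L : V4 →ₗ[ℝ] V4), L e = e → (∀ t ∈ Icc (0 : ℝ) 1,
      Submodule.span ℝ {δ t} = Submodule.span ℝ {L (bezierConic x e b t)}) →
      e ∈ supportingPlane δ := by
    intro δ e b L he h
    rw [supportingPlane_eq_of_arc_eq (arc_congr h)]
    have := mem_supportingPlane_bezierConic L x e b
    rwa [he] at this
  refine ⟨F, ⟨hF, ?_, ?_, ?_, ?_⟩, fun t ht => ⟨(hb t ht).1, (hb t ht).2.2.1⟩, ?_, ?_, ?_, ?_⟩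
  · rw [b0.1, bezierConic_zero]
  · rw [b1.1, bezierConic_one]
  · rw [b1.2.1, bezierConic_one, d3]
  · rw [b1.2.2.1, bezierConic_one]
  · exact plane (b := b₁) LinearMap.id rfl fun t ht => (hb t ht).1
  · exact plane (b := b₁) (persp l y) (by simp [persp_apply, le]) fun t ht => (hb t ht).2.1
  · exact plane (b := b₂) LinearMap.id rfl fun t ht => (hb t ht).2.2.1
  · exact plane (b := b₂) (persp m z) (by simp [persp_apply, me]) fun t ht => (hb t ht).2.2.2

/-- One control point per direction serves both patches at the common edge, so their boundary curves
agree. It also lies in the opposite boundary planes, so avoiding the two near and two far planes of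
the faces parallel to this direction settles all genericity conditions. -/
theorem exists_isCauchyData {x : RP3} {x₁ x₂ : Fin 3 → RP3} (hV : VerticesGeneric x x₁ x₂)
    (hp : ∀ k, (x₂ k).rep ∈ nearSpan x.rep (fun i => (x₁ i).rep) k) :
    ∃ f, IsCauchyData x x₁ x₂ f := by
  have hG := genericVectors hV hp
  have he := fun i => exists_notMem_four (hG.finrank_near (i + 1)) (hG.finrank_near (i + 2))
    (hG.finrank_far (i + 1)) (hG.finrank_far (i + 2))
  choose e e1 e2 e3 e4 using he
  have n1 : ∀ k, e (k + 1) ∉ nearSpan x.rep (fun i => (x₁ i).rep) k := fun k => by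
    have := e2 (k + 1)
    rwa [fin3_one_two] at this
  have n2 : ∀ k, e (k + 2) ∉ nearSpan x.rep (fun i => (x₁ i).rep) k := fun k => by
    have := e1 (k + 2)
    rwa [fin3_two_one] at this
  have g1 : ∀ k, e (k + 1) ∉ farSpan (fun i => (x₁ i).rep) (fun i => (x₂ i).rep) (k + 2) :=
    fun k => by
      have := e3 (k + 1)
      rwa [fin3_one_one] at this
  have g2 : ∀ k, e (k + 2) ∉ farSpan (fun i => (x₁ i).rep) (fun i => (x₂ i).rep) (k + 1) :=
    fun k => by
      have := e4 (k + 2)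
      rwa [fin3_two_two] at this
  choose f hf hb s1 s2 s3 s4 using fun k => exists_patch_of_quad (hG.near k) (hG.left k)
    (hG.right k) (hG.opposite k) (hG.planar k) (n1 k) (n2 k)
  refine ⟨f, fun k => isAdaptedSCPatch_iff.2 (hf k), fun i => ?_, hV, fun k => ?_, fun k => ?_⟩
  · refine arc_congr fun t ht => ?_
    have h1 := (hb (i + 1) t ht).2
    have h2 := (hb (i + 2) t ht).1
    rw [fin3_one_two] at h1
    rw [fin3_two_one] at h2
    exact h2.trans h1.symm
  · rw [nearPlane_eq]
    exact ⟨fun h => n1 k (h ▸ s1 k), fun h => n1 k (h ▸ s2 k), fun h => n2 k (h ▸ s3 k),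
      fun h => n2 k (h ▸ s4 k)⟩
  · rw [farPlane_eq, farPlane_eq]
    exact ⟨fun h => g1 k (h ▸ s2 k), fun h => g2 k (h ▸ s4 k)⟩

end Supercyclidic

/-! ### Both parts of the theorem, from the statement for a fixed Q-cube -/

open Supercyclidic in
theorem mainTheorem1 :
    (∀ (x : RP3) (x₁ x₂ : Fin 3 → RP3) (f : Fin 3 → ℝ → ℝ → V4), IsCauchyData x x₁ x₂ f →
      ∃ (X : (Fin 3 → Fin 2) → RP3) (F : Fin 3 → Fin 2 → ℝ → ℝ → V4),
        (IsSCCube X F ∧ ∀ k, F k 0 = f k) ∧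
        ∀ (X' : (Fin 3 → Fin 2) → RP3) (F' : Fin 3 → Fin 2 → ℝ → ℝ → V4),
          (IsSCCube X' F' ∧ ∀ k, F' k 0 = f k) →
            X' = X ∧ ∀ k, SamePatch (F k 1) (F' k 1)) ∧
    (∀ X : (Fin 3 → Fin 2) → RP3, IsQCube X →
      VerticesGeneric (vertex0 X) (vertex1 X) (vertex2 X) →
        (∃ f : Fin 3 → ℝ → ℝ → V4, IsCauchyData (vertex0 X) (vertex1 X) (vertex2 X) f) ∧
        ∀ f : Fin 3 → ℝ → ℝ → V4, IsCauchyData (vertex0 X) (vertex1 X) (vertex2 X) f →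
          ∃ F : Fin 3 → Fin 2 → ℝ → ℝ → V4,
            (IsSCCube X F ∧ ∀ k, F k 0 = f k) ∧
            ∀ F' : Fin 3 → Fin 2 → ℝ → ℝ → V4,
              (IsSCCube X F' ∧ ∀ k, F' k 0 = f k) → ∀ k, SamePatch (F k 1) (F' k 1)) := by
  have main : ∀ X : (Fin 3 → Fin 2) → RP3, IsQCube X → ∀ f : Fin 3 → ℝ → ℝ → V4,
      IsCauchyData (vertex0 X) (vertex1 X) (vertex2 X) f →
      ∃ F : Fin 3 → Fin 2 → ℝ → ℝ → V4, (IsSCCube X F ∧ ∀ k, F k 0 = f k) ∧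
        ∀ F' : Fin 3 → Fin 2 → ℝ → ℝ → V4,
          (IsSCCube X F' ∧ ∀ k, F' k 0 = f k) → ∀ k, SamePatch (F k 1) (F' k 1) := by
    intro X hX f hf
    have ht := ((isQCube_iff_mem hf.vertices).1 hX).2
    have hc := hf.cauchyPatches
    obtain ⟨g, hg⟩ := hc.exists_farPatches ht (X 1).rep_nonzero
    refine ⟨cubePatches f g, ⟨isSCCube_of_farPatches hX hc hg, fun _ => rfl⟩, ?_⟩
    rintro F' ⟨hF', hf'⟩ k
    have hg' := hF'.farPatches
    rw [funext hf'] at hg'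
    exact hg.samePatch hg' hc ht k
  refine ⟨fun x x₁ x₂ f hf => ?_, fun X hX hV => ⟨?_, main X hX⟩⟩
  · have hG := hf.cauchyPatches.generic
    obtain ⟨t, ht0, ht⟩ := hG.exists_last
    obtain ⟨T, hT⟩ : ∃ T : RP3, ∀ k,
        T.rep ∈ farSpan (fun i => (x₁ i).rep) (fun i => (x₂ i).rep) k := by
      refine ⟨Projectivization.mk ℝ t ht0, fun k => (mem_iff_of_span_eq ?_ _).1 (ht k)⟩
      rw [← Projectivization.submodule_mk t ht0, Projectivization.submodule_eq]
    have hf₁ : IsCauchyData (vertex0 (cubeOf x x₁ x₂ T)) (vertex1 (cubeOf x x₁ x₂ T))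
        (vertex2 (cubeOf x x₁ x₂ T)) f := by
      rwa [vertex0_cubeOf, vertex1_cubeOf, vertex2_cubeOf]
    have hX : IsQCube (cubeOf x x₁ x₂ T) := by
      rw [isQCube_iff_mem hf₁.vertices, vertex0_cubeOf, vertex1_cubeOf, vertex2_cubeOf]
      exact ⟨hG.planar, hT⟩
    obtain ⟨F, hF, hu⟩ := main _ hX f hf₁
    refine ⟨cubeOf x x₁ x₂ T, F, hF, fun X' F' hF' => ?_⟩
    -- The patches fix seven vertices of any competing cube; planarity of its far faces fixes the
    -- eighth.
    obtain ⟨v0, v1, v2⟩ := hF'.1.vertices_eq fun k => (hF'.2 k).symm ▸ hf.adapted k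
    have hX' : X' = cubeOf x x₁ x₂ T := by
      refine cube_ext v0 (v1.trans (vertex1_cubeOf _ _ _ _).symm)
        (v2.trans (vertex2_cubeOf _ _ _ _).symm) (rep_injective ?_)
      have hV : VerticesGeneric (vertex0 X') (vertex1 X') (vertex2 X') := by
        rw [v0, v1, v2]
        exact hf.vertices
      have hm := ((isQCube_iff_mem hV).1 hF'.1.planar).2
      rw [v1, v2] at hm
      exact hG.last_unique hm hT (X' 1).rep_nonzero T.rep_nonzero
    subst hX'
    exact ⟨rfl, hu F' hF'⟩
  · exact exists_isCauchyData hV ((isQCube_iff_mem hV).1 hX).1
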